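/- **Setting.** A block MDP has horizon $H\ge1$, observation space $\mathcal S$ (a measurable space), finite action space $\mathcal A$, finite latent space $\mathcal Z$ (both non-empty), initial distribution $d_0$, latent transitions $T_h(z'\mid z,a)$, emissions $o_h(\cdot\mid z)$ and decoders $\psi^\star_h:\mathcal S\to\mathcal Z$ with $\psi^\star_h(s)=z$ for $o_h(\cdot\mid z)$-almost every $s$; $P^\star_h(\cdot\mid s,a)=\sum_{z'}T_h(z'\mid\psi^\star_h(s),a)\,o_{h+1}(\cdot\mid z')$. Rewards $r_h\ge0$ are known, with cumulative reward at most $1$ on every trajectory. Put $d=|\mathcal Z||\mathcal A|$. Finite classes $\Phi_h$ of one-hot features $\phi(s,a)=e_{(\psi(s),a)}$, $\psi:\mathcal S\to\mathcal Z$ measurable, satisfy $\phi^\star_h=e_{(\psi^\star_h(s),a)}\in\Phi_h$ for $0\le h<H$; $|\Phi|=\max_{h<H}|\Phi_h|$. For a (possibly unnormalized) model $P$, $V^\pi_{P,r}=\mathbb E_{s\sim d_0}V_0(s)$ with $V_H=0$, $V_h(s)=\sum_a\pi_h(a|s)\big(r_h(s,a)+P_h(\cdot|s,a)^\top V_{h+1}\big)$.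 Let $\pi^\star$ be an optimal policy for $(P^\star,r)$, and $d^\pi_h$ the law of the state at step $h$ under $\pi$ in $P^\star$. **Algorithm.** Start with an arbitrary policy $\hat\pi^0$. In iteration $n=1,\dots,N$, for each $h<H$, given the past, add to $\mathcal D_h$ a triple $(s,a,s')$ with $s\sim d^{\hat\pi^{n-1}}_h$, $a$ uniform, $s'\sim P^\star_h(s,a)$, and, if $h\ge1$, add to $\mathcal D'_h$ a triple $(\tilde s',\tilde a',\tilde s'')$ with $\tilde s\sim d^{\hat\pi^{n-1}}_{h-1}$, $\tilde a$ uniform, $\tilde s'\sim P^\star_{h-1}(\tilde s,\tilde a)$, $\tilde a'$ uniform, $\tilde s''\sim P^\star_h(\tilde s',\tilde a')$ ($\mathcal D'_0=\emptyset$). Then features $\hat\phi^n_h\in\Phi_h$ are selected from the data. With $\Sigma_h=\sum_{\mathcal D_h}\hat\phi^n_h\hat\phi_h^{n\top}+\lambda_nI$, the bonus is $\hat b^n_h=\min\{\alpha_n\sqrt{\hat\phi_h^{n\top}\Sigma_h^{-1}\hat\phi^n_h},2\}$. With $\bar\Sigma_h=\sum_{\mathcal D_h\cup\mathcal D_h'}\hat\phi^n_h\hat\phi_h^{n\top}+\lambda_nI$,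 the learned model is $\hat P^n_h(\cdot|s,a)^\top f=\hat\phi^n_h(s,a)^\top\bar\Sigma_h^{-1}\sum_{(\tilde s,\tilde a,\tilde s')\in\mathcal D_h\cup\mathcal D'_h}\hat\phi^n_h(\tilde s,\tilde a)f(\tilde s')$. Finally $\hat\pi^n$ is returned by least-squares value iteration with rewards $r+\hat b^n$, features $\hat\phi^n$, data $\mathcal D\cup\mathcal D'$ and regularization $\lambda_n$. **RepLearn guarantee at iteration $n$ with accuracy $\zeta_n\ge 0$:** for all $h$ with $h+1<H$ and all $f\in\mathcal F_h$, $\mathbb E_{(s,a)\sim\rho}\big[(\hat P^n_h(\cdot|s,a)^\top f-P^\star_h(\cdot|s,a)^\top f)^2\big]\le\zeta_n$ for $\rho=\rho^n_h$ and, if $h\ge1$, for $\rho=\beta^n_h$. Here $\rho^n_h$ is the average over $i<n$ of the laws of $(s,a)$, $s\sim d^{\hat\pi^i}_h$, $a$ uniform; $\beta^n_h$ is the average over $i<n$ of the laws of $(s,a)$, $s\sim P^\star_{h-1}(\tilde s,\tilde a)$, $\tilde s\sim d^{\hat\pi^i}_{h-1}$, $\tilde a,a$ uniform. The class $\mathcal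 F_h$ consists of all functions $s\mapsto\mathbb E_{a\sim U(\mathcal A)}[\phi(s,a)^\top\theta-\phi'(s,a)^\top\theta']$ and all functions $s\mapsto\max_a\Big(\frac{r_{h+1}(s,a)+\min\{w^\top\phi(s,a),2\}}{2H+1}+w'^\top\phi(s,a)\Big)$, with $\phi,\phi'\in\Phi_{h+1}$, $\|\theta\|_\infty,\|\theta'\|_\infty,\|w'\|_\infty\le1$, $\|w\|_\infty\le\alpha_N/\sqrt{\lambda_N}$. **Lemma (almost optimism).** For every $\kappa>0$ there is $c_0>0$, depending on $\kappa$ only, such that the following holds for every $0<c\le c_0$. Let $\delta\in(0,1)$ with $2\delta\le|\Phi|$ (a restriction only if $|\Phi|=1$), let $\lambda_n\ge\kappa\,d\ln(|\Phi|n/\delta)$ (in particular, any $\lambda_n=\Theta(d\ln(|\Phi|n/\delta))$ with lower constant $\kappa$), $\zeta_n\ge0$, and $$\alpha_n=\tfrac1c\sqrt{n|\mathcal A|^2\zeta_n+4\lambda_nd+n\zeta_n}.$$ Then there is an event of probability at least $1-\delta$ on which, for all $n=1,\dots,N$ at which the RepLearn guarantee holds, $$V^{\pi^\star}_{\hat P^n,r+\hat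 b^n}\ge V^{\pi^\star}_{P^\star,r}-\sqrt{|\mathcal A|\zeta_n}\qquad\text{and}\qquad V^{\hat\pi^n}_{\hat P^n,r+\hat b^n}\ge V^{\pi^\star}_{P^\star,r}-\sqrt{|\mathcal A|\zeta_n}.$$ Consequently, if $\zeta_n\le B\,d^2\sqrt{\ln(n|\Phi|/\delta)/n}$ with $B\ge0$, then $V^{\hat\pi^n}_{\hat P^n,r+\hat b^n}\ge V^{\pi^\star}_{P^\star,r}-\sigma_n$ with $\sigma_n=\sqrt B\,|\mathcal A|^{1/2}d\,\big(\ln(n|\Phi|/\delta)/n\big)^{1/4}$. -/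

import Mathlib

open MeasureTheory
open scoped ENNReal Matrix

noncomputable section

namespace Briee

/-! ### Block MDPs, policies, values -/

/-- An episodic block MDP of horizon `H` with observation space `S` (an arbitrary measurable
space), finite action space `A` and finite latent space `Z`. The observation at step `h` is emitted
by `o h z`, where `z` is the latent state at step `h`, and the decoder `ψ h` recovers `z` from it. -/
structure BlockMDP (S A Z : Type*) [MeasurableSpace S] [Fintype A] [Fintype Z] where
  /-- horizon -/
  H : ℕ
  H_pos : 0 < H
  /-- initial state distribution -/
  d₀ : Measure S
  d₀_prob : IsProbabilityMeasure d₀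
  /-- rewards -/
  r : ℕ → S → A → ℝ
  r_meas : ∀ h a, Measurable fun s => r h s a
  r_nonneg : ∀ h s a, 0 ≤ r h s a
  /-- latent transitions `T h z a z'`, the probability of `z'` given `(z, a)` -/
  T : ℕ → Z → A → Z → ℝ
  T_nonneg : ∀ h z a z', 0 ≤ T h z a z'
  T_sum : ∀ h z a, ∑ z', T h z a z' = 1
  /-- emission distributions -/
  o : ℕ → Z → Measure S
  o_prob : ∀ h z, IsProbabilityMeasure (o h z)
  /-- the true decoder -/
  ψ : ℕ → S → Z
  ψ_meas : ∀ h z, MeasurableSet (ψ h ⁻¹' {z})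
  /-- block structure: emissions of distinct latent states live on disjoint blocks -/
  o_decode : ∀ h z, ∀ᵐ s ∂(o h z), ψ h s = z
  /-- normalization: the cumulative reward of every trajectory of the MDP is at most one -/
  reward_le : ∀ (s : ℕ → S) (a : ℕ → A),
    (∀ h, h + 1 < H → 0 < T h (ψ h (s h)) (a h) (ψ (h + 1) (s (h + 1)))) →
      ∑ h ∈ Finset.range H, r h (s h) (a h) ≤ 1

/-- A non-stationary (possibly randomized) Markov policy: `prob h s a` is `π_h(a | s)`. -/
structure Policy (S A : Type*) [MeasurableSpace S] [Fintype A] where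
  prob : ℕ → S → A → ℝ
  nonneg : ∀ h s a, 0 ≤ prob h s a
  sum_eq_one : ∀ h s, ∑ a, prob h s a = 1
  meas : ∀ h a, Measurable fun s => prob h s a

/-- The policy that plays uniformly random actions. -/
def uniformPolicy (S A : Type*) [MeasurableSpace S] [Fintype A] [Nonempty A] : Policy S A where
  prob := fun _ _ _ => (Fintype.card A : ℝ)⁻¹
  nonneg := fun _ _ _ => by positivity
  sum_eq_one := fun _ _ => by simp
  meas := fun _ _ => measurable_const

/-- A (possibly unnormalized) transition model, given by its action on functions:
`P h s a f` is `P_h(· | s, a)ᵀ f`. -/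
abbrev Model (S A : Type*) := ℕ → S → A → (S → ℝ) → ℝ

section Values

variable {S A Z : Type*} [MeasurableSpace S] [Fintype A] [Fintype Z]

/-- The value function of `π` in the model `P` with rewards `r`, with `k` steps to go,
at step `h`. -/
def valueFrom (P : Model S A) (r : ℕ → S → A → ℝ) (π : Policy S A) : ℕ → ℕ → S → ℝ
  | 0, _, _ => 0
  | k + 1, h, s => ∑ a, π.prob h s a * (r h s a + P h s a (valueFrom P r π k (h + 1)))

namespace BlockMDP

variable (M : BlockMDP S A Z)

/-- The true transition distribution `P⋆_h(· | s, a)`. -/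
def trans (h : ℕ) (s : S) (a : A) : Measure S :=
  ∑ z', ENNReal.ofReal (M.T h (M.ψ h s) a z') • M.o (h + 1) z'

/-- The true transitions as a model. -/
def trueModel : Model S A := fun h s a f => ∫ s', f s' ∂(M.trans h s a)

/-- `V^π_{P,r}`: the expected total reward of `π` in the model `P` with rewards `r`, from the
initial distribution of `M` and over its horizon. -/
def value (P : Model S A) (r : ℕ → S → A → ℝ) (π : Policy S A) : ℝ :=
  ∫ s, valueFrom P r π M.H 0 s ∂M.d₀

/-- `π` is an optimal policy of the true MDP. -/
def IsOptimal (π : Policy S A) : Prop :=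
  ∀ π' : Policy S A, M.value M.trueModel M.r π' ≤ M.value M.trueModel M.r π

/-! ### Occupancies and sampling distributions in the true MDP -/

/-- The law of the state at step `h + 1` if the state at step `h` has law `ν` and the action at
step `h` is drawn from `π`. -/
def nextDist (π : Policy S A) (h : ℕ) (ν : Measure S) : Measure S :=
  ν.bind fun s => ∑ a, ENNReal.ofReal (π.prob h s a) • M.trans h s a

/-- The state occupancy `d^π_h`. -/
def stateDist (π : Policy S A) : ℕ → Measure S
  | 0 => M.d₀
  | h + 1 => M.nextDist π h (stateDist π h)

end BlockMDP

/-- The law of `(s, a)` with `s ∼ ν` and an independent uniform action `a`. -/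
def withUniform (A : Type*) [Fintype A] [MeasurableSpace A] (ν : Measure S) : Measure (S × A) :=
  ν.prod ((Fintype.card A : ℝ≥0∞)⁻¹ • Measure.count)

namespace BlockMDP

variable (M : BlockMDP S A Z) [MeasurableSpace A]

/-- The law of `(s, a, s')` with `s ∼ ν`, `a` uniform and `s' ∼ P⋆_h(· | s, a)`. -/
def tripleLaw (h : ℕ) (ν : Measure S) : Measure (S × A × S) :=
  (withUniform A ν).bind fun p => (M.trans h p.1 p.2).map fun s' => (p.1, p.2, s')

/-- The law of the state at step `h ≥ 1` if `π` is followed up to step `h - 1`, where a uniform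
action is played instead. -/
def exploreDist [Nonempty A] (π : Policy S A) (h : ℕ) : Measure S :=
  M.nextDist (uniformPolicy S A) (h - 1) (M.stateDist π (h - 1))

/-- `ρ^n_h` for the policies `π 0, …, π (n-1)`. -/
def rho (π : ℕ → Policy S A) (n h : ℕ) : Measure (S × A) :=
  (n : ℝ≥0∞)⁻¹ • ∑ i ∈ Finset.range n, withUniform A (M.stateDist (π i) h)

/-- `β^n_h` (for `h ≥ 1`) for the policies `π 0, …, π (n-1)`. -/
def beta [Nonempty A] (π : ℕ → Policy S A) (n h : ℕ) : Measure (S × A) :=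
  (n : ℝ≥0∞)⁻¹ • ∑ i ∈ Finset.range n, withUniform A (M.exploreDist (π i) h)

end BlockMDP

end Values

/-! ### One-hot features, ridge regression, bonus, learned model, LSVI -/

section Learning

variable {S A Z : Type*} [Fintype A] [Fintype Z]

/-- A finite data set of transitions `(s, a, s')`, with multiplicities. -/
abbrev Dataset (S A : Type*) := Multiset (S × A × S)

open Classical in
/-- The one-hot feature `φ(s, a) = e_{(ψ(s), a)}` of the decoder `ψ`. -/
def feat (ψ : S → Z) (s : S) (a : A) : Z × A → ℝ :=
  fun x => if x = (ψ s, a) then 1 else 0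

open Classical in
/-- The regularized empirical covariance `∑ φ φᵀ + lam I` over the data set `D`. -/
def cov (ψ : S → Z) (D : Dataset S A) (lam : ℝ) : Matrix (Z × A) (Z × A) ℝ :=
  (D.map fun x => Matrix.vecMulVec (feat ψ x.1 x.2.1) (feat ψ x.1 x.2.1)).sum + lam • 1

open Classical in
/-- The exploration bonus `min {alpha ‖φ(s, a)‖_{Σ⁻¹}, 2}`. -/
def bonus (ψ : S → Z) (D : Dataset S A) (lam alpha : ℝ) (s : S) (a : A) : ℝ :=
  min (alpha * √(feat ψ s a ⬝ᵥ ((cov ψ D lam)⁻¹ *ᵥ feat ψ s a))) 2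

open Classical in
/-- The ridge regression weights `Σ⁻¹ ∑ φ(s, a) f(s')`. -/
def ridge (ψ : S → Z) (D : Dataset S A) (lam : ℝ) (f : S → ℝ) : Z × A → ℝ :=
  (cov ψ D lam)⁻¹ *ᵥ (D.map fun x => f x.2.2 • feat ψ x.1 x.2.1).sum

/-- The learned non-parametric unnormalized model:
`P̂_h(· | s, a)ᵀ f = φ_h(s, a)ᵀ Σ_h⁻¹ ∑ φ_h(s̃, ã) f(s̃')`. -/
def learnedModel (ψ : ℕ → S → Z) (D : ℕ → Dataset S A) (lam : ℝ) : Model S A :=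
  fun h s a f => feat (ψ h) s a ⬝ᵥ ridge (ψ h) (D h) lam f

variable [Nonempty A]

/-- The value estimates of least-squares value iteration, with `k` steps to go, at step `h`. -/
def lsviV (ψ : ℕ → S → Z) (D : ℕ → Dataset S A) (lam : ℝ) (r : ℕ → S → A → ℝ) :
    ℕ → ℕ → S → ℝ
  | 0, _, _ => 0
  | k + 1, h, s => Finset.univ.sup' Finset.univ_nonempty fun a =>
      ridge (ψ h) (D h) lam (lsviV ψ D lam r k (h + 1)) ⬝ᵥ feat (ψ h) s a + r h s a

/-- The `Q`-estimates of least-squares value iteration over the horizon `H`, at step `h < H`. -/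
def lsviQ (H : ℕ) (ψ : ℕ → S → Z) (D : ℕ → Dataset S A) (lam : ℝ) (r : ℕ → S → A → ℝ)
    (h : ℕ) (s : S) (a : A) : ℝ :=
  ridge (ψ h) (D h) lam (lsviV ψ D lam r (H - (h + 1)) (h + 1)) ⬝ᵥ feat (ψ h) s a + r h s a

/-- `π` is an output of least-squares value iteration, i.e. greedy for its `Q`-estimates
(with any rule for breaking ties). -/
def IsLSVI [MeasurableSpace S] (H : ℕ) (ψ : ℕ → S → Z) (D : ℕ → Dataset S A) (lam : ℝ)
    (r : ℕ → S → A → ℝ) (π : Policy S A) : Prop :=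
  ∀ h < H, ∀ s a, 0 < π.prob h s a →
    ∀ a', lsviQ H ψ D lam r h s a' ≤ lsviQ H ψ D lam r h s a

end Learning

/-! ### Feature classes, discriminators -/

section Classes

variable {S A Z : Type*} [MeasurableSpace S] [Fintype A] [Fintype Z] [Nonempty A]

/-- `|Φ|`, the maximal size of the classes `Φ_0, …, Φ_{H-1}`; a class is given by its decoders. -/
def classSize (H : ℕ) (Φ : ℕ → Finset (S → Z)) : ℕ :=
  (Finset.range H).sup fun h => (Φ h).card

/-- The discriminators `𝓕⁽¹⁾_h` (the norm is the sup norm). -/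
def discr₁ (Φ : ℕ → Finset (S → Z)) (h : ℕ) : Set (S → ℝ) :=
  {f | ∃ ψ ∈ Φ (h + 1), ∃ ψ' ∈ Φ (h + 1), ∃ θ θ' : Z × A → ℝ, ‖θ‖ ≤ 1 ∧ ‖θ'‖ ≤ 1 ∧
    f = fun s => (Fintype.card A : ℝ)⁻¹ * ∑ a : A, (feat ψ s a ⬝ᵥ θ - feat ψ' s a ⬝ᵥ θ')}

/-- The discriminators `𝓕⁽²⁾_h` with radius `C` (the norm is the sup norm). -/
def discr₂ (M : BlockMDP S A Z) (Φ : ℕ → Finset (S → Z)) (C : ℝ) (h : ℕ) : Set (S → ℝ) :=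
  {f | ∃ ψ ∈ Φ (h + 1), ∃ w w' : Z × A → ℝ, ‖w‖ ≤ C ∧ ‖w'‖ ≤ 1 ∧
    f = fun s => Finset.univ.sup' Finset.univ_nonempty fun a : A =>
      (M.r (h + 1) s a + min (w ⬝ᵥ feat ψ s a) 2) / (2 * M.H + 1) + w' ⬝ᵥ feat ψ s a}

/-- The discriminator class `𝓕_h`. -/
def discr (M : BlockMDP S A Z) (Φ : ℕ → Finset (S → Z)) (C : ℝ) (h : ℕ) : Set (S → ℝ) :=
  discr₁ (A := A) Φ h ∪ discr₂ M Φ C h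

end Classes

/-! ### Runs of the algorithm -/

section Run

variable {S A Z Ω : Type*} [MeasurableSpace S] [Fintype A] [Fintype Z]

/-- The first `n` samples of the sequence `X` at each step. -/
def collect (X : ℕ → ℕ → Ω → S × A × S) (n h : ℕ) (ω : Ω) : Dataset S A :=
  (Multiset.range n).map fun i => X i h ω

/-- The joint data set `D_h ∪ D'_h` after `n` iterations; `D'_0` is empty. -/
def collectAll (X Y : ℕ → ℕ → Ω → S × A × S) (n h : ℕ) (ω : Ω) : Dataset S A :=
  collect X n h ω + if h = 0 then 0 else collect Y n h ω

/-- `r + b̂^n`: the true reward plus the bonus computed from `D_h`. -/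
def bonusReward (M : BlockMDP S A Z) (lam alpha : ℝ) (ψ : ℕ → S → Z) (D : ℕ → Dataset S A) :
    ℕ → S → A → ℝ :=
  fun h s a => M.r h s a + bonus (ψ h) (D h) lam alpha s a

variable [Nonempty A] [MeasurableSpace A] [MeasurableSpace Ω]

/-- A run of `N` iterations of the algorithm with regularizations `lam n` and bonus multipliers
`alpha n`. `ℱ n` is the information available after iteration `n` (all data so far, and any
internal randomness). In iteration `i + 1`, given `ℱ i`, the samples `X i h` (for `D_h`) and
`Y i h` (for `D'_h`, `h ≥ 1`) are drawn by rolling in with `π̂^i`; nothing is assumed on their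
joint law for distinct `h`. After iteration `n`, features `ψhat n h` are selected from `Φ_h` by any
rule, and `πhat n` is returned by LSVI; `πhat 0` is arbitrary. -/
structure Run (M : BlockMDP S A Z) (Φ : ℕ → Finset (S → Z)) (N : ℕ) (lam alpha : ℕ → ℝ)
    (μ : Measure Ω) where
  ℱ : Filtration ℕ (inferInstance : MeasurableSpace Ω)
  X : ℕ → ℕ → Ω → S × A × S
  Y : ℕ → ℕ → Ω → S × A × S
  ψhat : ℕ → ℕ → Ω → S → Z
  πhat : ℕ → Ω → Policy S A
  X_meas : ∀ i < N, ∀ h < M.H, Measurable[ℱ (i + 1)] (X i h)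
  Y_meas : ∀ i < N, ∀ h < M.H, 0 < h → Measurable[ℱ (i + 1)] (Y i h)
  ψhat_mem : ∀ n, 1 ≤ n → n ≤ N → ∀ h < M.H, ∀ ω, ψhat n h ω ∈ Φ h
  ψhat_meas : ∀ n, 1 ≤ n → n ≤ N → ∀ h < M.H, ∀ ψ, MeasurableSet[ℱ n] {ω | ψhat n h ω = ψ}
  πhat_meas : ∀ n ≤ N, ∀ h < M.H, ∀ a,
    Measurable[(ℱ n).prod (inferInstance : MeasurableSpace S)]
      fun p : Ω × S => (πhat n p.1).prob h p.2 a
  X_law : ∀ i < N, ∀ h < M.H, ∀ B : Set (S × A × S), MeasurableSet B →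
    μ[(X i h ⁻¹' B).indicator (fun _ => (1 : ℝ)) | ℱ i] =ᵐ[μ]
      fun ω => (M.tripleLaw h (M.stateDist (πhat i ω) h)).real B
  Y_law : ∀ i < N, ∀ h < M.H, 0 < h → ∀ B : Set (S × A × S), MeasurableSet B →
    μ[(Y i h ⁻¹' B).indicator (fun _ => (1 : ℝ)) | ℱ i] =ᵐ[μ]
      fun ω => (M.tripleLaw h (M.exploreDist (πhat i ω) h)).real B
  πhat_lsvi : ∀ n, 1 ≤ n → n ≤ N → ∀ ω,
    IsLSVI M.H (fun h => ψhat n h ω) (fun h => collectAll X Y n h ω) (lam n)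
      (bonusReward M (lam n) (alpha n) (fun h => ψhat n h ω) fun h => collect X n h ω)
      (πhat n ω)

namespace Run

variable {M : BlockMDP S A Z} {Φ : ℕ → Finset (S → Z)} {N : ℕ} {lam alpha : ℕ → ℝ}
  {μ : Measure Ω} (R : Run M Φ N lam alpha μ)

/-- The learned model `P̂^n`. -/
def Phat (n : ℕ) (ω : Ω) : Model S A :=
  learnedModel (fun h => R.ψhat n h ω) (fun h => collectAll R.X R.Y n h ω) (lam n)

/-- The rewards with bonus, `r + b̂^n`. -/
def rhat (n : ℕ) (ω : Ω) : ℕ → S → A → ℝ :=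
  bonusReward M (lam n) (alpha n) (fun h => R.ψhat n h ω) fun h => collect R.X n h ω

/-- The representation learning guarantee at iteration `n` with accuracy `ζ`: for every step `h`
and every discriminator `f ∈ 𝓕_h`, the mean squared error of `P̂_h f` as an estimate of `P⋆_h f` is
at most `ζ` under `ρ_h`, and under `β_h` if `h ≥ 1`. The last step, whose next states lie beyond
the horizon and have no features, is left out. -/
def Guarantee (ζ : ℝ) (n : ℕ) (ω : Ω) : Prop :=
  ∀ h, h + 1 < M.H → ∀ f ∈ discr M Φ (alpha N / √(lam N)) h,
    ∫ p, (R.Phat n ω h p.1 p.2 f - M.trueModel h p.1 p.2 f) ^ 2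
        ∂(M.rho (fun i => R.πhat i ω) n h) ≤ ζ ∧
    (0 < h → ∫ p, (R.Phat n ω h p.1 p.2 f - M.trueModel h p.1 p.2 f) ^ 2
        ∂(M.beta (fun i => R.πhat i ω) n h) ≤ ζ)

end Run

/-- The bonus multiplier `α_n = √(n |A|² ζ_n + 4 lam_n d + n ζ_n) / c`, where `d = |Z| |A|`. -/
def bonusScale (Z A : Type*) [Fintype Z] [Fintype A] (c : ℝ) (lam ζ : ℕ → ℝ) (n : ℕ) : ℝ :=
  √(n * (Fintype.card A : ℝ) ^ 2 * ζ n + 4 * lam n * (Fintype.card Z * Fintype.card A)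
    + n * ζ n) / c

end Run

end Briee

end

/-! With one-hot features, ridge regression decouples. The learned model `P̂ f` at `(s, a)` is a
regularized average of `f` over the samples in the cell of `(s, a)`, the bonus depends only on the
number of samples in that cell, and `P̂` is monotone.

Let `U` be the value of `π⋆` in the true MDP, clipped at one, `Ū` its mean given the latent state,
and `V` the value of `π⋆` in the learned model with bonus. The claim, by backward induction, is `U_h
- V_h ≤ g_h`, where `g_h(s) = max_a |P⋆_h Ū_{h+1} - P̂_h Ū_{h+1}|`. Since `P⋆ U = P⋆ Ū`, the
induction step reduces to `P̂ Ū ≤ b̂ + P̂ V` (`Run.clippedValue_sub_le_gap`,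
`Run.predictedValue_le`). Up to concentration errors, `P̂ Ū ≤ P̂ U ≤ P̂ V + P̂ g_{h+1} ≤ P̂ V + P̂
ḡ_{h+1}`, with `ḡ` the emission mean of `g`. Both `Ū` and `ḡ` are bounded functions of the true
latent state, hence discriminators. The guarantee under `ρ_h` compares `P̂ ḡ` with `P⋆ ḡ = P⋆ g`. By
Jensen the second moment of the latter under `ρ_h` is at most that of `g_{h+1}` under the
exploratory state law, which the guarantee under `β_{h+1}` bounds (`Run.sq_cellMean_gap_le`). For
small `c` the bonus covers all of this. What remains at step 0 is `E g_0 ≤ √(E g_0²) ≤ √(|A| ζ)`,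
because every policy starts from `d₀`.

Concentration: given the latent next state, `G(s')` minus its emission mean is centered, whatever
the roll-in policy and however wrong the decoder that defines the cell. An exponential
supermartingale gives deviations of order `√(λ/(count + λ))`, the scale of the bonus. `U` is fixed
before the data are drawn. `g` is not, but it is determined by a decoder and a vector in
`[0,1]^(Z×A)`; rounding that vector to multiples of `1/n` leaves about `|Φ| (n+1)^d` functions,
whose logarithm `λ` dominates.

The union bound over steps would cost a factor `H`. If `H ≤ n` this is at most `n`. If `H > n`, no
concentration is needed: the bonuses collected over `H` steps already exceed the largest possible
value (`Run.one_le_valueFrom`). Finally, LSVI is exact planning in the learned model, so its policy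
is at least as good there as `π⋆` (`Run.value_le_value_lsvi`). -/

noncomputable section

namespace Briee

/-! ### Conditional laws and lower integrals -/

section Conditional

variable {Ω T : Type*} {m m0 : MeasurableSpace Ω} [MeasurableSpace T] {μ : Measure Ω}
  [IsProbabilityMeasure μ]

/-- The restriction of `μ` to `E` and the measure with density the conditional probability of `E`
agree on `m`, so they integrate every `m`-measurable weight alike. Working with `ℝ≥0∞` avoids
integrability conditions on `W`. -/
lemma lintegral_mul_indicator_eq_condExp (hm : m ≤ m0) {E : Set Ω} (hE : MeasurableSet E)
    {W : Ω → ℝ≥0∞} (hW : Measurable[m] W) :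
    ∫⁻ ω, W ω * E.indicator 1 ω ∂μ =
      ∫⁻ ω, W ω * ENNReal.ofReal (μ[E.indicator (fun _ => (1 : ℝ)) | m] ω) ∂μ := by
  set f : Ω → ℝ := μ[E.indicator (fun _ => (1 : ℝ)) | m] with hf
  have hint : Integrable (E.indicator (fun _ => (1 : ℝ))) μ := (integrable_const _).indicator hE
  have hfm : Measurable[m] f := stronglyMeasurable_condExp.measurable
  have hf0 : 0 ≤ᵐ[μ] f :=
    condExp_nonneg (ae_of_all _ fun ω => Set.indicator_nonneg (fun _ _ => zero_le_one) ω)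
  have hg : Measurable fun ω => ENNReal.ofReal (f ω) := (hfm.mono hm le_rfl).ennreal_ofReal
  have hW0 : Measurable W := hW.mono hm le_rfl
  have key : (μ.restrict E).trim hm =
      (μ.withDensity fun ω => ENNReal.ofReal (f ω)).trim hm := by
    refine @Measure.ext _ m _ _ fun s hs => ?_
    rw [trim_measurableSet_eq hm hs, trim_measurableSet_eq hm hs,
      Measure.restrict_apply (hm s hs), withDensity_apply _ (hm s hs),
      ← ofReal_integral_eq_lintegral_ofReal integrable_condExp.integrableOn
        (ae_restrict_of_ae hf0), setIntegral_condExp hm hint hs, setIntegral_indicator hE]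
    simp
  have h1 : ∫⁻ ω, W ω * E.indicator 1 ω ∂μ = ∫⁻ ω, W ω ∂(μ.restrict E) := by
    rw [← lintegral_indicator hE]
    refine lintegral_congr fun ω => ?_
    by_cases h : ω ∈ E <;> simp [h]
  rw [h1, ← lintegral_trim hm hW, key, lintegral_trim hm hW,
    lintegral_withDensity_eq_lintegral_mul _ hg hW0]
  simp [mul_comm]

/-- `κ` is a version of the conditional law of `X` given `m`. -/
def IsCondLaw (μ : Measure Ω) (m : MeasurableSpace Ω) (X : Ω → T) (κ : Ω → Measure T) : Prop :=
  ∀ B : Set T, MeasurableSet B →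
    μ[(X ⁻¹' B).indicator (fun _ => (1 : ℝ)) | m] =ᵐ[μ] fun ω => (κ ω).real B

/-- `κ` is not assumed to be a kernel, so measurability of its integrals has to be carried through
the induction on `F` together with the identity. For indicators it comes from the conditional
expectation. -/
lemma IsCondLaw.lintegral_eq (hm : m ≤ m0) {X : Ω → T} (hX : Measurable X)
    {κ : Ω → Measure T} (hκ : ∀ ω, IsProbabilityMeasure (κ ω)) (h : IsCondLaw μ m X κ)
    {F : T → ℝ≥0∞} (hF : Measurable F) :
    AEMeasurable (fun ω => ∫⁻ x, F x ∂(κ ω)) μ ∧ ∀ W : Ω → ℝ≥0∞, Measurable[m] W →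
      ∫⁻ ω, W ω * F (X ω) ∂μ = ∫⁻ ω, W ω * ∫⁻ x, F x ∂(κ ω) ∂μ := by
  refine Measurable.ennreal_induction (motive := fun F =>
    AEMeasurable (fun ω => ∫⁻ x, F x ∂(κ ω)) μ ∧ ∀ W : Ω → ℝ≥0∞, Measurable[m] W →
      ∫⁻ ω, W ω * F (X ω) ∂μ = ∫⁻ ω, W ω * ∫⁻ x, F x ∂(κ ω) ∂μ) ?_ ?_ ?_ hF
  · intro c B hB
    have e1 : (fun ω => ∫⁻ x, B.indicator (fun _ => c) x ∂(κ ω)) =ᵐ[μ]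
        fun ω => c * ENNReal.ofReal (μ[(X ⁻¹' B).indicator (fun _ => (1 : ℝ)) | m] ω) := by
      filter_upwards [h B hB] with ω hω
      rw [lintegral_indicator_const hB, hω, ofReal_measureReal]
    have hfm : Measurable (μ[(X ⁻¹' B).indicator (fun _ => (1 : ℝ)) | m]) :=
      stronglyMeasurable_condExp.measurable.mono hm le_rfl
    refine ⟨(hfm.ennreal_ofReal.const_mul c).aemeasurable.congr e1.symm, fun W hW => ?_⟩
    have e2 : ∫⁻ ω, W ω * B.indicator (fun _ => c) (X ω) ∂μ =
        ∫⁻ ω, (W ω * c) * (X ⁻¹' B).indicator 1 ω ∂μ := by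
      refine lintegral_congr fun ω => ?_
      by_cases hω : X ω ∈ B <;> simp [hω]
    rw [e2, lintegral_mul_indicator_eq_condExp hm (hX hB) (hW.mul_const c)]
    refine lintegral_congr_ae ?_
    filter_upwards [e1] with ω hω
    rw [hω, mul_assoc]
  · intro f g _ hf hg ihf ihg
    have hadd : ∀ ω, ∫⁻ x, (f + g) x ∂(κ ω) = ∫⁻ x, f x ∂(κ ω) + ∫⁻ x, g x ∂(κ ω) :=
      fun ω => lintegral_add_left hf _
    simp only [hadd]
    refine ⟨ihf.1.add ihg.1, fun W hW => ?_⟩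
    have hW0 : Measurable W := hW.mono hm le_rfl
    simp only [Pi.add_apply, mul_add]
    have hm1 : Measurable fun ω => W ω * f (X ω) := hW0.mul (hf.comp hX)
    have hm2 : AEMeasurable (fun ω => W ω * ∫⁻ x, f x ∂(κ ω)) μ := hW0.aemeasurable.mul ihf.1
    rw [lintegral_add_left hm1, lintegral_add_left' hm2,
      ihf.2 W hW, ihg.2 W hW]
  · intro f hf hmono ih
    have hsup : ∀ ω, ∫⁻ x, (⨆ n, f n x) ∂(κ ω) = ⨆ n, ∫⁻ x, f n x ∂(κ ω) :=
      fun ω => lintegral_iSup hf hmono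
    simp only [hsup]
    refine ⟨AEMeasurable.iSup fun n => (ih n).1, fun W hW => ?_⟩
    have hW0 : Measurable W := hW.mono hm le_rfl
    simp only [ENNReal.mul_iSup]
    have hm1 : ∀ n, Measurable fun ω => W ω * f n (X ω) := fun n => hW0.mul ((hf n).comp hX)
    have hm2 : ∀ n, AEMeasurable (fun ω => W ω * ∫⁻ x, f n x ∂(κ ω)) μ :=
      fun n => hW0.aemeasurable.mul (ih n).1
    rw [lintegral_iSup hm1, lintegral_iSup' hm2]
    · exact iSup_congr fun n => (ih n).2 W hW
    · exact ae_of_all _ fun ω i j hij => by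
        dsimp only
        gcongr
        exact hmono hij _
    · intro i j hij ω
      dsimp only
      gcongr
      exact hmono hij _

end Conditional

/-! ### Exponential supermartingales -/

section Supermartingale

variable {Ω : Type*} {m0 : MeasurableSpace Ω} {μ : Measure Ω} [IsProbabilityMeasure μ]

/-- Peel off the last factor: the product of the earlier ones is an admissible weight `W` for
`hstep`. -/
lemma lintegral_prod_le_one (ℱ : Filtration ℕ m0) (Z : ℕ → Ω → ℝ≥0∞) (n : ℕ)
    (hZ : ∀ i < n, Measurable[ℱ (i + 1)] (Z i))
    (hstep : ∀ i < n, ∀ W : Ω → ℝ≥0∞, Measurable[ℱ i] W →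
      ∫⁻ ω, W ω * Z i ω ∂μ ≤ ∫⁻ ω, W ω ∂μ) :
    Measurable[ℱ n] (fun ω => ∏ i ∈ Finset.range n, Z i ω) ∧
      ∫⁻ ω, ∏ i ∈ Finset.range n, Z i ω ∂μ ≤ 1 := by
  induction n with
  | zero => simp
  | succ k ih =>
    obtain ⟨h1, h2⟩ := ih (fun i hi => hZ i (by omega)) (fun i hi => hstep i (by omega))
    simp only [Finset.prod_range_succ]
    refine ⟨(h1.mono (ℱ.mono (Nat.le_succ k)) le_rfl).mul (hZ k (by omega)), ?_⟩
    exact (hstep k (by omega) _ h1).trans h2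

/-- Exponential Markov inequality for a sum of adapted increments whose exponentials are
supermartingale increments. -/
lemma measure_sum_ge_le_exp (ℱ : Filtration ℕ m0) (ξ : ℕ → Ω → ℝ) (n : ℕ) (a : ℝ)
    (hξ : ∀ i < n, Measurable[ℱ (i + 1)] (ξ i))
    (hstep : ∀ i < n, ∀ W : Ω → ℝ≥0∞, Measurable[ℱ i] W →
      ∫⁻ ω, W ω * ENNReal.ofReal (Real.exp (ξ i ω)) ∂μ ≤ ∫⁻ ω, W ω ∂μ) :
    μ {ω | a ≤ ∑ i ∈ Finset.range n, ξ i ω} ≤ ENNReal.ofReal (Real.exp (-a)) := by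
  obtain ⟨h1, h2⟩ := lintegral_prod_le_one (μ := μ) ℱ
    (fun i ω => ENNReal.ofReal (Real.exp (ξ i ω))) n
    (fun i hi => (Real.measurable_exp.comp (hξ i hi)).ennreal_ofReal) hstep
  have h3 := mul_meas_ge_le_lintegral (μ := μ) (h1.mono (ℱ.le n) le_rfl)
    (ENNReal.ofReal (Real.exp a))
  have h4 : {ω | a ≤ ∑ i ∈ Finset.range n, ξ i ω} = {ω | ENNReal.ofReal (Real.exp a) ≤
      ∏ i ∈ Finset.range n, ENNReal.ofReal (Real.exp (ξ i ω))} := by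
    ext ω
    simp only [Set.mem_ofPred_eq]
    rw [← ENNReal.ofReal_prod_of_nonneg (fun _ _ => (Real.exp_pos _).le), ← Real.exp_sum,
      ENNReal.ofReal_le_ofReal_iff (Real.exp_pos _).le, Real.exp_le_exp]
  rw [← h4] at h3
  have h5 := h3.trans h2
  have h6 : ENNReal.ofReal (Real.exp (-a)) * ENNReal.ofReal (Real.exp a) = 1 := by
    rw [← ENNReal.ofReal_mul (Real.exp_pos _).le, ← Real.exp_add]; simp
  calc _ = ENNReal.ofReal (Real.exp (-a)) * ENNReal.ofReal (Real.exp a) *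
        μ {ω | a ≤ ∑ i ∈ Finset.range n, ξ i ω} := by rw [h6, one_mul]
    _ ≤ ENNReal.ofReal (Real.exp (-a)) * 1 := by rw [mul_assoc]; gcongr
    _ = _ := mul_one _

end Supermartingale

/-! ### Measurability through finite decoders, and the sampling laws -/

section Decoder

variable {S Z β : Type*} [MeasurableSpace S] [Fintype Z]

lemma measurable_comp_of_finite {ψ : S → Z} (hψ : ∀ z, MeasurableSet (ψ ⁻¹' {z}))
    [MeasurableSpace β] (g : Z → β) : Measurable fun s => g (ψ s) := by
  intro B _
  have : (fun s => g (ψ s)) ⁻¹' B = ⋃ z ∈ g ⁻¹' B, ψ ⁻¹' {z} := by ext s; simp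
  rw [this]
  exact MeasurableSet.biUnion (Set.toFinite _).countable fun z _ => hψ z

lemma measurable_comp₂_of_finite {ψ ψ' : S → Z} (hψ : ∀ z, MeasurableSet (ψ ⁻¹' {z}))
    (hψ' : ∀ z, MeasurableSet (ψ' ⁻¹' {z})) [MeasurableSpace β] (g : Z → Z → β) :
    Measurable fun s => g (ψ s) (ψ' s) := by
  refine measurable_comp_of_finite (ψ := fun s => (ψ s, ψ' s)) (fun z => ?_) fun z => g z.1 z.2
  have : (fun s => (ψ s, ψ' s)) ⁻¹' {z} = ψ ⁻¹' {z.1} ∩ ψ' ⁻¹' {z.2} := by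
    ext s; simp [Prod.ext_iff]
  rw [this]
  exact (hψ _).inter (hψ' _)

end Decoder

section Measures

variable {S A Z : Type*} [MeasurableSpace S] [Fintype A] [Fintype Z] (M : BlockMDP S A Z)

instance BlockMDP.instIsProbabilityMeasureO (h : ℕ) (z : Z) : IsProbabilityMeasure (M.o h z) :=
  M.o_prob h z

instance BlockMDP.instIsProbabilityMeasureD₀ : IsProbabilityMeasure M.d₀ := M.d₀_prob

lemma BlockMDP.sum_ofReal_T (h : ℕ) (z : Z) (a : A) :
    ∑ z', ENNReal.ofReal (M.T h z a z') = 1 := by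
  rw [← ENNReal.ofReal_sum_of_nonneg fun z' _ => M.T_nonneg h z a z', M.T_sum, ENNReal.ofReal_one]

lemma BlockMDP.lintegral_trans (h : ℕ) (s : S) (a : A) (F : S → ℝ≥0∞) :
    ∫⁻ s', F s' ∂(M.trans h s a) =
      ∑ z', ENNReal.ofReal (M.T h (M.ψ h s) a z') * ∫⁻ s', F s' ∂(M.o (h + 1) z') := by
  simp [BlockMDP.trans, lintegral_smul_measure]

instance BlockMDP.instIsProbabilityMeasureTrans (h : ℕ) (s : S) (a : A) :
    IsProbabilityMeasure (M.trans h s a) :=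
  ⟨by rw [← lintegral_one, M.lintegral_trans]; simp [M.sum_ofReal_T]⟩

lemma BlockMDP.measurable_trans (h : ℕ) (a : A) : Measurable fun s => M.trans h s a :=
  measurable_comp_of_finite (M.ψ_meas h)
    fun z => ∑ z', ENNReal.ofReal (M.T h z a z') • M.o (h + 1) z'

/-- A mixture component of weight zero does not count, and any other component is almost surely
decoded to its own latent state. This keeps sampled trajectories among those to which the reward
normalization applies. -/
lemma BlockMDP.ae_trans (h : ℕ) (s : S) (a : A) :
    ∀ᵐ s' ∂(M.trans h s a), 0 < M.T h (M.ψ h s) a (M.ψ (h + 1) s') := by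
  rw [ae_iff, BlockMDP.trans, Measure.finsetSum_apply]
  refine Finset.sum_eq_zero fun z' _ => ?_
  rw [Measure.smul_apply, smul_eq_mul, mul_eq_zero]
  rcases (M.T_nonneg h (M.ψ h s) a z').eq_or_lt with h0 | h0
  · left; simp [← h0]
  · right
    refine measure_mono_null (fun s' hs' => ?_) (ae_iff.1 (M.o_decode (h + 1) z'))
    intro he
    apply hs'
    rw [he]
    exact h0

variable {M} in
lemma BlockMDP.integral_trans (h : ℕ) (s : S) (a : A) {F : S → ℝ}
    (hF : ∀ z', Integrable F (M.o (h + 1) z')) :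
    ∫ s', F s' ∂(M.trans h s a) =
      ∑ z', M.T h (M.ψ h s) a z' * ∫ s', F s' ∂(M.o (h + 1) z') := by
  rw [BlockMDP.trans, integral_finsetSum_measure]
  · simp [integral_smul_measure, M.T_nonneg]
  · intro z' _
    exact (hF z').smul_measure ENNReal.ofReal_ne_top

lemma lintegral_nextDist (π : Policy S A) (h : ℕ) (ν : Measure S) {F : S → ℝ≥0∞}
    (hF : Measurable F) :
    ∫⁻ s', F s' ∂(M.nextDist π h ν) =
      ∫⁻ s, ∑ a, ENNReal.ofReal (π.prob h s a) * ∫⁻ s', F s' ∂(M.trans h s a) ∂ν := by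
  have hm : Measurable fun s => ∑ a, ENNReal.ofReal (π.prob h s a) • M.trans h s a := by
    refine Measure.measurable_of_measurable_coe _ fun B hB => ?_
    simp only [Measure.finsetSum_apply, Measure.smul_apply, smul_eq_mul]
    exact Finset.measurable_fun_sum _ fun a _ => (π.meas h a).ennreal_ofReal.mul
      ((Measure.measurable_coe hB).comp (M.measurable_trans h a))
  rw [BlockMDP.nextDist, Measure.lintegral_bind hm.aemeasurable hF.aemeasurable]
  simp [lintegral_smul_measure]

lemma Policy.sum_ofReal_prob (π : Policy S A) (h : ℕ) (s : S) :
    ∑ a, ENNReal.ofReal (π.prob h s a) = 1 := by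
  rw [← ENNReal.ofReal_sum_of_nonneg fun a _ => π.nonneg h s a, π.sum_eq_one, ENNReal.ofReal_one]

instance instIsProbabilityMeasureNextDist (π : Policy S A) (h : ℕ) (ν : Measure S)
    [IsProbabilityMeasure ν] : IsProbabilityMeasure (M.nextDist π h ν) :=
  ⟨by rw [← lintegral_one, lintegral_nextDist M π h ν measurable_const]
      simp [π.sum_ofReal_prob]⟩

instance instIsProbabilityMeasureStateDist (π : Policy S A) (h : ℕ) :
    IsProbabilityMeasure (M.stateDist π h) := by
  induction h with
  | zero => exact M.d₀_prob
  | succ h ih => exact instIsProbabilityMeasureNextDist M π h _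

instance instIsProbabilityMeasureExploreDist [MeasurableSpace A] [Nonempty A] (π : Policy S A)
    (h : ℕ) : IsProbabilityMeasure (M.exploreDist π h) :=
  instIsProbabilityMeasureNextDist M _ _ _

section WithUniform

variable [MeasurableSpace A] [MeasurableSingletonClass A]

lemma lintegral_withUniform (ν : Measure S) [SFinite ν] {F : S × A → ℝ≥0∞} (hF : Measurable F) :
    ∫⁻ p, F p ∂(withUniform A ν) =
      ∫⁻ s, (Fintype.card A : ℝ≥0∞)⁻¹ * ∑ a, F (s, a) ∂ν := by
  rw [withUniform, lintegral_prod _ hF.aemeasurable]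
  simp [lintegral_smul_measure, lintegral_count, tsum_fintype]

instance instIsProbabilityMeasureWithUniform [Nonempty A] (ν : Measure S)
    [IsProbabilityMeasure ν] : IsProbabilityMeasure (withUniform A ν) :=
  ⟨by rw [← lintegral_one, lintegral_withUniform ν measurable_const]
      simp only [lintegral_const, Finset.sum_const, nsmul_eq_mul, mul_one, measure_univ,
        Finset.card_univ]
      exact ENNReal.inv_mul_cancel (by simp) (by simp)⟩

/-- Separates the latent transition from the emission, so that later one can argue under a single
emission law. The work lies in the measurability of the kernel inside `bind`. -/
lemma lintegral_tripleLaw (h : ℕ) (ν : Measure S) {F : S × A × S → ℝ≥0∞} (hF : Measurable F) :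
    ∫⁻ x, F x ∂(M.tripleLaw h ν) = ∫⁻ p, ∑ z', ENNReal.ofReal (M.T h (M.ψ h p.1) p.2 z') *
        ∫⁻ s', F (p.1, p.2, s') ∂(M.o (h + 1) z') ∂(withUniform A ν) := by
  have hm1 : ∀ p : S × A, Measurable fun s' : S => (p.1, p.2, s') := fun p => by fun_prop
  have hm : Measurable fun p : S × A => (M.trans h p.1 p.2).map fun s' => (p.1, p.2, s') := by
    refine Measure.measurable_of_measurable_coe _ fun B hB => ?_
    refine measurable_from_prod_countable_left fun a => ?_
    have : ∀ s : S, ((M.trans h s a).map fun s' => (s, a, s')) B =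
        ∑ z', ENNReal.ofReal (M.T h (M.ψ h s) a z') *
          (M.o (h + 1) z') (Prod.mk s ⁻¹' {q : S × S | (q.1, a, q.2) ∈ B}) := by
      intro s
      rw [Measure.map_apply (hm1 (s, a)) hB, BlockMDP.trans, Measure.finsetSum_apply]
      rfl
    simp only [this]
    refine Finset.measurable_fun_sum _ fun z' _ => Measurable.mul ?_ ?_
    · exact measurable_comp_of_finite (M.ψ_meas h) fun z => ENNReal.ofReal (M.T h z a z')
    · have hB' : MeasurableSet {q : S × S | (q.1, a, q.2) ∈ B} := by
        have : Measurable fun q : S × S => (q.1, a, q.2) := by fun_prop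
        exact this hB
      exact measurable_measure_prodMk_left hB'
  rw [BlockMDP.tripleLaw, Measure.lintegral_bind hm.aemeasurable hF.aemeasurable]
  refine lintegral_congr fun p => ?_
  rw [lintegral_map hF (hm1 p), M.lintegral_trans]

instance instIsProbabilityMeasureTripleLaw [Nonempty A] (h : ℕ) (ν : Measure S)
    [IsProbabilityMeasure ν] : IsProbabilityMeasure (M.tripleLaw h ν) :=
  ⟨by rw [← lintegral_one, lintegral_tripleLaw M h ν measurable_const]
      simp [M.sum_ofReal_T]⟩

lemma tripleLaw_cell (h : ℕ) (ν : Measure S) {C : Set (S × A)} (hC : MeasurableSet C) :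
    M.tripleLaw h ν ((fun x : S × A × S => (x.1, x.2.1)) ⁻¹' C) = withUniform A ν C := by
  have hm : Measurable fun x : S × A × S => (x.1, x.2.1) := by fun_prop
  rw [← lintegral_indicator_one (hm hC), ← lintegral_indicator_one hC,
    lintegral_tripleLaw M h ν (measurable_one.indicator (hm hC))]
  refine lintegral_congr fun p => ?_
  by_cases hp : p ∈ C
  · have : ∀ s' : S, (p.1, p.2, s') ∈ (fun x : S × A × S => (x.1, x.2.1)) ⁻¹' C := fun _ => hp
    simp [hp, this, M.sum_ofReal_T]
  · have : ∀ s' : S, (p.1, p.2, s') ∉ (fun x : S × A × S => (x.1, x.2.1)) ⁻¹' C := fun _ => hp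
    simp [hp, this]

end WithUniform

end Measures

/-! ### Cells of a decoder, and tail bounds for counts and for emissions -/

section Cells

variable {S A Z : Type*}

open Classical in
/-- The indicator that the pair `(ψ s, a)` of the transition `(s, a, s')` is `c`. -/
def cellInd (ψ : S → Z) (c : Z × A) (x : S × A × S) : ℝ := if (ψ x.1, x.2.1) = c then 1 else 0

/-- The state-action pairs with feature `e_c`. -/
def cell (ψ : S → Z) (c : Z × A) : Set (S × A) := {p | (ψ p.1, p.2) = c}

lemma cellInd_nonneg (ψ : S → Z) (c : Z × A) (x : S × A × S) : 0 ≤ cellInd ψ c x := by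
  unfold cellInd; split_ifs <;> norm_num

lemma cellInd_eq_indicator (ψ : S → Z) (c : Z × A) :
    cellInd ψ c = ((fun x : S × A × S => (x.1, x.2.1)) ⁻¹' cell ψ c).indicator (fun _ => 1) := by
  ext x
  by_cases hx : (ψ x.1, x.2.1) = c
  · rw [Set.indicator_of_mem (show x ∈ (fun x : S × A × S => (x.1, x.2.1)) ⁻¹' cell ψ c from hx)]
    simp [cellInd, hx]
  · rw [Set.indicator_of_notMem
      (show x ∉ (fun x : S × A × S => (x.1, x.2.1)) ⁻¹' cell ψ c from hx)]
    simp [cellInd, hx]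

variable [MeasurableSpace S] [MeasurableSpace A] [MeasurableSingletonClass A]

lemma measurableSet_cell {ψ : S → Z} (hψ : ∀ z, MeasurableSet (ψ ⁻¹' {z})) (c : Z × A) :
    MeasurableSet (cell ψ c) := by
  have : cell ψ c = (ψ ⁻¹' {c.1}) ×ˢ {c.2} := by
    ext p; simp [cell, Prod.ext_iff]
  rw [this]
  exact (hψ _).prod (measurableSet_singleton _)

lemma measurableSet_preimage_cell {ψ : S → Z} (hψ : ∀ z, MeasurableSet (ψ ⁻¹' {z}))
    (c : Z × A) : MeasurableSet ((fun x : S × A × S => (x.1, x.2.1)) ⁻¹' cell ψ c) :=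
  (by fun_prop : Measurable fun x : S × A × S => (x.1, x.2.1)) (measurableSet_cell hψ c)

lemma measurable_cellInd {ψ : S → Z} (hψ : ∀ z, MeasurableSet (ψ ⁻¹' {z})) (c : Z × A) :
    Measurable (cellInd ψ c) := by
  rw [cellInd_eq_indicator]
  exact measurable_const.indicator (measurableSet_preimage_cell hψ c)

end Cells

section Tails

variable {S A Z Ω : Type*} [MeasurableSpace S] [Fintype A] [MeasurableSpace A]
  [MeasurableSingletonClass A] [Fintype Z]

variable (M : BlockMDP S A Z) {m0 : MeasurableSpace Ω} {μ : Measure Ω} [IsProbabilityMeasure μ]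

/-- Multiplicative upper tail for the number of samples in a cell. -/
lemma measure_count_ge_le (ℱ : Filtration ℕ m0) (h n : ℕ) (X : ℕ → Ω → S × A × S)
    (ν : ℕ → Ω → Measure S)
    (hX : ∀ i < n, Measurable[ℱ (i + 1)] (X i))
    (hlaw : ∀ i < n, IsCondLaw μ (ℱ i) (X i) fun ω => M.tripleLaw h (ν i ω))
    {ψ : S → Z} (hψ : ∀ z, MeasurableSet (ψ ⁻¹' {z})) (c : Z × A) (a : ℝ) :
    μ {ω | 2 * ∑ i ∈ Finset.range n, (withUniform A (ν i ω)).real (cell ψ c) + a ≤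
      ∑ i ∈ Finset.range n, cellInd ψ c (X i ω)} ≤ ENNReal.ofReal (Real.exp (-a)) := by
  set C := ((fun x : S × A × S => (x.1, x.2.1)) ⁻¹' cell ψ c) with hC
  have hCm : MeasurableSet C := measurableSet_preimage_cell hψ c
  -- The compensator is the conditional probability itself, which is `ℱ i`-measurable by
  -- construction; `hae` identifies it with the cell mass almost surely.
  set p : ℕ → Ω → ℝ := fun i => μ[(X i ⁻¹' C).indicator (fun _ => (1 : ℝ)) | ℱ i] with hp
  have hpm : ∀ i, Measurable[ℱ i] (p i) := fun i => stronglyMeasurable_condExp.measurable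
  have hp0 : ∀ i, 0 ≤ᵐ[μ] p i := fun i =>
    condExp_nonneg (ae_of_all _ fun ω => Set.indicator_nonneg (fun _ _ => zero_le_one) ω)
  have hae : ∀ᵐ ω ∂μ, ∀ i < n, p i ω = (withUniform A (ν i ω)).real (cell ψ c) := by
    rw [ae_all_iff]
    intro i
    by_cases hi : i < n
    · filter_upwards [hlaw i hi C hCm] with ω hω _
      simp only [hp]
      rw [hω, Measure.real, tripleLaw_cell M h _ (measurableSet_cell hψ c), Measure.real]
    · exact ae_of_all _ fun ω h' => absurd h' hi
  have hcI : ∀ i ω, cellInd ψ c (X i ω) = (X i ⁻¹' C).indicator (fun _ => (1 : ℝ)) ω := by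
    intro i ω
    rw [cellInd_eq_indicator]
    rfl
  have hmain := measure_sum_ge_le_exp (μ := μ) ℱ
    (fun i ω => cellInd ψ c (X i ω) - 2 * p i ω) n a
    (fun i hi => ((measurable_cellInd hψ c).comp (hX i hi)).sub
      (((hpm i).mono (ℱ.mono (Nat.le_succ i)) le_rfl).const_mul 2)) ?_
  · refine le_trans (measure_mono_ae ?_) hmain
    filter_upwards [hae] with ω hω hmem
    have hmem' : 2 * ∑ i ∈ Finset.range n, (withUniform A (ν i ω)).real (cell ψ c) + a ≤
      ∑ i ∈ Finset.range n, cellInd ψ c (X i ω) := hmem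
    have : ∑ i ∈ Finset.range n, p i ω =
        ∑ i ∈ Finset.range n, (withUniform A (ν i ω)).real (cell ψ c) :=
      Finset.sum_congr rfl fun i hi => hω i (Finset.mem_range.1 hi)
    change a ≤ ∑ i ∈ Finset.range n, (cellInd ψ c (X i ω) - 2 * p i ω)
    rw [Finset.sum_sub_distrib, ← Finset.mul_sum, this]
    linarith
  · intro i hi W hW
    set e : ℝ≥0∞ := ENNReal.ofReal (Real.exp 1 - 1) with he
    have hEm : MeasurableSet (X i ⁻¹' C) := ((hX i hi).mono (ℱ.le _) le_rfl) hCm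
    set W' : Ω → ℝ≥0∞ := fun ω => W ω * ENNReal.ofReal (Real.exp (-(2 * p i ω))) with hW'
    have hW'm : Measurable[ℱ i] W' :=
      hW.mul (Real.measurable_exp.comp ((hpm i).const_mul 2).neg).ennreal_ofReal
    have hW'0 : Measurable W' := hW'm.mono (ℱ.le _) le_rfl
    have e1 : ∀ ω, W ω * ENNReal.ofReal (Real.exp (cellInd ψ c (X i ω) - 2 * p i ω)) =
        W' ω + W' ω * e * (X i ⁻¹' C).indicator 1 ω := by
      intro ω
      rw [hcI, sub_eq_add_neg, Real.exp_add, ENNReal.ofReal_mul (Real.exp_pos _).le]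
      by_cases hω : ω ∈ X i ⁻¹' C
      · have : ENNReal.ofReal (Real.exp 1) = 1 + e := by
          rw [he, ← ENNReal.ofReal_one, ← ENNReal.ofReal_add zero_le_one
            (by linarith [Real.add_one_le_exp 1])]
          congr 1; ring
        simp only [hω, Set.indicator_of_mem, this, hW', Pi.one_apply]
        ring
      · simp [hω, hW']
    simp only [e1]
    rw [lintegral_add_left hW'0, lintegral_mul_indicator_eq_condExp (ℱ.le i) hEm
      (hW'm.mul_const e), ← lintegral_add_left hW'0]
    refine lintegral_mono_ae ?_
    filter_upwards [hp0 i] with ω hω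
    have hpw : 0 ≤ p i ω := hω
    change W' ω + W' ω * e * ENNReal.ofReal (p i ω) ≤ W ω
    have h1 : W' ω + W' ω * e * ENNReal.ofReal (p i ω) =
        W ω * ENNReal.ofReal (Real.exp (-(2 * p i ω)) * (1 + (Real.exp 1 - 1) * p i ω)) := by
      have he1 : 0 ≤ Real.exp 1 - 1 := by linarith [Real.add_one_le_exp 1]
      rw [ENNReal.ofReal_mul (Real.exp_pos _).le, ENNReal.ofReal_add zero_le_one
        (mul_nonneg he1 hpw), ENNReal.ofReal_mul he1, ENNReal.ofReal_one]
      simp only [hW', he]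
      ring
    rw [h1]
    -- The factor 2 of the multiplicative tail: `1 + (e - 1) p ≤ 1 + 2 p ≤ exp (2 p)`.
    have h2 : Real.exp (-(2 * p i ω)) * (1 + (Real.exp 1 - 1) * p i ω) ≤ 1 := by
      have h3 : 1 + (Real.exp 1 - 1) * p i ω ≤ Real.exp (2 * p i ω) := by
        have := Real.add_one_le_exp (2 * p i ω)
        have := Real.exp_one_lt_d9
        nlinarith
      calc _ ≤ Real.exp (-(2 * p i ω)) * Real.exp (2 * p i ω) := by gcongr
        _ = 1 := by rw [← Real.exp_add]; simp
    calc W ω * _ ≤ W ω * ENNReal.ofReal 1 := by gcongr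
      _ = W ω := by simp

/-- For `|u| ≤ 1` one has `exp u ≤ 1 + u + u²`. The linear term has mean zero, and `1 + t² ≤ exp
(t²)` is cancelled by the compensator `t²`. The restriction `t ≤ 1` keeps `u = t (G - mean)` in
range. -/
lemma lintegral_exp_centered_le_one {ν : Measure S} [IsProbabilityMeasure ν] {G : S → ℝ}
    (hG : Measurable G) (hG0 : ∀ s, 0 ≤ G s) (hG1 : ∀ s, G s ≤ 1) {t : ℝ} (ht0 : 0 ≤ t)
    (ht1 : t ≤ 1) :
    ∫⁻ s, ENNReal.ofReal (Real.exp (t * (G s - ∫ s', G s' ∂ν) - t ^ 2)) ∂ν ≤ 1 := by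
  set g := ∫ s', G s' ∂ν with hg
  have hGi : Integrable G ν := Integrable.of_bound hG.aestronglyMeasurable 1
    (ae_of_all _ fun s => by rw [Real.norm_eq_abs, abs_of_nonneg (hG0 s)]; exact hG1 s)
  have hg0 : 0 ≤ g := integral_nonneg hG0
  have hg1 : g ≤ 1 := by
    have := integral_mono hGi (integrable_const 1) hG1
    simpa using this
  have hu : ∀ s, |t * (G s - g)| ≤ t := by
    intro s
    rw [abs_mul, abs_of_nonneg ht0]
    have : |G s - g| ≤ 1 := by rw [abs_le]; constructor <;> linarith [hG0 s, hG1 s]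
    nlinarith
  have hb : ∀ s, Real.exp (t * (G s - g) - t ^ 2) ≤
      (1 + t * (G s - g) + t ^ 2) * Real.exp (-t ^ 2) := by
    intro s
    rw [sub_eq_add_neg, Real.exp_add]
    gcongr
    have h1 := Real.abs_exp_sub_one_sub_id_le ((hu s).trans ht1)
    have h2 : (t * (G s - g)) ^ 2 ≤ t ^ 2 := by
      rw [← sq_abs]; exact pow_le_pow_left₀ (abs_nonneg _) (hu s) 2
    linarith [(abs_le.1 h1).2]
  have hnn : ∀ s, 0 ≤ (1 + t * (G s - g) + t ^ 2) * Real.exp (-t ^ 2) :=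
    fun s => (Real.exp_pos _).le.trans (hb s)
  have hi0 : Integrable (fun s => 1 + t * (G s - g) + t ^ 2) ν :=
    ((integrable_const 1).add ((hGi.sub (integrable_const g)).const_mul t)).add
      (integrable_const _)
  have hi := hi0.mul_const (Real.exp (-t ^ 2))
  calc _ ≤ ∫⁻ s, ENNReal.ofReal ((1 + t * (G s - g) + t ^ 2) * Real.exp (-t ^ 2)) ∂ν :=
        lintegral_mono fun s => ENNReal.ofReal_le_ofReal (hb s)
    _ = ENNReal.ofReal (∫ s, (1 + t * (G s - g) + t ^ 2) * Real.exp (-t ^ 2) ∂ν) :=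
        (ofReal_integral_eq_lintegral_ofReal hi (ae_of_all _ hnn)).symm
    _ ≤ 1 := by
      have hsum : ∫ s, (1 + t * (G s - g) + t ^ 2) ∂ν = 1 + t ^ 2 := by
        have e : ∀ s, 1 + t * (G s - g) + t ^ 2 = t * G s + (1 - t * g + t ^ 2) := fun s => by ring
        simp only [e]
        rw [integral_add (hGi.const_mul t) (integrable_const _), integral_const_mul]
        simp only [integral_const, probReal_univ, smul_eq_mul, one_mul, ← hg]
        ring
      rw [ENNReal.ofReal_le_one, integral_mul_const, hsum]
      have := Real.add_one_le_exp (t ^ 2)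
      calc (1 + t ^ 2) * Real.exp (-t ^ 2) ≤ Real.exp (t ^ 2) * Real.exp (-t ^ 2) := by
            gcongr; linarith
        _ = 1 := by rw [← Real.exp_add]; simp

/-- The mean of `G` under the emission at step `h` of the latent state of `s`. -/
def BlockMDP.emissionMean (h : ℕ) (G : S → ℝ) (s : S) : ℝ := ∫ s', G s' ∂(M.o h (M.ψ h s))

/-- Given the latent next states, the samples of a cell concentrate around their emission means. -/
lemma measure_emission_ge_le [Nonempty A] (ℱ : Filtration ℕ m0) (h n : ℕ) (X : ℕ → Ω → S × A × S)
    (ν : ℕ → Ω → Measure S) (hν : ∀ i ω, IsProbabilityMeasure (ν i ω))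
    (hX : ∀ i < n, Measurable[ℱ (i + 1)] (X i))
    (hlaw : ∀ i < n, IsCondLaw μ (ℱ i) (X i) fun ω => M.tripleLaw h (ν i ω))
    {ψ : S → Z} (hψ : ∀ z, MeasurableSet (ψ ⁻¹' {z})) (c : Z × A)
    {G : S → ℝ} (hG : Measurable G) (hG0 : ∀ s, 0 ≤ G s) (hG1 : ∀ s, G s ≤ 1)
    {t : ℝ} (ht0 : 0 ≤ t) (ht1 : t ≤ 1) (a : ℝ) :
    μ {ω | a ≤ ∑ i ∈ Finset.range n, cellInd ψ c (X i ω) *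
      (t * (G (X i ω).2.2 - M.emissionMean (h + 1) G (X i ω).2.2) - t ^ 2)} ≤
      ENNReal.ofReal (Real.exp (-a)) := by
  set φ : S × A × S → ℝ := fun x => cellInd ψ c x *
    (t * (G x.2.2 - M.emissionMean (h + 1) G x.2.2) - t ^ 2) with hφ
  have hem : Measurable (M.emissionMean (h + 1) G) :=
    measurable_comp_of_finite (M.ψ_meas (h + 1)) fun z => ∫ s', G s' ∂(M.o (h + 1) z)
  have h22 : Measurable fun x : S × A × S => x.2.2 := by fun_prop
  have hφm : Measurable φ := (measurable_cellInd hψ c).mul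
    ((((hG.comp h22).sub (hem.comp h22)).const_mul t).sub_const _)
  have hF : Measurable fun x => ENNReal.ofReal (Real.exp (φ x)) :=
    (Real.measurable_exp.comp hφm).ennreal_ofReal
  refine measure_sum_ge_le_exp (μ := μ) ℱ (fun i ω => φ (X i ω)) n a
    (fun i hi => hφm.comp (hX i hi)) fun i hi W hW => ?_
  have h1 := ((hlaw i hi).lintegral_eq (ℱ.le i) ((hX i hi).mono (ℱ.le _) le_rfl)
    (fun ω => by have := hν i ω; infer_instance) hF).2 W hW
  rw [h1]
  refine lintegral_mono fun ω => ?_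
  have hone : ∫⁻ x, ENNReal.ofReal (Real.exp (φ x)) ∂(M.tripleLaw h (ν i ω)) ≤ 1 := by
    have := hν i ω
    rw [lintegral_tripleLaw M h _ hF]
    -- Condition on the latent next state `z'`. Under its emission law the centering is almost
    -- surely the constant mean under `o z'`, so the previous bound applies; outside the cell the
    -- increment vanishes.
    have hin : ∀ (p : S × A) (z' : Z),
        ∫⁻ s', ENNReal.ofReal (Real.exp (φ (p.1, p.2, s'))) ∂(M.o (h + 1) z') ≤ 1 := by
      intro p z'
      by_cases hc : (ψ p.1, p.2) = c
      · calc _ = ∫⁻ s', ENNReal.ofReal (Real.exp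
                (t * (G s' - ∫ s'', G s'' ∂(M.o (h + 1) z')) - t ^ 2)) ∂(M.o (h + 1) z') := by
              refine lintegral_congr_ae ?_
              filter_upwards [M.o_decode (h + 1) z'] with s' hs'
              simp [hφ, cellInd, hc, BlockMDP.emissionMean, hs']
          _ ≤ 1 := lintegral_exp_centered_le_one hG hG0 hG1 ht0 ht1
      · simp [hφ, cellInd, hc]
    calc _ ≤ ∫⁻ p, ∑ z', ENNReal.ofReal (M.T h (M.ψ h p.1) p.2 z') * 1
            ∂(withUniform A (ν i ω)) := by
          refine lintegral_mono fun p => Finset.sum_le_sum fun z' _ => ?_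
          gcongr
          exact hin p z'
      _ = 1 := by simp [M.sum_ofReal_T]
  calc W ω * _ ≤ W ω * 1 := by gcongr
    _ = W ω := mul_one _

end Tails

/-! ### The concentration event and its union bound -/

lemma measure_biUnion_le_card_mul {Ω ι : Type*} [MeasurableSpace Ω] {μ : Measure Ω}
    (s : Finset ι) (E : ι → Set Ω) {b : ℕ} (hs : s.card ≤ b) {ε : ℝ≥0∞}
    (hE : ∀ i ∈ s, μ (E i) ≤ ε) : μ (⋃ i ∈ s, E i) ≤ b * ε := by
  calc μ (⋃ i ∈ s, E i) ≤ ∑ i ∈ s, μ (E i) := measure_biUnion_finset_le s E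
    _ ≤ s.card • ε := Finset.sum_le_card_nsmul _ _ _ hE
    _ = s.card * ε := nsmul_eq_mul _ _
    _ ≤ b * ε := by gcongr

/-- The union bound over all cells, samples, test functions and scales at one iteration. -/
lemma union_bound_numeric {κ δ lam : ℝ} (hκ : 0 < κ) (hδ0 : 0 < δ) (hδ1 : δ < 1) {n d C : ℕ}
    (hn : 1 ≤ n) (hd : 1 ≤ d) (hC : 2 * δ ≤ C) (hC1 : 1 ≤ C)
    (hlam : κ * d * Real.log (C * n / δ) ≤ lam) :
    ((n * (C * (d * (1 + (1 + C * (n + 1) ^ d) * ((n + 1) * 2))))) : ℝ) *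
      Real.exp (-(12 / κ * lam)) ≤ δ / (n * (n + 1)) := by
  -- Everything is compared with powers of `x`. From `2δ ≤ C` one gets `x ≥ 2n`, so `x` absorbs
  -- numerical constants and powers of `n`, while `n C = x δ` supplies the factor `δ`. The
  -- cardinality and the weight `n (n+1)` cost `δ x^(2d+8)`, and the tail gains `x^(-12d)`, which
  -- suffices as `d ≥ 1`.
  set x : ℝ := C * n / δ with hx
  have hn' : (1 : ℝ) ≤ n := by exact_mod_cast hn
  have hC' : (1 : ℝ) ≤ C := by exact_mod_cast hC1
  have hx2n : 2 * (n : ℝ) ≤ x := by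
    rw [hx, le_div_iff₀ hδ0]; nlinarith
  have hxn : (n : ℝ) + 1 ≤ x := by linarith
  have hx2 : 2 ≤ x := by linarith
  have hxC : (C : ℝ) ≤ x := by
    rw [hx, le_div_iff₀ hδ0]; nlinarith
  have hx0 : 0 < x := by linarith
  have hx1 : 1 ≤ x := by linarith
  have hnC : (n : ℝ) * C = x * δ := by rw [hx]; field_simp
  have hdx : (d : ℝ) ≤ x ^ d := by
    calc (d : ℝ) ≤ 2 ^ d := by exact_mod_cast (Nat.lt_two_pow_self).le
      _ ≤ x ^ d := by gcongr
  have hexp : Real.exp (-(12 / κ * lam)) ≤ (x ^ (12 * d))⁻¹ := by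
    rw [Real.exp_neg]
    gcongr
    rw [← Real.exp_log (pow_pos hx0 _), Real.log_pow]
    refine Real.exp_le_exp.2 ?_
    calc ((12 * d : ℕ) : ℝ) * Real.log x = 12 / κ * (κ * d * Real.log x) := by
          push_cast; field_simp
      _ ≤ _ := by gcongr
  have hp : (1 + (1 + (C : ℝ) * (n + 1) ^ d) * ((n + 1) * 2)) ≤ x ^ (d + 5) := by
    have h1 : (C : ℝ) * (n + 1) ^ d ≤ x ^ (d + 1) := by
      calc (C : ℝ) * (n + 1) ^ d ≤ x * x ^ d := by gcongr
        _ = x ^ (d + 1) := by ring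
    have h2 : (1 : ℝ) ≤ x ^ (d + 1) := one_le_pow₀ hx1
    have h3 : (1 : ℝ) ≤ x ^ (d + 2) := one_le_pow₀ hx1
    have h8 : (8 : ℝ) ≤ x ^ 3 := by
      calc (8 : ℝ) = 2 ^ 3 := by norm_num
        _ ≤ x ^ 3 := by gcongr
    calc (1 + (1 + (C : ℝ) * (n + 1) ^ d) * ((n + 1) * 2))
        ≤ x ^ (d + 2) + (x ^ (d + 1) + x ^ (d + 1)) * (x * 2) := by gcongr
      _ = 5 * x ^ (d + 2) := by ring
      _ ≤ x ^ 3 * x ^ (d + 2) := by gcongr; linarith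
      _ = x ^ (d + 5) := by ring
  have hnn : (n : ℝ) * (n + 1) ≤ x ^ 2 := by
    rw [sq]; gcongr; linarith
  rw [le_div_iff₀ (by positivity)]
  calc ((n * (C * (d * (1 + (1 + C * (n + 1) ^ d) * ((n + 1) * 2))))) : ℝ) *
        Real.exp (-(12 / κ * lam)) * (n * (n + 1))
      = (n * C) * (d * (1 + (1 + C * (n + 1) ^ d) * ((n + 1) * 2))) *
        Real.exp (-(12 / κ * lam)) * (n * (n + 1)) := by ring
    _ ≤ (x * δ) * (x ^ d * x ^ (d + 5)) * (x ^ (12 * d))⁻¹ * x ^ 2 := by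
        rw [hnC]; gcongr
    _ = δ * (x ^ (2 * d + 8) * (x ^ (12 * d))⁻¹) := by ring
    _ ≤ δ * 1 := by
        gcongr
        rw [← div_eq_mul_inv, div_le_one (by positivity)]
        exact pow_le_pow_right₀ hx1 (by omega)
    _ = δ := mul_one δ

section Events

variable {S A Z Ω : Type*} [MeasurableSpace S] [Fintype A] [Nonempty A] [MeasurableSpace A]
  [MeasurableSingletonClass A] [Fintype Z] [MeasurableSpace Ω]
  {M : BlockMDP S A Z} {Φ : ℕ → Finset (S → Z)} {N : ℕ} {lam alpha : ℕ → ℝ} {μ : Measure Ω}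

/-- The scale at which a sum over `m` samples is compared with its mean. -/
def tiltScale (lam : ℝ) (m : ℕ) : ℝ := √(lam / (m + lam))

lemma tiltScale_le_one {lam : ℝ} (h : 0 < lam) (m : ℕ) : tiltScale lam m ≤ 1 := by
  rw [tiltScale, Real.sqrt_le_left zero_le_one, one_pow, div_le_one (by positivity)]
  linarith [(Nat.cast_nonneg m : (0 : ℝ) ≤ m)]

/-- The centered and tilted increment of the test function `G` on the cell `c`. -/
def tilted (M : BlockMDP S A Z) (h : ℕ) (ψ : S → Z) (c : Z × A) (G : S → ℝ) (t : ℝ)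
    (x : S × A × S) : ℝ :=
  cellInd ψ c x * (t * (G x.2.2 - M.emissionMean (h + 1) G x.2.2) - t ^ 2)

/-- The data of iteration `n` concentrate for the test functions `𝒢`. -/
structure Run.Concentrated (R : Run M Φ N lam alpha μ) (K : ℝ) (𝒢 : ℕ → Finset (S → ℝ)) (n : ℕ)
    (ω : Ω) : Prop where
  count : ∀ h < M.H, ∀ ψ ∈ Φ h, ∀ c, ∑ i ∈ Finset.range n, cellInd ψ c (R.X i h ω) ≤
    2 * ∑ i ∈ Finset.range n, (withUniform A (M.stateDist (R.πhat i ω) h)).real (cell ψ c) +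
      K * lam n
  emissionX : ∀ h < M.H, ∀ ψ ∈ Φ h, ∀ c, ∀ G ∈ 𝒢 h, ∀ m ≤ n,
    ∑ i ∈ Finset.range n, tilted M h ψ c G (tiltScale (lam n) m) (R.X i h ω) ≤ K * lam n
  emissionY : ∀ h < M.H, 0 < h → ∀ ψ ∈ Φ h, ∀ c, ∀ G ∈ 𝒢 h, ∀ m ≤ n,
    ∑ i ∈ Finset.range n, tilted M h ψ c G (tiltScale (lam n) m) (R.Y i h ω) ≤ K * lam n

/-- The factors count steps, decoders, cells, and per cell one count event plus, for each test
function and each of `n + 1` tilts, one event for each of the two data sources. -/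
lemma Run.measure_not_concentrated_le [IsProbabilityMeasure μ] (R : Run M Φ N lam alpha μ)
    (hΦ : ∀ h < M.H, ∀ ψ ∈ Φ h, ∀ z, MeasurableSet (ψ ⁻¹' {z})) {K : ℝ}
    {𝒢 : ℕ → Finset (S → ℝ)} {n B C : ℕ} (hn : n ≤ N) (hlam : 0 < lam n) (hHn : M.H ≤ n)
    (hC : ∀ h < M.H, (Φ h).card ≤ C)
    (hB : ∀ h < M.H, (𝒢 h).card ≤ B)
    (h𝒢 : ∀ h < M.H, ∀ G ∈ 𝒢 h, Measurable G ∧ (∀ s, 0 ≤ G s) ∧ ∀ s, G s ≤ 1) :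
    μ {ω | ¬ R.Concentrated K 𝒢 n ω} ≤
      (n * (C * ((Fintype.card Z * Fintype.card A : ℕ) * (1 + B * ((n + 1 : ℕ) * 2)))) : ℝ≥0∞) *
        ENNReal.ofReal (Real.exp (-(K * lam n))) := by
  classical
  set ε := ENNReal.ofReal (Real.exp (-(K * lam n))) with hε
  let E1 : ℕ → (S → Z) → Z × A → Set Ω := fun h ψ c =>
    {ω | 2 * ∑ i ∈ Finset.range n, (withUniform A (M.stateDist (R.πhat i ω) h)).real (cell ψ c) +
      K * lam n ≤ ∑ i ∈ Finset.range n, cellInd ψ c (R.X i h ω)}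
  let EX : ℕ → (S → Z) → Z × A → (S → ℝ) → ℕ → Set Ω := fun h ψ c G m =>
    {ω | K * lam n ≤ ∑ i ∈ Finset.range n, tilted M h ψ c G (tiltScale (lam n) m) (R.X i h ω)}
  let EY : ℕ → (S → Z) → Z × A → (S → ℝ) → ℕ → Set Ω := fun h ψ c G m =>
    {ω | 0 < h ∧
      K * lam n ≤ ∑ i ∈ Finset.range n, tilted M h ψ c G (tiltScale (lam n) m) (R.Y i h ω)}
  have hsub : {ω | ¬ R.Concentrated K 𝒢 n ω} ⊆ ⋃ h ∈ Finset.range M.H, ⋃ ψ ∈ Φ h,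
      ⋃ c ∈ (Finset.univ : Finset (Z × A)), (E1 h ψ c ∪ ⋃ G ∈ 𝒢 h, ⋃ m ∈ Finset.range (n + 1),
        (EX h ψ c G m ∪ EY h ψ c G m)) := by
    intro ω hω
    by_contra hcon
    apply hω
    simp only [Set.mem_iUnion, Set.mem_union, not_exists, not_or, Finset.mem_range,
      Finset.mem_univ] at hcon
    refine ⟨fun h hh ψ hψ c => ?_, fun h hh ψ hψ c G hG m hm => ?_,
      fun h hh h0 ψ hψ c G hG m hm => ?_⟩
    · exact (not_le.1 (hcon h hh ψ hψ c trivial).1).le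
    · exact (not_le.1 ((hcon h hh ψ hψ c trivial).2 G hG m (by omega)).1).le
    · by_contra hlt
      exact ((hcon h hh ψ hψ c trivial).2 G hG m (by omega)).2 ⟨h0, (not_le.1 hlt).le⟩
  refine (measure_mono hsub).trans ?_
  -- The `H` steps are charged as `n`, which keeps the horizon out of the logarithm.
  refine measure_biUnion_le_card_mul _ _ (b := n) (by simpa using hHn) (fun h hh => ?_) |>.trans
    (le_of_eq (mul_assoc _ _ _).symm)
  have hh' : h < M.H := Finset.mem_range.1 hh
  refine measure_biUnion_le_card_mul _ _ (b := C) (hC h hh') (fun ψ hψ => ?_) |>.trans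
    (le_of_eq (mul_assoc _ _ _).symm)
  refine measure_biUnion_le_card_mul _ _ (b := Fintype.card Z * Fintype.card A) (by simp)
    (fun c _ => ?_) |>.trans (le_of_eq (mul_assoc _ _ _).symm)
  have hψm := hΦ h hh' ψ hψ
  have hlawX : ∀ i < n, IsCondLaw μ (R.ℱ i) (R.X i h)
      fun ω => M.tripleLaw h (M.stateDist (R.πhat i ω) h) :=
    fun i hi => R.X_law i (by omega) h hh'
  have hXm : ∀ i < n, Measurable[R.ℱ (i + 1)] (R.X i h) :=
    fun i hi => R.X_meas i (by omega) h hh'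
  have hE1 : μ (E1 h ψ c) ≤ ε :=
    measure_count_ge_le M R.ℱ h n (fun i => R.X i h) (fun i ω => M.stateDist (R.πhat i ω) h)
      hXm hlawX hψm c (K * lam n)
  have ht0 : ∀ m, 0 ≤ tiltScale (lam n) m := fun m => Real.sqrt_nonneg _
  have hEX : ∀ G ∈ 𝒢 h, ∀ m, μ (EX h ψ c G m) ≤ ε := fun G hG m =>
    measure_emission_ge_le M R.ℱ h n (fun i => R.X i h) (fun i ω => M.stateDist (R.πhat i ω) h)
      (fun i ω => inferInstance) hXm hlawX hψm c (h𝒢 h hh' G hG).1 (h𝒢 h hh' G hG).2.1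
      (h𝒢 h hh' G hG).2.2 (ht0 m) (tiltScale_le_one hlam m) (K * lam n)
  have hEY : ∀ G ∈ 𝒢 h, ∀ m, μ (EY h ψ c G m) ≤ ε := by
    intro G hG m
    by_cases h0 : 0 < h
    · refine le_trans (measure_mono fun ω hω => hω.2) (measure_emission_ge_le M R.ℱ h n
        (fun i => R.Y i h) (fun i ω => M.exploreDist (R.πhat i ω) h)
        (fun i ω => inferInstance) (fun i hi => R.Y_meas i (by omega) h hh' h0)
        (fun i hi => R.Y_law i (by omega) h hh' h0) hψm c (h𝒢 h hh' G hG).1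
        (h𝒢 h hh' G hG).2.1 (h𝒢 h hh' G hG).2.2 (ht0 m) (tiltScale_le_one hlam m) (K * lam n))
    · have : EY h ψ c G m = ∅ := by
        ext ω; simp [EY, h0]
      simp [this]
  refine (measure_union_le _ _).trans ?_
  rw [add_mul, one_mul]
  refine add_le_add hE1 ?_
  refine measure_biUnion_le_card_mul _ _ (b := B) (hB h hh') (fun G hG => ?_) |>.trans
    (le_of_eq (mul_assoc _ _ _).symm)
  refine measure_biUnion_le_card_mul _ _ (b := n + 1) (by simp) (fun m _ => ?_) |>.trans
    (le_of_eq (mul_assoc _ _ _).symm)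
  refine (measure_union_le _ _).trans ?_
  rw [two_mul]
  exact add_le_add (hEX G hG m) (hEY G hG m)

/-- A telescoping sum: it lets iteration `n` fail with probability `δ / (n (n+1))`. -/
lemma sum_inv_mul_succ_le (N : ℕ) :
    ∑ n ∈ Finset.Icc 1 N, (1 : ℝ) / (n * (n + 1)) ≤ 1 - 1 / (N + 1) := by
  induction N with
  | zero => simp
  | succ k ih =>
    rw [Finset.sum_Icc_succ_top (by omega)]
    refine (add_le_add_left ih _).trans (le_of_eq ?_)
    push_cast
    field_simp
    ring

/-- With probability at least `1 - δ` the data of all iterations `n ≥ H` concentrate. -/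
lemma Run.exists_event [IsProbabilityMeasure μ] [Nonempty Z] (R : Run M Φ N lam alpha μ)
    (hΦ : ∀ h < M.H, ∀ ψ ∈ Φ h, ∀ z, MeasurableSet (ψ ⁻¹' {z})) {κ δ : ℝ} (hκ : 0 < κ)
    (hδ0 : 0 < δ) (hδ1 : δ < 1) {C : ℕ} (hC : ∀ h < M.H, (Φ h).card ≤ C) (hCδ : 2 * δ ≤ C)
    (hlam0 : ∀ n, 1 ≤ n → n ≤ N → 0 < lam n)
    (hlam : ∀ n, 1 ≤ n → n ≤ N →
      κ * (Fintype.card Z * Fintype.card A) * Real.log (C * n / δ) ≤ lam n)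
    {𝒢 : ℕ → ℕ → Finset (S → ℝ)}
    (hB : ∀ n, ∀ h < M.H, (𝒢 n h).card ≤ 1 + C * (n + 1) ^ (Fintype.card Z * Fintype.card A))
    (h𝒢 : ∀ n, ∀ h < M.H, ∀ G ∈ 𝒢 n h, Measurable G ∧ (∀ s, 0 ≤ G s) ∧ ∀ s, G s ≤ 1) :
    ∃ E : Set Ω, MeasurableSet E ∧ ENNReal.ofReal (1 - δ) ≤ μ E ∧
      ∀ ω ∈ E, ∀ n, 1 ≤ n → n ≤ N → M.H ≤ n → R.Concentrated (12 / κ) (𝒢 n) n ω := by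
  set d := Fintype.card Z * Fintype.card A with hd
  have hd1 : 1 ≤ d := Nat.mul_pos Fintype.card_pos Fintype.card_pos
  have hC1 : 1 ≤ C := by
    have : (0 : ℝ) < C := by linarith
    exact_mod_cast this
  set bad : ℕ → Set Ω := fun n => {ω | M.H ≤ n ∧ ¬ R.Concentrated (12 / κ) (𝒢 n) n ω} with hbad
  have hbadn : ∀ n ∈ Finset.Icc 1 N, μ (bad n) ≤ ENNReal.ofReal (δ * (1 / (n * (n + 1)))) := by
    intro n hn
    obtain ⟨h1, h2⟩ := Finset.mem_Icc.1 hn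
    by_cases hH : M.H ≤ n
    · have e : bad n ⊆ {ω | ¬ R.Concentrated (12 / κ) (𝒢 n) n ω} := fun ω hω => hω.2
      refine (measure_mono e).trans ?_
      refine (R.measure_not_concentrated_le hΦ h2 (hlam0 n h1 h2) hH hC (hB n) (h𝒢 n)).trans ?_
      have hnum := union_bound_numeric hκ hδ0 hδ1 h1 hd1 hCδ hC1 (lam := lam n)
        (by rw [hd]; push_cast; exact hlam n h1 h2)
      have hcast : (n * (C * ((d : ℕ) * (1 + (1 + C * (n + 1) ^ d : ℕ) * ((n + 1 : ℕ) * 2)))) :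
          ℝ≥0∞) = ENNReal.ofReal
          (n * (C * (d * (1 + (1 + C * (n + 1) ^ d) * ((n + 1) * 2))))) := by
        rw [show ((n : ℝ) * (C * (d * (1 + (1 + C * (n + 1) ^ d) * ((n + 1) * 2))))) =
          ((n * (C * (d * (1 + (1 + C * (n + 1) ^ d) * ((n + 1) * 2)))) : ℕ) : ℝ) by push_cast; ring,
          ENNReal.ofReal_natCast]
        push_cast
        ring
      rw [hcast, ← ENNReal.ofReal_mul (by positivity)]
      apply ENNReal.ofReal_le_ofReal
      rw [mul_one_div]
      exact hnum
    · have : bad n = ∅ := by ext ω; simp [hbad, hH]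
      simp [this]
  set Bad : Set Ω := ⋃ n ∈ Finset.Icc 1 N, bad n with hBad
  have hBadμ : μ Bad ≤ ENNReal.ofReal δ := by
    calc μ Bad ≤ ∑ n ∈ Finset.Icc 1 N, μ (bad n) := measure_biUnion_finset_le _ _
      _ ≤ ∑ n ∈ Finset.Icc 1 N, ENNReal.ofReal (δ * (1 / (n * (n + 1)))) :=
          Finset.sum_le_sum hbadn
      _ = ENNReal.ofReal (δ * ∑ n ∈ Finset.Icc 1 N, (1 : ℝ) / (n * (n + 1))) := by
          rw [Finset.mul_sum, ENNReal.ofReal_sum_of_nonneg fun n _ => by positivity]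
      _ ≤ ENNReal.ofReal δ := by
          apply ENNReal.ofReal_le_ofReal
          have h1 := sum_inv_mul_succ_le N
          have h2 : (0 : ℝ) ≤ 1 / (N + 1) := by positivity
          nlinarith
  -- The bad set is only bounded in outer measure, so it is enlarged to a measurable set of the same
  -- measure.
  refine ⟨(toMeasurable μ Bad)ᶜ, (measurableSet_toMeasurable μ Bad).compl, ?_, ?_⟩
  · rw [prob_compl_eq_one_sub (measurableSet_toMeasurable μ Bad), measure_toMeasurable,
      ENNReal.ofReal_sub _ hδ0.le, ENNReal.ofReal_one]
    exact tsub_le_tsub_left hBadμ 1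
  · intro ω hω n h1 h2 hH
    by_contra hcon
    refine hω (subset_toMeasurable μ Bad ?_)
    exact Set.mem_biUnion (Finset.mem_coe.2 (Finset.mem_Icc.2 ⟨h1, h2⟩)) ⟨hH, hcon⟩

end Events

/-! ### Ridge regression with one-hot features as cellwise averaging -/

section Ridge

variable {S A Z : Type*}

/-- The number of transitions of `D` in the cell `c`. -/
def cellCount (ψ : S → Z) (D : Dataset S A) (c : Z × A) : ℝ := (D.map (cellInd ψ c)).sum

/-- The sum of `f` over the next states of the transitions of `D` in the cell `c`. -/
def cellSum (ψ : S → Z) (D : Dataset S A) (c : Z × A) (f : S → ℝ) : ℝ :=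
  (D.map fun x => cellInd ψ c x * f x.2.2).sum

/-- The regularized empirical mean of `f` over the cell `c`. -/
def cellMean (ψ : S → Z) (D : Dataset S A) (lam : ℝ) (c : Z × A) (f : S → ℝ) : ℝ :=
  cellSum ψ D c f / (cellCount ψ D c + lam)

lemma cellCount_nonneg (ψ : S → Z) (D : Dataset S A) (c : Z × A) : 0 ≤ cellCount ψ D c := by
  refine Multiset.sum_nonneg fun x hx => ?_
  obtain ⟨y, _, rfl⟩ := Multiset.mem_map.1 hx
  exact cellInd_nonneg ψ c y

open Classical in
-- The outer square of a one-hot vector is a diagonal matrix unit, so each sample adds one to the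
-- entry of its cell.
lemma cov_eq_diagonal (ψ : S → Z) (D : Dataset S A) (lam : ℝ) :
    cov ψ D lam = Matrix.diagonal fun c => cellCount ψ D c + lam := by
  unfold cov cellCount
  rw [← Matrix.diagonal_add, ← Matrix.smul_one_eq_diagonal]
  congr 1
  induction D using Multiset.induction_on with
  | empty => simp
  | cons x D ih =>
    simp only [Multiset.map_cons, Multiset.sum_cons]
    rw [ih, ← Matrix.diagonal_add]
    congr 1
    ext i j
    by_cases hij : i = j
    · subst hij
      by_cases hi : i = (ψ x.1, x.2.1)
      · simp [Matrix.vecMulVec, feat, cellInd, hi]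
      · simp [Matrix.vecMulVec, feat, cellInd, hi, Ne.symm hi]
    · rw [Matrix.diagonal_apply_ne _ hij]
      by_cases hi : i = (ψ x.1, x.2.1)
      · have : j ≠ (ψ x.1, x.2.1) := fun h => hij (hi.trans h.symm)
        simp [Matrix.vecMulVec, feat, this]
      · simp [Matrix.vecMulVec, feat, hi]

lemma sum_smul_feat_apply (ψ : S → Z) (D : Dataset S A) (f : S → ℝ) (c : Z × A) :
    (D.map fun x => f x.2.2 • feat ψ x.1 x.2.1).sum c = cellSum ψ D c f := by
  unfold cellSum
  induction D using Multiset.induction_on with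
  | empty => simp
  | cons x D ih =>
    simp only [Multiset.map_cons, Multiset.sum_cons, Pi.add_apply, ih]
    congr 1
    by_cases hc : c = (ψ x.1, x.2.1)
    · simp [feat, cellInd, hc]
    · simp [feat, cellInd, hc, Ne.symm hc]

lemma cellSum_mono (ψ : S → Z) (D : Dataset S A) (c : Z × A) {f g : S → ℝ}
    (h : ∀ s, f s ≤ g s) : cellSum ψ D c f ≤ cellSum ψ D c g :=
  Multiset.sum_map_le_sum_map _ _ fun x _ =>
    mul_le_mul_of_nonneg_left (h _) (cellInd_nonneg ψ c x)

lemma cellSum_add (ψ : S → Z) (D : Dataset S A) (c : Z × A) (f g : S → ℝ) :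
    cellSum ψ D c (fun s => f s + g s) = cellSum ψ D c f + cellSum ψ D c g := by
  simp [cellSum, mul_add, Multiset.sum_map_add]

lemma cellSum_const (ψ : S → Z) (D : Dataset S A) (c : Z × A) (w : ℝ) :
    cellSum ψ D c (fun _ => w) = cellCount ψ D c * w := by
  simp only [cellSum, cellCount, Multiset.sum_map_mul_right]

variable {lam : ℝ}

lemma cellCount_add_pos (hlam : 0 < lam) (ψ : S → Z) (D : Dataset S A) (c : Z × A) :
    0 < cellCount ψ D c + lam := by linarith [cellCount_nonneg ψ D c]

/-- The averaging weights are nonnegative. Both exactness of LSVI and the optimism recursion rest on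
this monotonicity. -/
lemma cellMean_mono (hlam : 0 < lam) (ψ : S → Z) (D : Dataset S A) (c : Z × A) {f g : S → ℝ}
    (h : ∀ s, f s ≤ g s) : cellMean ψ D lam c f ≤ cellMean ψ D lam c g :=
  div_le_div_of_nonneg_right (cellSum_mono ψ D c h) (cellCount_add_pos hlam ψ D c).le

lemma cellMean_add (ψ : S → Z) (D : Dataset S A) (c : Z × A) (f g : S → ℝ) :
    cellMean ψ D lam c (fun s => f s + g s) = cellMean ψ D lam c f + cellMean ψ D lam c g := by
  rw [cellMean, cellSum_add, add_div]; rfl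

lemma cellMean_const (ψ : S → Z) (D : Dataset S A) (c : Z × A) (w : ℝ) :
    cellMean ψ D lam c (fun _ => w) =
      cellCount ψ D c / (cellCount ψ D c + lam) * w := by
  rw [cellMean, cellSum_const]; ring

lemma cellMean_nonneg (hlam : 0 < lam) (ψ : S → Z) (D : Dataset S A) (c : Z × A) {f : S → ℝ}
    (h : ∀ s, 0 ≤ f s) : 0 ≤ cellMean ψ D lam c f := by
  have := cellMean_mono hlam ψ D c h
  rwa [cellMean_const, mul_zero] at this

/-- Regularization makes the total weight less than one, which is why `w` must be nonnegative. -/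
lemma cellMean_le_const (hlam : 0 < lam) (ψ : S → Z) (D : Dataset S A) (c : Z × A) {f : S → ℝ} {w : ℝ}
    (hw : 0 ≤ w) (h : ∀ s, f s ≤ w) : cellMean ψ D lam c f ≤ w := by
  refine (cellMean_mono hlam ψ D c h).trans ?_
  rw [cellMean_const]
  refine mul_le_of_le_one_left hw ?_
  rw [div_le_one (cellCount_add_pos hlam ψ D c)]
  linarith

variable [Fintype A] [Fintype Z]

open Classical in
lemma inv_cov (hlam : 0 < lam) (ψ : S → Z) (D : Dataset S A) :
    (cov ψ D lam)⁻¹ = Matrix.diagonal fun c => (cellCount ψ D c + lam)⁻¹ := by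
  rw [cov_eq_diagonal]
  refine Matrix.inv_eq_right_inv ?_
  rw [Matrix.diagonal_mul_diagonal, ← Matrix.diagonal_one]
  congr 1
  ext c
  exact mul_inv_cancel₀ (by linarith [cellCount_nonneg ψ D c])

lemma feat_dotProduct (ψ : S → Z) (s : S) (a : A) (v : Z × A → ℝ) :
    feat ψ s a ⬝ᵥ v = v (ψ s, a) := by
  classical
  simp [feat, dotProduct]

lemma feat_dotProduct_ridge (hlam : 0 < lam) (ψ : S → Z) (D : Dataset S A) (f : S → ℝ)
    (s : S) (a : A) : feat ψ s a ⬝ᵥ ridge ψ D lam f = cellMean ψ D lam (ψ s, a) f := by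
  classical
  rw [feat_dotProduct, ridge, cellMean, inv_cov hlam, Matrix.mulVec_diagonal,
    sum_smul_feat_apply, mul_comm, div_eq_mul_inv]

lemma bonus_eq (hlam : 0 < lam) (ψ : S → Z) (D : Dataset S A) (alpha : ℝ) (s : S)
    (a : A) : bonus ψ D lam alpha s a =
      min (alpha * √((cellCount ψ D (ψ s, a) + lam)⁻¹)) 2 := by
  classical
  have h : feat ψ s a ⬝ᵥ ((cov ψ D lam)⁻¹ *ᵥ feat ψ s a) =
      (cellCount ψ D (ψ s, a) + lam)⁻¹ := by
    rw [feat_dotProduct, inv_cov hlam, Matrix.mulVec_diagonal]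
    simp [feat]
  rw [bonus, ← h]

end Ridge

/-! ### Planning in the learned model -/

section Planning

variable {S A Z : Type*} [Fintype A] [Fintype Z] [MeasurableSpace S]

/-- If every step gains at least `β`, then so does the value, up to the level one. -/
lemma min_le_valueFrom {P : Model S A} {r : ℕ → S → A → ℝ} {β : ℝ} (hβ : 0 ≤ β)
    (hP : ∀ h s a (f : S → ℝ) (w : ℝ), 0 ≤ w → w ≤ 1 → (∀ s', w ≤ f s') →
      w + β ≤ r h s a + P h s a f) (π : Policy S A) (k h : ℕ) (s : S) :
    min 1 (k * β) ≤ valueFrom P r π k h s := by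
  induction k generalizing h s with
  | zero => simp [valueFrom]
  | succ k ih =>
    rw [valueFrom]
    have hk : (0 : ℝ) ≤ k * β := by positivity
    -- The gain is available only for levels `w ≤ 1`, so the level carried by the induction is
    -- capped at one.
    have h1 : min 1 (((k + 1 : ℕ) : ℝ) * β) ≤ min 1 (k * β) + β := by
      push_cast
      rcases le_total 1 ((k : ℝ) * β) with h | h
      · rw [min_eq_left h]; exact (min_le_left _ _).trans (by linarith)
      · rw [min_eq_right h]; exact (min_le_right _ _).trans (by linarith)
    refine h1.trans ?_
    calc min 1 (k * β) + β = ∑ a, π.prob h s a * (min 1 (k * β) + β) := by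
          rw [← Finset.sum_mul, π.sum_eq_one, one_mul]
      _ ≤ _ := Finset.sum_le_sum fun a _ => mul_le_mul_of_nonneg_left
          (hP h s a _ _ (le_min zero_le_one hk) (min_le_left _ _) fun s' => ih (h + 1) s')
          (π.nonneg h s a)

variable [Nonempty A]

/-- The value estimates of least-squares value iteration dominate the value of every policy in
the learned model. -/
lemma valueFrom_le_lsviV {lam : ℝ} (hlam : 0 < lam) (ψ : ℕ → S → Z) (D : ℕ → Dataset S A)
    (r : ℕ → S → A → ℝ) (π : Policy S A) (k h : ℕ) (s : S) :
    valueFrom (learnedModel ψ D lam) r π k h s ≤ lsviV ψ D lam r k h s := by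
  induction k generalizing h s with
  | zero => exact le_rfl
  | succ k ih =>
    rw [valueFrom, lsviV]
    set B := Finset.univ.sup' Finset.univ_nonempty fun a =>
      ridge (ψ h) (D h) lam (lsviV ψ D lam r k (h + 1)) ⬝ᵥ feat (ψ h) s a + r h s a with hB
    calc _ ≤ ∑ a, π.prob h s a * B := by
          refine Finset.sum_le_sum fun a _ => mul_le_mul_of_nonneg_left ?_ (π.nonneg h s a)
          refine le_trans ?_ (Finset.le_sup' _ (Finset.mem_univ a))
          rw [dotProduct_comm, add_comm, learnedModel, feat_dotProduct_ridge hlam,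
            feat_dotProduct_ridge hlam]
          gcongr
          exact cellMean_mono hlam _ _ _ (ih (h + 1))
      _ = B := by rw [← Finset.sum_mul, π.sum_eq_one, one_mul]

/-- A greedy policy charges only maximizers of the `Q`-estimate, so averaging over its actions
returns the maximum. The condition `h + k = H` matches the steps to go with the horizon inside
`lsviQ`. -/
lemma lsviV_le_valueFrom_of_isLSVI {lam : ℝ} {H : ℕ} (ψ : ℕ → S → Z)
    (D : ℕ → Dataset S A) (r : ℕ → S → A → ℝ) {π : Policy S A}
    (hπ : IsLSVI H ψ D lam r π) (k h : ℕ) (hk : h + k = H) :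
    valueFrom (learnedModel ψ D lam) r π k h = lsviV ψ D lam r k h := by
  induction k generalizing h with
  | zero => rfl
  | succ k ih =>
    funext s
    rw [valueFrom, lsviV]
    set B := Finset.univ.sup' Finset.univ_nonempty fun a =>
      ridge (ψ h) (D h) lam (lsviV ψ D lam r k (h + 1)) ⬝ᵥ feat (ψ h) s a + r h s a with hB
    have hQ : ∀ a, lsviQ H ψ D lam r h s a =
        ridge (ψ h) (D h) lam (lsviV ψ D lam r k (h + 1)) ⬝ᵥ feat (ψ h) s a + r h s a := by
      intro a
      rw [lsviQ, show H - (h + 1) = k by omega]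
    rw [ih (h + 1) (by omega)]
    calc _ = ∑ a, π.prob h s a * B := by
          refine Finset.sum_congr rfl fun a _ => ?_
          rcases (π.nonneg h s a).eq_or_lt with h0 | h0
          · rw [← h0, zero_mul, zero_mul]
          · congr 1
            rw [learnedModel, dotProduct_comm, add_comm, ← hQ a]
            refine le_antisymm ?_ ?_
            · rw [hQ a, hB]
              exact Finset.le_sup' (fun a => ridge (ψ h) (D h) lam (lsviV ψ D lam r k (h + 1)) ⬝ᵥ
                feat (ψ h) s a + r h s a) (Finset.mem_univ a)
            · refine Finset.sup'_le _ _ fun a' _ => ?_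
              rw [← hQ a']
              exact hπ h (by omega) s a h0 a'
      _ = B := by rw [← Finset.sum_mul, π.sum_eq_one, one_mul]

end Planning

/-! ### The clipped value, and why clipping is harmless -/

section Clipped

variable {S A Z : Type*} [MeasurableSpace S] [Fintype A] [Fintype Z] (M : BlockMDP S A Z)

/-- `s` is reached at step `h` by a possible trajectory with reward `c` so far. -/
def BlockMDP.Reaches (h : ℕ) (s : S) (c : ℝ) : Prop :=
  ∃ (σ : ℕ → S) (α : ℕ → A), σ h = s ∧
    (∀ j, j + 1 ≤ h → j + 1 < M.H → 0 < M.T j (M.ψ j (σ j)) (α j) (M.ψ (j + 1) (σ (j + 1)))) ∧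
    ∑ j ∈ Finset.range h, M.r j (σ j) (α j) = c

variable {M}

lemma BlockMDP.Reaches.nonneg {h : ℕ} {s : S} {c : ℝ} (hr : M.Reaches h s c) : 0 ≤ c := by
  obtain ⟨σ, α, -, -, rfl⟩ := hr
  exact Finset.sum_nonneg fun j _ => M.r_nonneg _ _ _

lemma BlockMDP.Reaches.le_one {s : S} {c : ℝ} (hr : M.Reaches M.H s c) : c ≤ 1 := by
  obtain ⟨σ, α, -, h2, rfl⟩ := hr
  exact M.reward_le σ α fun h hh => h2 h hh.le hh

/-- Overwrite the action at `h` and the state at `h + 1` of a witnessing trajectory. A transition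
beyond the horizon needs no positivity, as the reward normalization does not ask for it. -/
lemma BlockMDP.Reaches.succ {h : ℕ} {s : S} {c : ℝ} (hr : M.Reaches h s c) (a : A) (s' : S)
    (hT : h + 1 < M.H → 0 < M.T h (M.ψ h s) a (M.ψ (h + 1) s')) :
    M.Reaches (h + 1) s' (c + M.r h s a) := by
  obtain ⟨σ, α, rfl, h2, rfl⟩ := hr
  refine ⟨Function.update σ (h + 1) s', Function.update α h a, by simp, fun j hj hjH => ?_, ?_⟩
  · rcases Nat.lt_or_ge j h with hlt | hge
    · rw [Function.update_of_ne (by omega), Function.update_of_ne (by omega),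
        Function.update_of_ne (by omega)]
      exact h2 j (by omega) hjH
    · obtain rfl : j = h := by omega
      rw [Function.update_of_ne (by omega)]
      simpa using hT hjH
  · rw [Finset.sum_range_succ]
    congr 1
    · refine Finset.sum_congr rfl fun j hj => ?_
      have := Finset.mem_range.1 hj
      rw [Function.update_of_ne (by omega), Function.update_of_ne (by omega)]
    · simp

variable (M) in
/-- The value function of `π` in the true MDP, clipped at one in every step. -/
def BlockMDP.clippedValue (π : Policy S A) : ℕ → ℕ → S → ℝ
  | 0, _, _ => 0
  | k + 1, h, s => min 1 (∑ a, π.prob h s a *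
      (M.r h s a + M.trueModel h s a (BlockMDP.clippedValue π k (h + 1))))

lemma BlockMDP.clippedValue_nonneg (π : Policy S A) (k h : ℕ) (s : S) :
    0 ≤ M.clippedValue π k h s := by
  induction k generalizing h s with
  | zero => exact le_rfl
  | succ k ih =>
    rw [BlockMDP.clippedValue]
    refine le_min zero_le_one (Finset.sum_nonneg fun a _ => mul_nonneg (π.nonneg h s a)
      (add_nonneg (M.r_nonneg h s a) (integral_nonneg fun s' => ih (h + 1) s')))

lemma BlockMDP.clippedValue_le_one (π : Policy S A) (k h : ℕ) (s : S) :
    M.clippedValue π k h s ≤ 1 := by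
  cases k with
  | zero => exact zero_le_one
  | succ k => exact min_le_left _ _

lemma BlockMDP.measurable_trueModel (h : ℕ) (a : A) (f : S → ℝ) :
    Measurable fun s => M.trueModel h s a f :=
  measurable_comp_of_finite (M.ψ_meas h) fun z =>
    ∫ s', f s' ∂(∑ z', ENNReal.ofReal (M.T h z a z') • M.o (h + 1) z')

lemma BlockMDP.measurable_clippedValue (π : Policy S A) (k h : ℕ) :
    Measurable (M.clippedValue π k h) := by
  cases k with
  | zero => exact measurable_const
  | succ k =>
    refine measurable_const.min (Finset.measurable_fun_sum _ fun a _ => (π.meas h a).mul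
      ((M.r_meas h a).add (M.measurable_trueModel h a _)))

lemma integrable_of_mem_Icc {T : Type*} [MeasurableSpace T] {ν : Measure T} [IsFiniteMeasure ν]
    {f : T → ℝ} (hf : Measurable f) (h0 : ∀ s, 0 ≤ f s) {b : ℝ} (h1 : ∀ s, f s ≤ b) :
    Integrable f ν :=
  Integrable.of_bound hf.aestronglyMeasurable b
    (ae_of_all _ fun s => by rw [Real.norm_eq_abs, abs_of_nonneg (h0 s)]; exact h1 s)

lemma BlockMDP.integrable_clippedValue (π : Policy S A) (k h : ℕ) (ν : Measure S)
    [IsFiniteMeasure ν] : Integrable (M.clippedValue π k h) ν :=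
  integrable_of_mem_Icc (M.measurable_clippedValue π k h) (M.clippedValue_nonneg π k h)
    (M.clippedValue_le_one π k h)

/-- After a possible trajectory with reward `c`, almost every continuation is possible and at most
`1 - c` remains to be earned, so the minimum with one is inactive. The two claims are proved jointly
since the bound is what makes clipping inactive. At states that no possible trajectory reaches, the
normalization gives no bound; the clipped value is bounded there too. -/
lemma BlockMDP.Reaches.valueFrom_eq (π : Policy S A) (k : ℕ) {h : ℕ} (hk : h + k = M.H) {s : S}
    {c : ℝ} (hr : M.Reaches h s c) :
    valueFrom M.trueModel M.r π k h s = M.clippedValue π k h s ∧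
      M.clippedValue π k h s + c ≤ 1 := by
  induction k generalizing h s c with
  | zero =>
    obtain rfl : h = M.H := hk
    exact ⟨rfl, by simpa [BlockMDP.clippedValue] using hr.le_one⟩
  | succ k ih =>
    have hae : ∀ a, ∀ᵐ s' ∂(M.trans h s a), M.Reaches (h + 1) s' (c + M.r h s a) := by
      intro a
      filter_upwards [M.ae_trans h s a] with s' hs' using hr.succ a s' fun _ => hs'
    have heq : ∀ a, M.trueModel h s a (valueFrom M.trueModel M.r π k (h + 1)) =
        M.trueModel h s a (M.clippedValue π k (h + 1)) := by
      intro a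
      refine integral_congr_ae ?_
      filter_upwards [hae a] with s' hs' using (ih (by omega) hs').1
    have hle : ∀ a, M.trueModel h s a (M.clippedValue π k (h + 1)) ≤ 1 - (c + M.r h s a) := by
      intro a
      have h1 : ∫ s', M.clippedValue π k (h + 1) s' ∂(M.trans h s a) ≤
          ∫ _, (1 - (c + M.r h s a)) ∂(M.trans h s a) := by
        refine integral_mono_ae (M.integrable_clippedValue π k (h + 1) _) (integrable_const _) ?_
        filter_upwards [hae a] with s' hs'
        linarith [(ih (by omega) hs').2]
      simp only [integral_const, probReal_univ, one_smul] at h1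
      exact h1
    have hsum : ∑ a, π.prob h s a *
        (M.r h s a + M.trueModel h s a (M.clippedValue π k (h + 1))) ≤ 1 - c := by
      calc _ ≤ ∑ a, π.prob h s a * (1 - c) := Finset.sum_le_sum fun a _ =>
            mul_le_mul_of_nonneg_left (by linarith [hle a]) (π.nonneg h s a)
        _ = 1 - c := by rw [← Finset.sum_mul, π.sum_eq_one, one_mul]
    have hc := hr.nonneg
    have hclip : M.clippedValue π (k + 1) h s = ∑ a, π.prob h s a *
        (M.r h s a + M.trueModel h s a (M.clippedValue π k (h + 1))) :=
      min_eq_right (by linarith)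
    refine ⟨?_, by rw [hclip]; linarith⟩
    rw [hclip, valueFrom]
    simp only [heq]

lemma BlockMDP.reaches_zero [Nonempty A] (s : S) : M.Reaches 0 s 0 :=
  ⟨fun _ => s, fun _ => Classical.arbitrary A, rfl, fun j hj => by omega, by simp⟩

lemma BlockMDP.value_eq_clipped [Nonempty A] (π : Policy S A) :
    M.value M.trueModel M.r π = ∫ s, M.clippedValue π M.H 0 s ∂M.d₀ := by
  refine integral_congr_ae (ae_of_all _ fun s => ?_)
  exact ((M.reaches_zero s).valueFrom_eq π M.H (by omega)).1

/-- Every first action extends to a possible trajectory, whose later rewards are nonnegative. This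
is used for integrability of the learned value. -/
lemma BlockMDP.r_zero_le_one [Nonempty A] (s : S) (a : A) : M.r 0 s a ≤ 1 := by
  obtain ⟨s', hs'⟩ := (M.ae_trans 0 s a).exists
  have h1 := (M.reaches_zero s).succ a s' fun _ => hs'
  have h2 := h1.valueFrom_eq (uniformPolicy S A) (M.H - 1) (by have := M.H_pos; omega)
  have h3 := M.clippedValue_nonneg (uniformPolicy S A) (M.H - 1) (0 + 1) s'
  linarith [h2.2]

end Clipped

lemma measurable_prod_of_finite_action {S A : Type*} [MeasurableSpace S] [Fintype A]
    [MeasurableSpace A] [MeasurableSingletonClass A] {F : S × A → ℝ}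
    (hF : ∀ a, Measurable fun s => F (s, a)) : Measurable F :=
  measurable_from_prod_countable_left hF

/-! ### The largest prediction error over actions, and its second moments -/

section Gap

variable {S A Z : Type*} [MeasurableSpace S] [Fintype A] [Nonempty A] [Fintype Z]
  (M : BlockMDP S A Z)

/-- The largest gap over the actions between `τ` at the true and `p` at another decoding. -/
def BlockMDP.maxGap (h : ℕ) (τ : Z × A → ℝ) (ψ : S → Z) (p : Z × A → ℝ) (s : S) : ℝ :=
  Finset.univ.sup' Finset.univ_nonempty fun a => |τ (M.ψ h s, a) - p (ψ s, a)|

variable {M} {h : ℕ} {τ p : Z × A → ℝ} {ψ : S → Z}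

lemma BlockMDP.le_maxGap (s : S) (a : A) :
    |τ (M.ψ h s, a) - p (ψ s, a)| ≤ M.maxGap h τ ψ p s :=
  Finset.le_sup' (fun a => |τ (M.ψ h s, a) - p (ψ s, a)|) (Finset.mem_univ a)

lemma BlockMDP.maxGap_nonneg (s : S) : 0 ≤ M.maxGap h τ ψ p s :=
  (abs_nonneg _).trans (M.le_maxGap s (Classical.arbitrary A))

lemma BlockMDP.maxGap_le_one (hτ : ∀ c, 0 ≤ τ c ∧ τ c ≤ 1) (hp : ∀ c, 0 ≤ p c ∧ p c ≤ 1)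
    (s : S) : M.maxGap h τ ψ p s ≤ 1 := by
  refine Finset.sup'_le _ _ fun a _ => abs_le.2 ⟨?_, ?_⟩
  · linarith [(hτ (M.ψ h s, a)).1, (hp (ψ s, a)).2]
  · linarith [(hτ (M.ψ h s, a)).2, (hp (ψ s, a)).1]

/-- Lipschitz dependence on the prediction; this justifies rounding it to a finite grid. -/
lemma BlockMDP.maxGap_le_add {p' : Z × A → ℝ} {ε : ℝ} (hp : ∀ c, |p c - p' c| ≤ ε) (s : S) :
    M.maxGap h τ ψ p s ≤ M.maxGap h τ ψ p' s + ε := by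
  refine Finset.sup'_le _ _ fun a _ => ?_
  have h1 : |τ (M.ψ h s, a) - p (ψ s, a)| ≤
      |τ (M.ψ h s, a) - p' (ψ s, a)| + |p' (ψ s, a) - p (ψ s, a)| := abs_sub_le _ _ _
  have h2 := hp (ψ s, a)
  rw [abs_sub_comm] at h2
  linarith [M.le_maxGap (h := h) (τ := τ) (p := p') (ψ := ψ) s a]

lemma BlockMDP.measurable_maxGap (hψ : ∀ z, MeasurableSet (ψ ⁻¹' {z})) :
    Measurable (M.maxGap h τ ψ p) :=
  measurable_comp₂_of_finite (M.ψ_meas h) hψ fun z z' =>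
    Finset.univ.sup' Finset.univ_nonempty fun a => |τ (z, a) - p (z', a)|

lemma BlockMDP.sq_maxGap_le (s : S) :
    M.maxGap h τ ψ p s ^ 2 ≤ ∑ a, (τ (M.ψ h s, a) - p (ψ s, a)) ^ 2 := by
  obtain ⟨a, _, ha⟩ := Finset.exists_mem_eq_sup' Finset.univ_nonempty
    fun a => |τ (M.ψ h s, a) - p (ψ s, a)|
  rw [BlockMDP.maxGap, ha, sq_abs]
  exact Finset.single_le_sum (f := fun a => (τ (M.ψ h s, a) - p (ψ s, a)) ^ 2)
    (fun _ _ => sq_nonneg _) (Finset.mem_univ a)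

lemma sq_integral_le {T : Type*} [MeasurableSpace T] {ν : Measure T} [IsProbabilityMeasure ν]
    {g : T → ℝ} (hg : Measurable g) (h0 : ∀ s, 0 ≤ g s) (h1 : ∀ s, g s ≤ 1) :
    (∫ s, g s ∂ν) ^ 2 ≤ ∫ s, g s ^ 2 ∂ν := by
  have hi := integrable_of_mem_Icc (ν := ν) hg h0 h1
  have hi2 : Integrable (fun s => g s ^ 2) ν :=
    integrable_of_mem_Icc (hg.pow_const 2) (fun s => sq_nonneg _) fun s =>
      pow_le_one₀ (h0 s) (h1 s)
  set m := ∫ s, g s ∂ν with hm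
  have h2 : 0 ≤ ∫ s, (g s ^ 2 - (2 * m * g s - m ^ 2)) ∂ν :=
    integral_nonneg fun s => by dsimp only [Pi.zero_apply]; nlinarith [sq_nonneg (g s - m)]
  have hj : Integrable (fun s => 2 * m * g s - m ^ 2) ν :=
    (hi.const_mul _).sub (integrable_const _)
  rw [integral_sub hi2 hj,
    integral_sub (hi.const_mul _) (integrable_const _), integral_const_mul, ← hm] at h2
  simp only [integral_const, probReal_univ, smul_eq_mul, one_mul] at h2
  nlinarith

variable [MeasurableSpace A] [MeasurableSingletonClass A]

/-- The squared maximum is at most the sum over actions, that is `|A|` times the uniform average.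
This is the price for passing from uniform actions, under which the guarantee holds, to the worst
action. -/
lemma integral_sq_maxGap_le (hτ : ∀ c, 0 ≤ τ c ∧ τ c ≤ 1) (hp : ∀ c, 0 ≤ p c ∧ p c ≤ 1)
    (hψ : ∀ z, MeasurableSet (ψ ⁻¹' {z})) (ν : Measure S) [IsProbabilityMeasure ν] :
    ∫ s, M.maxGap h τ ψ p s ^ 2 ∂ν ≤
      Fintype.card A * ∫ x, (τ (M.ψ h x.1, x.2) - p (ψ x.1, x.2)) ^ 2 ∂(withUniform A ν) := by
  have hgm := M.measurable_maxGap (h := h) (τ := τ) (p := p) hψ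
  have hi2 : Integrable (fun s => M.maxGap h τ ψ p s ^ 2) ν :=
    integrable_of_mem_Icc (hgm.pow_const 2) (fun s => sq_nonneg _) fun s =>
      pow_le_one₀ (M.maxGap_nonneg s) (M.maxGap_le_one hτ hp s)
  have hem : ∀ a, Measurable fun s => (τ (M.ψ h s, a) - p (ψ s, a)) ^ 2 := fun a =>
    measurable_comp₂_of_finite (M.ψ_meas h) hψ fun z z' => (τ (z, a) - p (z', a)) ^ 2
  have hem2 : Measurable fun x : S × A => (τ (M.ψ h x.1, x.2) - p (ψ x.1, x.2)) ^ 2 :=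
    measurable_prod_of_finite_action hem
  have hie : Integrable (fun x : S × A => (τ (M.ψ h x.1, x.2) - p (ψ x.1, x.2)) ^ 2)
      (withUniform A ν) :=
    integrable_of_mem_Icc hem2 (fun s => sq_nonneg _) fun x => by
      rw [← sq_abs]
      exact pow_le_one₀ (abs_nonneg _) ((M.le_maxGap x.1 x.2).trans (M.maxGap_le_one hτ hp x.1))
  have hnn : 0 ≤ ∫ x, (τ (M.ψ h x.1, x.2) - p (ψ x.1, x.2)) ^ 2 ∂(withUniform A ν) :=
    integral_nonneg fun x => sq_nonneg _
  rw [← ENNReal.ofReal_le_ofReal_iff (by positivity), ENNReal.ofReal_mul (by positivity),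
    ofReal_integral_eq_lintegral_ofReal hi2 (ae_of_all _ fun s => sq_nonneg _),
    ofReal_integral_eq_lintegral_ofReal hie (ae_of_all _ fun s => sq_nonneg _),
    lintegral_withUniform ν hem2.ennreal_ofReal, ENNReal.ofReal_natCast,
    ← lintegral_const_mul]
  · refine lintegral_mono fun s => ?_
    rw [← mul_assoc, ENNReal.mul_inv_cancel (by simp) (by simp), one_mul,
      ← ENNReal.ofReal_sum_of_nonneg fun a _ => sq_nonneg _]
    exact ENNReal.ofReal_le_ofReal (M.sq_maxGap_le s)
  · exact (Finset.measurable_fun_sum _ fun a _ => (hem a).ennreal_ofReal).const_mul _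

/-- Jensen for each transition law; averaging over the uniform action then yields the next-state
law. It turns the sampling law of `ρ_h` into the exploratory state law at `h + 1`. -/
lemma integral_sq_trueModel_le {g : S → ℝ} (hg : Measurable g) (h0 : ∀ s, 0 ≤ g s)
    (h1 : ∀ s, g s ≤ 1) (ν : Measure S) [IsProbabilityMeasure ν] :
    ∫ x, M.trueModel h x.1 x.2 g ^ 2 ∂(withUniform A ν) ≤
      ∫ s, g s ^ 2 ∂(M.nextDist (uniformPolicy S A) h ν) := by
  have hb : ∀ x : S × A, 0 ≤ M.trueModel h x.1 x.2 g ∧ M.trueModel h x.1 x.2 g ≤ 1 := fun x => by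
    refine ⟨integral_nonneg h0, ?_⟩
    have := integral_mono (μ := M.trans h x.1 x.2) (integrable_of_mem_Icc hg h0 h1)
      (integrable_const 1) h1
    simp only [integral_const, probReal_univ, one_smul] at this
    exact this
  have hPm : Measurable fun x : S × A => M.trueModel h x.1 x.2 g ^ 2 :=
    measurable_prod_of_finite_action fun a => (M.measurable_trueModel h a g).pow_const 2
  have hi2 : ∀ (ν' : Measure S) [IsProbabilityMeasure ν'], Integrable (fun s => g s ^ 2) ν' :=
    fun ν' _ => integrable_of_mem_Icc (hg.pow_const 2) (fun s => sq_nonneg _) fun s =>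
      pow_le_one₀ (h0 s) (h1 s)
  have hiP : Integrable (fun x : S × A => M.trueModel h x.1 x.2 g ^ 2) (withUniform A ν) :=
    integrable_of_mem_Icc hPm (fun s => sq_nonneg _) fun x => pow_le_one₀ (hb x).1 (hb x).2
  rw [← ENNReal.ofReal_le_ofReal_iff (integral_nonneg fun s => sq_nonneg _),
    ofReal_integral_eq_lintegral_ofReal hiP (ae_of_all _ fun s => sq_nonneg _),
    ofReal_integral_eq_lintegral_ofReal (hi2 _) (ae_of_all _ fun s => sq_nonneg _),
    lintegral_withUniform ν hPm.ennreal_ofReal,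
    lintegral_nextDist M _ h ν (hg.pow_const 2).ennreal_ofReal]
  refine lintegral_mono fun s => ?_
  rw [Finset.mul_sum]
  refine Finset.sum_le_sum fun a _ => ?_
  have hc : (0 : ℝ) < Fintype.card A := by exact_mod_cast Fintype.card_pos
  rw [uniformPolicy, ENNReal.ofReal_inv_of_pos hc, ENNReal.ofReal_natCast]
  gcongr
  rw [← ofReal_integral_eq_lintegral_ofReal (hi2 _) (ae_of_all _ fun s => sq_nonneg _)]
  exact ENNReal.ofReal_le_ofReal (sq_integral_le hg h0 h1)

end Gap

/-! ### Emission means and the finite class of test functions -/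

section TestFunctions

variable {S A Z : Type*} [MeasurableSpace S] [Fintype A] [Fintype Z] (M : BlockMDP S A Z)

/-- The true transitions as a function of the latent state and the action. -/
def BlockMDP.latentModel (h : ℕ) (c : Z × A) (f : S → ℝ) : ℝ :=
  ∫ s', f s' ∂(∑ z', ENNReal.ofReal (M.T h c.1 c.2 z') • M.o (h + 1) z')

lemma BlockMDP.trueModel_eq_latentModel (h : ℕ) (s : S) (a : A) (f : S → ℝ) :
    M.trueModel h s a f = M.latentModel h (M.ψ h s, a) f := rfl

/-- The expected clipped value of `π` at step `h`, given the latent state. -/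
def BlockMDP.meanValue (π : Policy S A) (h : ℕ) : S → ℝ :=
  M.emissionMean h (M.clippedValue π (M.H - h) h)

variable {M}

lemma BlockMDP.measurable_emissionMean (h : ℕ) (G : S → ℝ) : Measurable (M.emissionMean h G) :=
  measurable_comp_of_finite (M.ψ_meas h) fun z => ∫ s', G s' ∂(M.o h z)

lemma BlockMDP.emissionMean_mem {h : ℕ} {G : S → ℝ} (hG : Measurable G) (h0 : ∀ s, 0 ≤ G s)
    (h1 : ∀ s, G s ≤ 1) (s : S) : 0 ≤ M.emissionMean h G s ∧ M.emissionMean h G s ≤ 1 := by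
  refine ⟨integral_nonneg h0, ?_⟩
  have := integral_mono (μ := M.o h (M.ψ h s)) (integrable_of_mem_Icc hG h0 h1)
    (integrable_const 1) h1
  simp only [integral_const, probReal_univ, one_smul] at this
  exact this

/-- The tower property over the latent next state. It allows an arbitrary bounded function to be
replaced under `P⋆` by a function of the latent state, to which the guarantee applies. -/
lemma BlockMDP.trueModel_emissionMean {h : ℕ} {G : S → ℝ} (hG : Measurable G)
    (h0 : ∀ s, 0 ≤ G s) (h1 : ∀ s, G s ≤ 1) (s : S) (a : A) :
    M.trueModel h s a (M.emissionMean (h + 1) G) = M.trueModel h s a G := by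
  have hm := M.emissionMean_mem (h := h + 1) hG h0 h1
  rw [BlockMDP.trueModel, BlockMDP.trueModel,
    BlockMDP.integral_trans h s a fun z' => integrable_of_mem_Icc
      (M.measurable_emissionMean (h + 1) G) (fun s => (hm s).1) fun s => (hm s).2,
    BlockMDP.integral_trans h s a fun z' => integrable_of_mem_Icc hG h0 h1]
  refine Finset.sum_congr rfl fun z' _ => ?_
  congr 1
  calc _ = ∫ _, (∫ s', G s' ∂(M.o (h + 1) z')) ∂(M.o (h + 1) z') := by
        refine integral_congr_ae ?_
        filter_upwards [M.o_decode (h + 1) z'] with s' hs'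
        rw [BlockMDP.emissionMean, hs']
    _ = _ := by simp

lemma BlockMDP.trueModel_mem {h : ℕ} {f : S → ℝ} (hf : Measurable f) (h0 : ∀ s, 0 ≤ f s)
    (h1 : ∀ s, f s ≤ 1) (s : S) (a : A) :
    0 ≤ M.trueModel h s a f ∧ M.trueModel h s a f ≤ 1 := by
  refine ⟨integral_nonneg h0, ?_⟩
  have := integral_mono (μ := M.trans h s a) (integrable_of_mem_Icc hf h0 h1)
    (integrable_const 1) h1
  simp only [integral_const, probReal_univ, one_smul] at this
  exact this

lemma BlockMDP.latentModel_mem {h : ℕ} {f : S → ℝ} (hf : Measurable f) (h0 : ∀ s, 0 ≤ f s)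
    (h1 : ∀ s, f s ≤ 1) (c : Z × A) :
    0 ≤ M.latentModel h c f ∧ M.latentModel h c f ≤ 1 := by
  refine ⟨integral_nonneg h0, ?_⟩
  have hp : IsProbabilityMeasure (∑ z', ENNReal.ofReal (M.T h c.1 c.2 z') • M.o (h + 1) z') :=
    ⟨by simp [M.sum_ofReal_T]⟩
  have := integral_mono
    (μ := ∑ z', ENNReal.ofReal (M.T h c.1 c.2 z') • M.o (h + 1) z')
    (integrable_of_mem_Icc hf h0 h1) (integrable_const 1) h1
  simp only [integral_const, probReal_univ, one_smul] at this
  exact this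

lemma BlockMDP.meanValue_mem (π : Policy S A) (h : ℕ) (s : S) :
    0 ≤ M.meanValue π h s ∧ M.meanValue π h s ≤ 1 :=
  M.emissionMean_mem (M.measurable_clippedValue π _ _) (M.clippedValue_nonneg π _ _)
    (M.clippedValue_le_one π _ _) s

lemma BlockMDP.measurable_meanValue (π : Policy S A) (h : ℕ) : Measurable (M.meanValue π h) :=
  M.measurable_emissionMean h _

lemma BlockMDP.meanValue_horizon (π : Policy S A) : M.meanValue π M.H = fun _ => 0 := by
  funext s
  simp [BlockMDP.meanValue, BlockMDP.emissionMean, BlockMDP.clippedValue]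

variable [Nonempty A]

variable (M) in
open Classical in
/-- The functions of the next state whose empirical means have to concentrate at step `h`. -/
def BlockMDP.testFunctions (Φ : ℕ → Finset (S → Z)) (π : Policy S A) (n h : ℕ) :
    Finset (S → ℝ) :=
  if h + 1 < M.H then
    insert (fun s => 1 - M.clippedValue π (M.H - (h + 1)) (h + 1) s)
      ((Φ (h + 1) ×ˢ (Finset.univ : Finset (Z × A → Fin (n + 1)))).image fun q =>
        M.maxGap (h + 1) (fun c => M.latentModel (h + 1) c (M.meanValue π (h + 2))) q.1
          fun c => (q.2 c : ℝ) / n)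
  else ∅

lemma BlockMDP.card_testFunctions_le {Φ : ℕ → Finset (S → Z)} (π : Policy S A) (n : ℕ) {C : ℕ}
    (hC : ∀ h < M.H, (Φ h).card ≤ C) (h : ℕ) :
    (M.testFunctions Φ π n h).card ≤ 1 + C * (n + 1) ^ (Fintype.card Z * Fintype.card A) := by
  classical
  unfold BlockMDP.testFunctions
  split_ifs with hh
  · refine (Finset.card_insert_le _ _).trans ?_
    rw [add_comm]
    refine Nat.add_le_add_left (Finset.card_image_le.trans ?_) 1
    rw [Finset.card_product]
    refine Nat.mul_le_mul (hC _ hh) ?_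
    simp
  · simp

lemma BlockMDP.testFunctions_mem {Φ : ℕ → Finset (S → Z)}
    (hΦ : ∀ h < M.H, ∀ ψ ∈ Φ h, ∀ z, MeasurableSet (ψ ⁻¹' {z})) (π : Policy S A) (n h : ℕ)
    {G : S → ℝ} (hG : G ∈ M.testFunctions Φ π n h) :
    Measurable G ∧ (∀ s, 0 ≤ G s) ∧ ∀ s, G s ≤ 1 := by
  classical
  unfold BlockMDP.testFunctions at hG
  split_ifs at hG with hh
  · rcases Finset.mem_insert.1 hG with rfl | hG
    · exact ⟨measurable_const.sub (M.measurable_clippedValue π _ _),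
        fun s => sub_nonneg.2 (M.clippedValue_le_one π _ _ s),
        fun s => sub_le_self _ (M.clippedValue_nonneg π _ _ s)⟩
    · obtain ⟨q, hq, rfl⟩ := Finset.mem_image.1 hG
      refine ⟨M.measurable_maxGap (hΦ _ hh _ (Finset.mem_product.1 hq).1),
        fun s => M.maxGap_nonneg s, fun s => M.maxGap_le_one
        (fun c => M.latentModel_mem (M.measurable_meanValue π _) (fun s => (M.meanValue_mem π _ s).1)
          (fun s => (M.meanValue_mem π _ s).2) c) (fun c => ⟨by positivity, ?_⟩) s⟩
      refine div_le_one_of_le₀ ?_ (Nat.cast_nonneg n)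
      exact_mod_cast Nat.lt_succ_iff.1 (q.2 c).2
  · simp at hG

end TestFunctions

/-! ### From tail events to bounds on cell averages -/

section Empirical

variable {S A Z Ω : Type*}

lemma cellCount_collect (X : ℕ → ℕ → Ω → S × A × S) (n h : ℕ) (ω : Ω) (ψ : S → Z) (c : Z × A) :
    cellCount ψ (collect X n h ω) c = ∑ i ∈ Finset.range n, cellInd ψ c (X i h ω) := by
  simp only [cellCount, collect, Multiset.map_map]
  rfl

lemma cellSum_collect (X : ℕ → ℕ → Ω → S × A × S) (n h : ℕ) (ω : Ω) (ψ : S → Z) (c : Z × A)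
    (f : S → ℝ) : cellSum ψ (collect X n h ω) c f =
      ∑ i ∈ Finset.range n, cellInd ψ c (X i h ω) * f (X i h ω).2.2 := by
  simp only [cellSum, collect, Multiset.map_map]
  rfl

lemma cellCount_add_dataset (ψ : S → Z) (D D' : Dataset S A) (c : Z × A) :
    cellCount ψ (D + D') c = cellCount ψ D c + cellCount ψ D' c := by
  simp [cellCount]

lemma cellSum_add_dataset (ψ : S → Z) (D D' : Dataset S A) (c : Z × A) (f : S → ℝ) :
    cellSum ψ (D + D') c f = cellSum ψ D c f + cellSum ψ D' c f := by
  simp [cellSum]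

lemma cellCount_collect_le_collectAll (X Y : ℕ → ℕ → Ω → S × A × S) (n h : ℕ) (ω : Ω)
    (ψ : S → Z) (c : Z × A) :
    cellCount ψ (collect X n h ω) c ≤ cellCount ψ (collectAll X Y n h ω) c := by
  rw [collectAll, cellCount_add_dataset]
  linarith [cellCount_nonneg ψ (if h = 0 then 0 else collect Y n h ω) c]

/-- The realized count is one of the `n + 1` values over which the tilts range, so a tilt tuned to
it is available. -/
lemma exists_sum_cellInd_eq (ψ : S → Z) (c : Z × A) (x : ℕ → S × A × S) (n : ℕ) :
    ∃ m ≤ n, ∑ i ∈ Finset.range n, cellInd ψ c (x i) = (m : ℕ) := by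
  classical
  refine ⟨((Finset.range n).filter fun i => (ψ (x i).1, (x i).2.1) = c).card, ?_, ?_⟩
  · exact (Finset.card_filter_le _ _).trans (by simp)
  · simp only [cellInd, Finset.sum_boole]

lemma cellCount_collect_le (X : ℕ → ℕ → Ω → S × A × S) (n h : ℕ) (ω : Ω) (ψ : S → Z)
    (c : Z × A) : cellCount ψ (collect X n h ω) c ≤ n := by
  rw [cellCount_collect]
  obtain ⟨m, hm, he⟩ := exists_sum_cellInd_eq ψ c (fun i => X i h ω) n
  rw [he]
  exact_mod_cast hm

variable [MeasurableSpace S] [Fintype A] [Fintype Z] {M : BlockMDP S A Z}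

/-- With `m` the realized count, the tail event says `t (P - Q) ≤ t² m + K λ`. Dividing by `t =
√(λ/(m+λ))`, which balances the two terms, gives `(1 + K) √(λ (m+λ))`. -/
lemma sum_cell_centered_le {lam K : ℝ} (hlam : 0 < lam) {h n : ℕ} {ψ : S → Z}
    {c : Z × A} {G : S → ℝ} {x : ℕ → S × A × S}
    (hx : ∀ m ≤ n, ∑ i ∈ Finset.range n, tilted M h ψ c G (tiltScale lam m) (x i) ≤ K * lam) :
    ∑ i ∈ Finset.range n, cellInd ψ c (x i) * G (x i).2.2 ≤
      ∑ i ∈ Finset.range n, cellInd ψ c (x i) * M.emissionMean (h + 1) G (x i).2.2 +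
        (1 + K) * (√lam * √(∑ i ∈ Finset.range n, cellInd ψ c (x i) + lam)) := by
  obtain ⟨m, hm, he⟩ := exists_sum_cellInd_eq ψ c x n
  have h1 := hx m hm
  set t := tiltScale lam m with ht
  have e1 : ∑ i ∈ Finset.range n, tilted M h ψ c G t (x i) =
      t * (∑ i ∈ Finset.range n, cellInd ψ c (x i) * G (x i).2.2 -
        ∑ i ∈ Finset.range n, cellInd ψ c (x i) * M.emissionMean (h + 1) G (x i).2.2) -
      t ^ 2 * m := by
    rw [← he, ← Finset.sum_sub_distrib, Finset.mul_sum, Finset.mul_sum, ← Finset.sum_sub_distrib]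
    refine Finset.sum_congr rfl fun i _ => ?_
    rw [tilted]
    ring
  rw [e1] at h1
  rw [he]
  set P := ∑ i ∈ Finset.range n, cellInd ψ c (x i) * G (x i).2.2
  set Q := ∑ i ∈ Finset.range n, cellInd ψ c (x i) * M.emissionMean (h + 1) G (x i).2.2
  have hml : (0 : ℝ) < m + lam := by positivity
  set l := √lam with hl
  set u := √((m : ℝ) + lam) with hu
  have hl0 : 0 < l := Real.sqrt_pos.2 hlam
  have hu0 : 0 < u := Real.sqrt_pos.2 hml
  have hl2 : l ^ 2 = lam := Real.sq_sqrt hlam.le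
  have hu2 : u ^ 2 = m + lam := Real.sq_sqrt hml.le
  have htlu : t = l / u := by rw [ht, tiltScale, Real.sqrt_div hlam.le]
  have ht0 : 0 < t := by rw [htlu]; positivity
  have htu : t * u = l := by rw [htlu]; field_simp
  have h2 : t * (P - Q) ≤ t * ((1 + K) * (l * u)) := by
    calc t * (P - Q) ≤ t ^ 2 * m + K * lam := by linarith
      _ ≤ t ^ 2 * u ^ 2 + K * lam := by rw [hu2]; gcongr; linarith
      _ = (t * u) ^ 2 + K * l ^ 2 := by rw [hl2]; ring
      _ = (1 + K) * (l * l) := by rw [htu]; ring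
      _ = t * ((1 + K) * (l * u)) := by
        calc (1 + K) * (l * l) = (1 + K) * (l * (t * u)) := by rw [htu]
          _ = _ := by ring
  have := le_of_mul_le_mul_left h2 ht0
  linarith

end Empirical

section RunBounds

variable {S A Z Ω : Type*} [MeasurableSpace S] [Fintype A] [Nonempty A] [Fintype Z]
  {M : BlockMDP S A Z} {Φ : ℕ → Finset (S → Z)}

/-- Take the true features with `θ (z, a) = u z` and `θ' = 0` in the first discriminator class; the
average over actions does nothing. Realizability of the features enters the argument here. -/
lemma emissionClass_mem_discr {h : ℕ} (hψ : M.ψ (h + 1) ∈ Φ (h + 1)) (C : ℝ) {u : Z → ℝ}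
    (hu : ∀ z, |u z| ≤ 1) : (fun s => u (M.ψ (h + 1) s)) ∈ discr M Φ C h := by
  refine Or.inl ⟨M.ψ (h + 1), hψ, M.ψ (h + 1), hψ, fun c => u c.1, 0, ?_, by simp, ?_⟩
  · rw [pi_norm_le_iff_of_nonneg zero_le_one]
    exact fun c => hu c.1
  · funext s
    have hc : (Fintype.card A : ℝ) ≠ 0 := by simp
    simp only [feat_dotProduct, Pi.zero_apply, sub_zero, Finset.sum_const, Finset.card_univ,
      nsmul_eq_mul]
    rw [← mul_assoc, inv_mul_cancel₀ hc, one_mul]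

variable [MeasurableSpace A] [MeasurableSpace Ω] {N : ℕ} {lam alpha : ℕ → ℝ} {μ : Measure Ω}

lemma Run.Phat_eq (R : Run M Φ N lam alpha μ) {n : ℕ} (hlam : 0 < lam n) (ω : Ω) (h : ℕ) (s : S)
    (a : A) (f : S → ℝ) : R.Phat n ω h s a f =
      cellMean (R.ψhat n h ω) (collectAll R.X R.Y n h ω) (lam n) (R.ψhat n h ω s, a) f :=
  feat_dotProduct_ridge hlam _ _ _ _ _

/-- The two data sources contribute one deviation each, hence the factor 2. Normalization is by the
joint count, but the bound is weakened to the count in `D_h` alone, the one that the bonus sees. -/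
lemma Run.cellMean_le_of_concentrated (R : Run M Φ N lam alpha μ) {K : ℝ} (hK : 0 ≤ K)
    {𝒢 : ℕ → Finset (S → ℝ)} {n : ℕ} (hlam : 0 < lam n) {ω : Ω} (hc : R.Concentrated K 𝒢 n ω)
    {h : ℕ} (hh : h < M.H) {ψ : S → Z} (hψ : ψ ∈ Φ h) (c : Z × A) {G : S → ℝ} (hG : G ∈ 𝒢 h) :
    cellMean ψ (collectAll R.X R.Y n h ω) (lam n) c G ≤
      cellMean ψ (collectAll R.X R.Y n h ω) (lam n) c (M.emissionMean (h + 1) G) +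
        2 * (1 + K) * √(lam n / (cellCount ψ (collect R.X n h ω) c + lam n)) := by
  set D := collectAll R.X R.Y n h ω with hD
  set Nb := cellCount ψ D c with hNb
  have hpos : 0 < Nb + lam n := cellCount_add_pos hlam ψ D c
  set l := √(lam n) with hl
  set u := √(Nb + lam n) with hu
  have hu0 : 0 < u := Real.sqrt_pos.2 hpos
  have hu2 : u ^ 2 = Nb + lam n := Real.sq_sqrt hpos.le
  have hl0 : 0 ≤ l := Real.sqrt_nonneg _
  have hX := sum_cell_centered_le hlam (hc.emissionX h hh ψ hψ c G hG)
  rw [← cellSum_collect, ← cellSum_collect, ← cellCount_collect] at hX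
  have hsum : cellSum ψ D c G ≤ cellSum ψ D c (M.emissionMean (h + 1) G) +
      2 * ((1 + K) * (l * u)) := by
    have hXc := cellCount_collect_le_collectAll R.X R.Y n h ω ψ c
    have hX' : (1 + K) * (l * √(cellCount ψ (collect R.X n h ω) c + lam n)) ≤
        (1 + K) * (l * u) := by
      gcongr
      exact Real.sqrt_le_sqrt (by linarith)
    have hlu : 0 ≤ (1 + K) * (l * u) := by positivity
    rw [hD, collectAll, cellSum_add_dataset, cellSum_add_dataset]
    by_cases h0 : h = 0
    · simp only [h0, if_true]
      subst h0
      simp only [cellSum, Multiset.map_zero, Multiset.sum_zero] at hX ⊢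
      linarith
    · have hY := sum_cell_centered_le hlam (hc.emissionY h hh (Nat.pos_of_ne_zero h0) ψ hψ c G hG)
      rw [← cellSum_collect, ← cellSum_collect, ← cellCount_collect] at hY
      have hYc : cellCount ψ (collect R.Y n h ω) c ≤ Nb := by
        rw [hNb, hD, collectAll, cellCount_add_dataset, if_neg h0]
        linarith [cellCount_nonneg ψ (collect R.X n h ω) c]
      have hY' : (1 + K) * (l * √(cellCount ψ (collect R.Y n h ω) c + lam n)) ≤
          (1 + K) * (l * u) := by
        gcongr
        exact Real.sqrt_le_sqrt (by linarith)
      simp only [h0, if_false]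
      linarith
  have hq : l / u ≤ √(lam n / (cellCount ψ (collect R.X n h ω) c + lam n)) := by
    rw [hl, hu, ← Real.sqrt_div hlam.le]
    apply Real.sqrt_le_sqrt
    have := cellCount_add_pos hlam ψ (collect R.X n h ω) c
    have := cellCount_collect_le_collectAll R.X R.Y n h ω ψ c
    gcongr
  calc cellMean ψ D (lam n) c G ≤ (cellSum ψ D c (M.emissionMean (h + 1) G) +
          2 * ((1 + K) * (l * u))) / (Nb + lam n) := div_le_div_of_nonneg_right hsum hpos.le
    _ = cellMean ψ D (lam n) c (M.emissionMean (h + 1) G) + 2 * (1 + K) * (l / u) := by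
        rw [add_div, cellMean, ← hNb]
        congr 1
        rw [← hu2]
        field_simp
    _ ≤ _ := by gcongr

lemma sum_integral_le_of_average_le {T : Type*} [MeasurableSpace T] {n : ℕ} (hn : 1 ≤ n)
    {ν : ℕ → Measure T} (hν : ∀ i, IsProbabilityMeasure (ν i)) {F : T → ℝ} (hF : Measurable F)
    {b : ℝ} (h0 : ∀ x, 0 ≤ F x) (h1 : ∀ x, F x ≤ b) {ζ : ℝ}
    (h : ∫ x, F x ∂((n : ℝ≥0∞)⁻¹ • ∑ i ∈ Finset.range n, ν i) ≤ ζ) :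
    ∑ i ∈ Finset.range n, ∫ x, F x ∂(ν i) ≤ n * ζ := by
  have hn' : (0 : ℝ) < n := by exact_mod_cast hn
  rw [integral_smul_measure, integral_finsetSum_measure
    (fun i _ => integrable_of_mem_Icc hF h0 h1)] at h
  simp only [ENNReal.toReal_inv, ENNReal.toReal_natCast, smul_eq_mul] at h
  rwa [inv_mul_le_iff₀ hn'] at h

end RunBounds

/-! ### Prediction errors along a run and their transport through the learned model -/

section Values

variable {S A Z : Type*} [MeasurableSpace S] [Fintype A]

lemma valueFrom_nonneg {P : Model S A} {r : ℕ → S → A → ℝ} (hr : ∀ h s a, 0 ≤ r h s a)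
    (hP : ∀ h s a f, (∀ s', 0 ≤ f s') → 0 ≤ P h s a f) (π : Policy S A) (k h : ℕ) (s : S) :
    0 ≤ valueFrom P r π k h s := by
  induction k generalizing h s with
  | zero => exact le_rfl
  | succ k ih =>
    exact Finset.sum_nonneg fun a _ => mul_nonneg (π.nonneg h s a)
      (add_nonneg (hr h s a) (hP h s a _ fun s' => ih (h + 1) s'))

variable [Fintype Z] (M : BlockMDP S A Z)

/-- The expected clipped value of `π` at step `h + 1`, given the latent state and the action at
step `h`. -/
def BlockMDP.latentValue (π : Policy S A) (h : ℕ) (c : Z × A) : ℝ :=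
  M.latentModel h c (M.meanValue π (h + 1))

variable {M}

lemma BlockMDP.latentValue_mem (π : Policy S A) (h : ℕ) (c : Z × A) :
    0 ≤ M.latentValue π h c ∧ M.latentValue π h c ≤ 1 :=
  M.latentModel_mem (M.measurable_meanValue π _) (fun s => (M.meanValue_mem π _ s).1)
    (fun s => (M.meanValue_mem π _ s).2) c

end Values

section Optimism

variable {S A Z Ω : Type*} [MeasurableSpace S] [Fintype A] [Nonempty A] [MeasurableSpace A]
  [Fintype Z] [MeasurableSpace Ω]
  {M : BlockMDP S A Z} {Φ : ℕ → Finset (S → Z)} {N : ℕ} {lam alpha : ℕ → ℝ} {μ : Measure Ω}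

/-- The estimate of `BlockMDP.latentValue` by the learned model. -/
def Run.predictedValue (R : Run M Φ N lam alpha μ) (π : Policy S A) (n : ℕ) (ω : Ω) (h : ℕ)
    (c : Z × A) : ℝ :=
  cellMean (R.ψhat n h ω) (collectAll R.X R.Y n h ω) (lam n) c (M.meanValue π (h + 1))

/-- The largest error of the learned model over the actions. -/
def Run.gap (R : Run M Φ N lam alpha μ) (π : Policy S A) (n : ℕ) (ω : Ω) (h : ℕ) : S → ℝ :=
  M.maxGap h (M.latentValue π h) (R.ψhat n h ω) (R.predictedValue π n ω h)

lemma Run.predictedValue_mem (R : Run M Φ N lam alpha μ) (π : Policy S A) {n : ℕ}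
    (hlam : 0 < lam n) (ω : Ω) (h : ℕ) (c : Z × A) :
    0 ≤ R.predictedValue π n ω h c ∧ R.predictedValue π n ω h c ≤ 1 :=
  ⟨cellMean_nonneg hlam _ _ _ fun s => (M.meanValue_mem π _ s).1,
    cellMean_le_const hlam _ _ _ zero_le_one fun s => (M.meanValue_mem π _ s).2⟩

lemma Run.gap_nonneg (R : Run M Φ N lam alpha μ) (π : Policy S A) (n : ℕ) (ω : Ω) (h : ℕ)
    (s : S) : 0 ≤ R.gap π n ω h s := M.maxGap_nonneg s

lemma Run.gap_le_one (R : Run M Φ N lam alpha μ) (π : Policy S A) {n : ℕ}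
    (hlam : 0 < lam n) (ω : Ω) (h : ℕ) (s : S) : R.gap π n ω h s ≤ 1 :=
  M.maxGap_le_one (M.latentValue_mem π h) (R.predictedValue_mem π hlam ω h) s

lemma Run.measurable_gap (R : Run M Φ N lam alpha μ)
    (hΦ : ∀ h < M.H, ∀ ψ ∈ Φ h, ∀ z, MeasurableSet (ψ ⁻¹' {z})) (π : Policy S A) {n : ℕ}
    (hn : 1 ≤ n) (hnN : n ≤ N) (ω : Ω) {h : ℕ} (hh : h < M.H) : Measurable (R.gap π n ω h) :=
  M.measurable_maxGap (hΦ h hh _ (R.ψhat_mem n hn hnN h hh ω))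

/-- The empirical mean of the error is close to that of its emission means: the error is one of
the test functions up to rounding the predictions to a grid. -/
lemma Run.cellMean_gap_le (R : Run M Φ N lam alpha μ)
    (hΦ : ∀ h < M.H, ∀ ψ ∈ Φ h, ∀ z, MeasurableSet (ψ ⁻¹' {z}))
    (π : Policy S A) {n : ℕ} (hn : 1 ≤ n) (hnN : n ≤ N) (hlam : 0 < lam n) {ω : Ω} {K : ℝ}
    (hK : 0 ≤ K) (hc : R.Concentrated K (M.testFunctions Φ π n) n ω) {h : ℕ} (hh : h + 1 < M.H)
    (c : Z × A) :
    cellMean (R.ψhat n h ω) (collectAll R.X R.Y n h ω) (lam n) c (R.gap π n ω (h + 1)) ≤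
      cellMean (R.ψhat n h ω) (collectAll R.X R.Y n h ω) (lam n) c
        (M.emissionMean (h + 1) (R.gap π n ω (h + 1))) +
      2 * (1 + K) * √(lam n / (cellCount (R.ψhat n h ω) (collect R.X n h ω) c + lam n)) +
        2 / n := by
  classical
  have hn0 : (0 : ℝ) < n := by exact_mod_cast hn
  set p := R.predictedValue π n ω (h + 1) with hp
  have hp01 := R.predictedValue_mem π hlam ω (h + 1)
  -- The predictions depend on the data, so the gap is not itself a fixed test function. Rounding
  -- them down to multiples of `1/n` gives one, at an error `1/n` on either side of the comparison.
  let θ : Z × A → Fin (n + 1) := fun c => ⟨⌊n * p c⌋₊, by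
    refine Nat.lt_succ_of_le (Nat.floor_le_of_le ?_)
    exact mul_le_of_le_one_right hn0.le (hp01 c).2⟩
  let p' : Z × A → ℝ := fun c => (θ c : ℝ) / n
  have hpp : ∀ c, |p c - p' c| ≤ 1 / n := by
    intro c
    have h1 : ((⌊n * p c⌋₊ : ℕ) : ℝ) ≤ n * p c := Nat.floor_le (mul_nonneg hn0.le (hp01 c).1)
    have h2 : n * p c < (⌊n * p c⌋₊ : ℕ) + 1 := Nat.lt_floor_add_one _
    have e : p c - p' c = (n * p c - (⌊n * p c⌋₊ : ℕ)) / n := by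
      simp only [p', θ]; field_simp
    rw [e, abs_of_nonneg (div_nonneg (by linarith) hn0.le)]
    gcongr
    linarith
  have hψΦ := R.ψhat_mem n hn hnN (h + 1) hh ω
  set g' := M.maxGap (h + 1) (M.latentValue π (h + 1)) (R.ψhat n (h + 1) ω) p' with hg'
  have hmem : g' ∈ M.testFunctions Φ π n h := by
    rw [BlockMDP.testFunctions, if_pos hh]
    refine Finset.mem_insert_of_mem (Finset.mem_image.2 ⟨(R.ψhat n (h + 1) ω, θ), ?_, rfl⟩)
    exact Finset.mem_product.2 ⟨hψΦ, Finset.mem_univ _⟩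
  have hle1 : ∀ s, R.gap π n ω (h + 1) s ≤ g' s + 1 / n := M.maxGap_le_add hpp
  have hle2 : ∀ s, g' s ≤ R.gap π n ω (h + 1) s + 1 / n :=
    M.maxGap_le_add fun c => by rw [abs_sub_comm]; exact hpp c
  obtain ⟨hgm', hg0', hg1'⟩ := M.testFunctions_mem hΦ π n h hmem
  have hgm := R.measurable_gap hΦ π hn hnN ω hh
  have hg0 := R.gap_nonneg π n ω (h + 1)
  have hg1 := R.gap_le_one π hlam ω (h + 1)
  have hmean : ∀ s, M.emissionMean (h + 1) g' s ≤
      M.emissionMean (h + 1) (R.gap π n ω (h + 1)) s + 1 / n := by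
    intro s
    have hi := integrable_of_mem_Icc (ν := M.o (h + 1) (M.ψ (h + 1) s)) hgm hg0 hg1
    have := integral_mono (μ := M.o (h + 1) (M.ψ (h + 1) s))
      (integrable_of_mem_Icc hgm' hg0' hg1') (hi.add (integrable_const (1 / (n : ℝ)))) hle2
    simp only [Pi.add_apply] at this
    rw [integral_add hi (integrable_const _)] at this
    simpa [BlockMDP.emissionMean] using this
  set D := collectAll R.X R.Y n h ω with hD
  set ψ := R.ψhat n h ω with hψdef
  have hconst : cellMean ψ D (lam n) c (fun _ => 1 / (n : ℝ)) ≤ 1 / n :=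
    cellMean_le_const hlam _ _ _ (by positivity) fun _ => le_rfl
  have h1 := cellMean_mono hlam ψ D c hle1
  have h2 := cellMean_mono hlam ψ D c hmean
  have h3 := R.cellMean_le_of_concentrated hK hlam hc (by omega)
    (R.ψhat_mem n hn hnN h (by omega) ω) c hmem
  rw [cellMean_add] at h1 h2
  have : (2 : ℝ) / n = 1 / n + 1 / n := by ring
  linarith

variable [MeasurableSingletonClass A]

/-- The mean value given the latent state is a discriminator. At the last step, which the guarantee
omits, the next value is zero and so is the error. -/
lemma Run.sum_sq_error_le (R : Run M Φ N lam alpha μ)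
    (hΦ : ∀ h < M.H, ∀ ψ ∈ Φ h, ∀ z, MeasurableSet (ψ ⁻¹' {z})) (hψ : ∀ h < M.H, M.ψ h ∈ Φ h)
    (π : Policy S A) {n : ℕ} (hn : 1 ≤ n) (hnN : n ≤ N) (hlam : 0 < lam n) {ω : Ω} {ζ : ℝ}
    (hζ : 0 ≤ ζ) (hg : R.Guarantee ζ n ω) {h : ℕ} (hh : h < M.H) :
    (∑ i ∈ Finset.range n, ∫ x, (M.latentValue π h (M.ψ h x.1, x.2) -
        R.predictedValue π n ω h (R.ψhat n h ω x.1, x.2)) ^ 2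
          ∂(withUniform A (M.stateDist (R.πhat i ω) h)) ≤ n * ζ) ∧
    (0 < h → ∑ i ∈ Finset.range n, ∫ x, (M.latentValue π h (M.ψ h x.1, x.2) -
        R.predictedValue π n ω h (R.ψhat n h ω x.1, x.2)) ^ 2
          ∂(withUniform A (M.exploreDist (R.πhat i ω) h)) ≤ n * ζ) := by
  set F : S × A → ℝ := fun x => (M.latentValue π h (M.ψ h x.1, x.2) -
        R.predictedValue π n ω h (R.ψhat n h ω x.1, x.2)) ^ 2 with hF
  have hψm := hΦ h hh _ (R.ψhat_mem n hn hnN h hh ω)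
  by_cases hlast : h + 1 < M.H
  · have hFm : Measurable F := measurable_prod_of_finite_action fun a =>
      measurable_comp₂_of_finite (M.ψ_meas h) hψm fun z z' =>
        (M.latentValue π h (z, a) - R.predictedValue π n ω h (z', a)) ^ 2
    have hF1 : ∀ x, F x ≤ 1 := fun x => by
      change (_ - _) ^ 2 ≤ (1 : ℝ)
      rw [← sq_abs]
      exact pow_le_one₀ (abs_nonneg _) ((M.le_maxGap x.1 x.2).trans (R.gap_le_one π hlam ω h x.1))
    have hmem : M.meanValue π (h + 1) ∈ discr M Φ (alpha N / √(lam N)) h := by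
      refine emissionClass_mem_discr (hψ _ hlast) _
        (u := fun z => ∫ s', M.clippedValue π (M.H - (h + 1)) (h + 1) s' ∂(M.o (h + 1) z))
        fun z => ?_
      rw [abs_of_nonneg (integral_nonneg fun s => M.clippedValue_nonneg π _ _ s)]
      have := integral_mono (M.integrable_clippedValue π (M.H - (h + 1)) (h + 1) (M.o (h + 1) z))
        (integrable_const 1) (M.clippedValue_le_one π _ _)
      simpa using this
    have hFe : (fun p : S × A => (R.Phat n ω h p.1 p.2 (M.meanValue π (h + 1)) -
        M.trueModel h p.1 p.2 (M.meanValue π (h + 1))) ^ 2) = F := by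
      funext p
      rw [R.Phat_eq hlam, M.trueModel_eq_latentModel, sub_sq_comm]
      rfl
    obtain ⟨h1, h2⟩ := hg h hlast _ hmem
    simp only [hFe] at h1 h2
    refine ⟨sum_integral_le_of_average_le hn (fun i => inferInstance) hFm (fun x => sq_nonneg _)
      hF1 h1, fun h0 => sum_integral_le_of_average_le hn (fun i => inferInstance) hFm
      (fun x => sq_nonneg _) hF1 (h2 h0)⟩
  · have hH : h + 1 = M.H := by omega
    have hF0 : F = fun _ => 0 := by
      funext x
      simp only [hF, BlockMDP.latentValue, Run.predictedValue, hH, M.meanValue_horizon,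
        cellMean_const]
      simp [BlockMDP.latentModel]
    have hnn : (0 : ℝ) ≤ n * ζ := by positivity
    simp only [hF0, integral_zero, Finset.sum_const_zero]
    exact ⟨hnn, fun _ => hnn⟩

/-- The learned model transports the error at step `h + 1` back to step `h` at a price controlled
by the elliptical potential of the cell. -/
lemma Run.sq_cellMean_gap_le (R : Run M Φ N lam alpha μ)
    (hΦ : ∀ h < M.H, ∀ ψ ∈ Φ h, ∀ z, MeasurableSet (ψ ⁻¹' {z})) (hψ : ∀ h < M.H, M.ψ h ∈ Φ h)
    (π : Policy S A) {n : ℕ} (hn : 1 ≤ n) (hnN : n ≤ N) (hlam : 0 < lam n) {ω : Ω} {ζ : ℝ}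
    (hζ : 0 ≤ ζ) (hg : R.Guarantee ζ n ω) {K : ℝ} (hK : 0 ≤ K) {𝒢 : ℕ → Finset (S → ℝ)}
    (hc : R.Concentrated K 𝒢 n ω) {h : ℕ} (hh : h + 1 < M.H) (c : Z × A) :
    (cellCount (R.ψhat n h ω) (collect R.X n h ω) c + lam n) *
      cellMean (R.ψhat n h ω) (collectAll R.X R.Y n h ω) (lam n) c
        (M.emissionMean (h + 1) (R.gap π n ω (h + 1))) ^ 2 ≤
      4 * (n * ζ) + 4 * (Fintype.card A * (n * ζ)) + (K + 1) * lam n := by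
  set g := R.gap π n ω (h + 1) with hgdef
  have hgm : Measurable g := R.measurable_gap hΦ π hn hnN ω hh
  have hg0 : ∀ s, 0 ≤ g s := R.gap_nonneg π n ω (h + 1)
  have hg1 : ∀ s, g s ≤ 1 := R.gap_le_one π hlam ω (h + 1)
  set gb := M.emissionMean (h + 1) g with hgb
  have hgbm : Measurable gb := M.measurable_emissionMean (h + 1) g
  have hgb01 : ∀ s, 0 ≤ gb s ∧ gb s ≤ 1 := M.emissionMean_mem hgm hg0 hg1
  set ψ := R.ψhat n h ω with hψdef
  have hψΦ : ψ ∈ Φ h := R.ψhat_mem n hn hnN h (by omega) ω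
  have hψm := hΦ h (by omega) ψ hψΦ
  set D := collectAll R.X R.Y n h ω with hD
  set y := cellMean ψ D (lam n) c gb with hy
  have hy01 : ∀ c', 0 ≤ cellMean ψ D (lam n) c' gb ∧ cellMean ψ D (lam n) c' gb ≤ 1 := fun c' =>
    ⟨cellMean_nonneg hlam _ _ _ fun s => (hgb01 s).1,
      cellMean_le_const hlam _ _ _ zero_le_one fun s => (hgb01 s).2⟩
  have hy2 : y ^ 2 ≤ 1 := pow_le_one₀ (hy01 c).1 (hy01 c).2
  let ν : ℕ → Measure (S × A) := fun i => withUniform A (M.stateDist (R.πhat i ω) h)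
  have hP01 : ∀ s a, 0 ≤ M.trueModel h s a gb ∧ M.trueModel h s a gb ≤ 1 := fun s a =>
    M.trueModel_mem hgbm (fun s => (hgb01 s).1) (fun s => (hgb01 s).2) s a
  let F : S × A → ℝ := fun x => (R.Phat n ω h x.1 x.2 gb - M.trueModel h x.1 x.2 gb) ^ 2
  let T : S × A → ℝ := fun x => M.trueModel h x.1 x.2 gb ^ 2
  have hFm : Measurable F := measurable_prod_of_finite_action fun a => by
    simp only [F, R.Phat_eq hlam, M.trueModel_eq_latentModel]
    exact measurable_comp₂_of_finite (M.ψ_meas h) hψm fun z z' =>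
        (cellMean ψ D (lam n) (z', a) gb - M.latentModel h (z, a) gb) ^ 2
  have hTm : Measurable T := measurable_prod_of_finite_action fun a =>
    (M.measurable_trueModel h a gb).pow_const 2
  have hF1 : ∀ x, F x ≤ 1 := fun x => by
    simp only [F, R.Phat_eq hlam]
    rw [← sq_abs]
    refine pow_le_one₀ (abs_nonneg _) (abs_le.2 ⟨?_, ?_⟩)
    · linarith [(hy01 (ψ x.1, x.2)).1, (hP01 x.1 x.2).2]
    · linarith [(hy01 (ψ x.1, x.2)).2, (hP01 x.1 x.2).1]
  have hT1 : ∀ x, T x ≤ 1 := fun x => pow_le_one₀ (hP01 x.1 x.2).1 (hP01 x.1 x.2).2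
  have hFi : ∀ i, Integrable F (ν i) := fun i =>
    integrable_of_mem_Icc hFm (fun x => sq_nonneg _) hF1
  have hTi : ∀ i, Integrable T (ν i) := fun i =>
    integrable_of_mem_Icc hTm (fun x => sq_nonneg _) hT1
  have hFsum : ∑ i ∈ Finset.range n, ∫ x, F x ∂(ν i) ≤ n * ζ := by
    refine sum_integral_le_of_average_le hn (fun i => inferInstance) hFm (fun x => sq_nonneg _)
      hF1 (hg h hh gb ?_).1
    refine emissionClass_mem_discr (hψ _ hh) _ (u := fun z => ∫ s', g s' ∂(M.o (h + 1) z))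
        fun z => ?_
    rw [abs_of_nonneg (integral_nonneg hg0)]
    have := integral_mono (integrable_of_mem_Icc (ν := M.o (h + 1) z) hgm hg0 hg1)
      (integrable_const 1) hg1
    simpa using this
  -- `P⋆ ḡ = P⋆ g`. Jensen moves its second moment to `g²` under the exploratory law at `h + 1`,
  -- where the `β`-guarantee bounds it at the price `|A|`.
  have hTsum : ∑ i ∈ Finset.range n, ∫ x, T x ∂(ν i) ≤ Fintype.card A * (n * ζ) := by
    refine le_trans (Finset.sum_le_sum fun i _ => ?_) (le_trans (Finset.mul_sum _ _ _).symm.le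
      (mul_le_mul_of_nonneg_left ((R.sum_sq_error_le hΦ hψ π hn hnN hlam hζ hg hh).2
        (Nat.succ_pos h)) (Nat.cast_nonneg _)))
    have e : ∀ x, T x = M.trueModel h x.1 x.2 g ^ 2 := fun x => by
      simp only [T, hgb]
      rw [M.trueModel_emissionMean hgm hg0 hg1]
    simp only [e]
    refine (integral_sq_trueModel_le hgm hg0 hg1 _).trans ?_
    exact integral_sq_maxGap_le (M.latentValue_mem π (h + 1))
      (R.predictedValue_mem π hlam ω (h + 1)) (hΦ _ hh _ (R.ψhat_mem n hn hnN _ hh ω))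
      (M.exploreDist (R.πhat i ω) (h + 1))
  -- On the cell the learned prediction is the constant `y`, and `y² ≤ 2 (y - P⋆ḡ)² + 2 (P⋆ḡ)²`.
  have hcell : ∀ i, (ν i).real (cell ψ c) * y ^ 2 ≤ 2 * ∫ x, F x ∂(ν i) + 2 * ∫ x, T x ∂(ν i) := by
    intro i
    have e : (ν i).real (cell ψ c) * y ^ 2 =
        ∫ x, (cell ψ c).indicator (fun _ => y ^ 2) x ∂(ν i) := by
      rw [integral_indicator_const _ (measurableSet_cell hψm c), smul_eq_mul]
    rw [e, ← integral_const_mul, ← integral_const_mul,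
      ← integral_add ((hFi i).const_mul 2) ((hTi i).const_mul 2)]
    refine integral_mono ((integrable_const _).indicator (measurableSet_cell hψm c))
      (((hFi i).const_mul 2).add ((hTi i).const_mul 2)) fun x => ?_
    dsimp only
    by_cases hx : x ∈ cell ψ c
    · rw [Set.indicator_of_mem hx]
      have hxc : (ψ x.1, x.2) = c := hx
      simp only [F, T, R.Phat_eq hlam]
      rw [← hψdef, ← hD, hxc, ← hy]
      nlinarith [sq_nonneg (y - 2 * M.trueModel h x.1 x.2 gb)]
    · rw [Set.indicator_of_notMem hx]
      have h1 : 0 ≤ F x := sq_nonneg _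
      have h2 : 0 ≤ T x := sq_nonneg _
      linarith
  -- The tail bound for counts replaces the random count by twice the expected number of visits,
  -- over which the guarantee is summed.
  have hcount := hc.count h (by omega) ψ hψΦ c
  rw [← cellCount_collect] at hcount
  have hsum : (∑ i ∈ Finset.range n, (ν i).real (cell ψ c)) * y ^ 2 ≤
      2 * (n * ζ) + 2 * (Fintype.card A * (n * ζ)) := by
    rw [Finset.sum_mul]
    refine (Finset.sum_le_sum fun i _ => hcell i).trans ?_
    rw [Finset.sum_add_distrib, ← Finset.mul_sum, ← Finset.mul_sum]
    linarith
  calc (cellCount ψ (collect R.X n h ω) c + lam n) * y ^ 2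
      ≤ (2 * ∑ i ∈ Finset.range n, (ν i).real (cell ψ c) + K * lam n + lam n) * y ^ 2 := by
        gcongr
    _ = 2 * ((∑ i ∈ Finset.range n, (ν i).real (cell ψ c)) * y ^ 2) + (K + 1) * lam n * y ^ 2 := by
        ring
    _ ≤ 2 * (2 * (n * ζ) + 2 * (Fintype.card A * (n * ζ))) + (K + 1) * lam n * 1 := by
        gcongr
    _ = _ := by ring

end Optimism

/-! ### Comparison of all errors with the bonus scale -/

section Numeric

/-- Absorbs the rounding error: `N + λ ≤ n + λ ≤ (1 + 1/κ') λ n` because `λ ≥ κ'`, and a number in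
`[0,1]` is at most its square root. -/
lemma two_div_le_scale {κ' lam N : ℝ} {n : ℕ} (hκ : 0 < κ') (hlam : κ' ≤ lam) (hn : 1 ≤ n)
    (hN0 : 0 ≤ N) (hN : N ≤ n) : 2 / (n : ℝ) ≤ 2 * (1 + 1 / κ') * √(lam / (N + lam)) := by
  have hlam0 : 0 < lam := hκ.trans_le hlam
  have hn' : (1 : ℝ) ≤ n := by exact_mod_cast hn
  have hx1 : lam / (N + lam) ≤ 1 := by rw [div_le_one (by positivity)]; linarith
  have hx0 : 0 ≤ lam / (N + lam) := by positivity
  have h1 : lam / (N + lam) ≤ √(lam / (N + lam)) := by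
    apply Real.le_sqrt_of_sq_le; nlinarith
  have h2 : 1 / (n : ℝ) ≤ (1 + 1 / κ') * (lam / (N + lam)) := by
    rw [← mul_div_assoc, div_le_div_iff₀ (by positivity) (by positivity)]
    have h3 : 1 ≤ lam / κ' := by rwa [one_le_div hκ]
    have h4 : (1 + 1 / κ') * lam * n = lam * n + lam / κ' * n := by field_simp
    rw [h4]
    nlinarith
  have h5 : (1 + 1 / κ') * (lam / (N + lam)) ≤ (1 + 1 / κ') * √(lam / (N + lam)) := by gcongr
  calc 2 / (n : ℝ) = 2 * (1 / n) := by ring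
    _ ≤ 2 * ((1 + 1 / κ') * √(lam / (N + lam))) := by linarith
    _ = _ := by ring

variable {Z A : Type*} [Fintype Z] [Fintype A] {c : ℝ} {lam ζ : ℕ → ℝ} {n : ℕ} {N : ℝ}

lemma mul_bonusScale_eq (hc : 0 < c) (hN : 0 ≤ N) (hlam : 0 < lam n) :
    c * (bonusScale Z A c lam ζ n * √((N + lam n)⁻¹)) =
      √((n * (Fintype.card A : ℝ) ^ 2 * ζ n + 4 * lam n * (Fintype.card Z * Fintype.card A)
        + n * ζ n) / (N + lam n)) := by
  have : 0 ≤ (N + lam n)⁻¹ := by positivity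
  rw [bonusScale, div_eq_mul_inv _ (N + lam n), Real.sqrt_mul' _ this]
  field_simp

variable [Nonempty Z] [Nonempty A]

lemma one_le_card_mul_card : (1 : ℝ) ≤ Fintype.card Z * Fintype.card A := by
  have : 1 ≤ Fintype.card Z * Fintype.card A := Nat.mul_pos Fintype.card_pos Fintype.card_pos
  exact_mod_cast this

/-- Uses only the term `4 λ d` of the bonus multiplier, with `d ≥ 1`. -/
lemma two_mul_sqrt_le_bonusScale (hc : 0 < c) (hN : 0 ≤ N) (hlam : 0 < lam n) (hζ : 0 ≤ ζ n) :
    2 * √(lam n / (N + lam n)) ≤ c * (bonusScale Z A c lam ζ n * √((N + lam n)⁻¹)) := by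
  rw [mul_bonusScale_eq hc hN hlam]
  have h4 : (2 : ℝ) = √(2 ^ 2) := (Real.sqrt_sq (by norm_num)).symm
  rw [h4, ← Real.sqrt_mul (by positivity)]
  apply Real.sqrt_le_sqrt
  rw [← mul_div_assoc]
  have hd := one_le_card_mul_card (Z := Z) (A := A)
  gcongr
  have h1 : 0 ≤ n * (Fintype.card A : ℝ) ^ 2 * ζ n := by positivity
  have h2 : 0 ≤ n * ζ n := by positivity
  nlinarith

/-- The terms are matched with those under the root of the multiplier, `|A| nζ` being at most `|A|²
nζ`; the constant `K + 5` covers every coefficient. -/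
lemma le_bonusScale_of_sq_le (hc : 0 < c) (hN : 0 ≤ N) (hlam : 0 < lam n) (hζ : 0 ≤ ζ n)
    {K y : ℝ} (hK : 0 ≤ K) (hy : (N + lam n) * y ^ 2 ≤
      4 * (n * ζ n) + 4 * (Fintype.card A * (n * ζ n)) + (K + 1) * lam n) :
    y ≤ √(K + 5) * (c * (bonusScale Z A c lam ζ n * √((N + lam n)⁻¹))) := by
  rw [mul_bonusScale_eq hc hN hlam, ← Real.sqrt_mul (by positivity)]
  apply Real.le_sqrt_of_sq_le
  rw [← mul_div_assoc, le_div_iff₀ (by positivity), mul_comm]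
  refine hy.trans ?_
  have hd := one_le_card_mul_card (Z := Z) (A := A)
  have hA : (1 : ℝ) ≤ Fintype.card A := by exact_mod_cast Fintype.card_pos
  have hz : 0 ≤ n * ζ n := by positivity
  have h1 : (Fintype.card A : ℝ) * (n * ζ n) ≤ n * (Fintype.card A : ℝ) ^ 2 * ζ n := by
    nlinarith [mul_le_mul_of_nonneg_right hA (mul_nonneg (by linarith : (0 : ℝ) ≤ Fintype.card A) hz)]
  have h2 : lam n ≤ lam n * (Fintype.card Z * Fintype.card A) := by nlinarith
  have h3 : 0 ≤ n * (Fintype.card A : ℝ) ^ 2 * ζ n := by positivity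
  nlinarith

end Numeric

/-! ### One step of the recursion, integrability and greediness -/

section Step

variable {S A Z Ω : Type*} [MeasurableSpace S] [Fintype A] [Nonempty A] [MeasurableSpace A]
  [Fintype Z] [MeasurableSpace Ω]
  {M : BlockMDP S A Z} {Φ : ℕ → Finset (S → Z)} {N : ℕ} {lam alpha : ℕ → ℝ} {μ : Measure Ω}

lemma Run.rhat_eq (R : Run M Φ N lam alpha μ) {n : ℕ} (hlam : 0 < lam n) (ω : Ω) (h : ℕ) (s : S)
    (a : A) : R.rhat n ω h s a = M.r h s a + min (alpha n *
      √((cellCount (R.ψhat n h ω) (collect R.X n h ω) (R.ψhat n h ω s, a) + lam n)⁻¹)) 2 := by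
  rw [Run.rhat, bonusReward, bonus_eq hlam]

lemma Run.rhat_nonneg (R : Run M Φ N lam alpha μ) {n : ℕ} (hlam : 0 < lam n) (hα : 0 ≤ alpha n)
    (ω : Ω) (h : ℕ) (s : S) (a : A) : 0 ≤ R.rhat n ω h s a := by
  rw [R.rhat_eq hlam]
  exact add_nonneg (M.r_nonneg h s a) (le_min (by positivity) zero_le_two)

lemma Run.valueFrom_nonneg (R : Run M Φ N lam alpha μ) {n : ℕ} (hlam : 0 < lam n)
    (hα : 0 ≤ alpha n) (ω : Ω) (π : Policy S A) (k h : ℕ) (s : S) :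
    0 ≤ valueFrom (R.Phat n ω) (R.rhat n ω) π k h s :=
  Briee.valueFrom_nonneg (R.rhat_nonneg hlam hα ω)
    (fun h s a f hf => by rw [R.Phat_eq hlam]; exact cellMean_nonneg hlam _ _ _ hf) π k h s

/-- One step of the optimism recursion: the value lost is at most the error of the model if the
bonus covers the rest. -/
lemma Run.clippedValue_sub_le_gap (R : Run M Φ N lam alpha μ) {n : ℕ} (hlam : 0 < lam n) (ω : Ω)
    (π : Policy S A) {k h : ℕ} (hk : h + (k + 1) = M.H) (s : S)
    (hb : ∀ a, R.predictedValue π n ω h (R.ψhat n h ω s, a) ≤ min (alpha n *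
      √((cellCount (R.ψhat n h ω) (collect R.X n h ω) (R.ψhat n h ω s, a) + lam n)⁻¹)) 2 +
      cellMean (R.ψhat n h ω) (collectAll R.X R.Y n h ω) (lam n) (R.ψhat n h ω s, a)
        (valueFrom (R.Phat n ω) (R.rhat n ω) π k (h + 1))) :
    M.clippedValue π (k + 1) h s - valueFrom (R.Phat n ω) (R.rhat n ω) π (k + 1) h s ≤
      R.gap π n ω h s := by
  have h1 : M.clippedValue π (k + 1) h s ≤ ∑ a, π.prob h s a *
      (M.r h s a + M.trueModel h s a (M.clippedValue π k (h + 1))) := min_le_right _ _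
  have h2 : ∀ a, M.trueModel h s a (M.clippedValue π k (h + 1)) =
      M.latentValue π h (M.ψ h s, a) := by
    intro a
    rw [← M.trueModel_emissionMean (M.measurable_clippedValue π k (h + 1))
      (M.clippedValue_nonneg π k (h + 1)) (M.clippedValue_le_one π k (h + 1)),
      M.trueModel_eq_latentModel, BlockMDP.latentValue, BlockMDP.meanValue,
      show M.H - (h + 1) = k by omega]
  refine (sub_le_sub_right h1 _).trans ?_
  rw [valueFrom, ← Finset.sum_sub_distrib]
  calc _ ≤ ∑ a, π.prob h s a * R.gap π n ω h s := by
        refine Finset.sum_le_sum fun a _ => ?_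
        rw [← mul_sub]
        refine mul_le_mul_of_nonneg_left ?_ (π.nonneg h s a)
        rw [h2, R.rhat_eq hlam, R.Phat_eq hlam]
        have h3 : |M.latentValue π h (M.ψ h s, a) -
            R.predictedValue π n ω h (R.ψhat n h ω s, a)| ≤ R.gap π n ω h s := M.le_maxGap s a
        linarith [hb a, (abs_le.1 h3).2]
    _ = R.gap π n ω h s := by rw [← Finset.sum_mul, π.sum_eq_one, one_mul]

/-- Apart from the policy and the reward at step 0, the value depends on the state only through a
finite decoding, whatever the regularity of the later value functions. -/
lemma Run.integrable_valueFrom (R : Run M Φ N lam alpha μ)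
    (hΦ : ∀ h < M.H, ∀ ψ ∈ Φ h, ∀ z, MeasurableSet (ψ ⁻¹' {z})) {n : ℕ} (hn : 1 ≤ n)
    (hnN : n ≤ N) (hlam : 0 < lam n) (hα : 0 ≤ alpha n) (ω : Ω) (π : Policy S A) :
    Integrable (valueFrom (R.Phat n ω) (R.rhat n ω) π M.H 0) M.d₀ := by
  obtain ⟨k, hk⟩ : ∃ k, M.H = k + 1 := ⟨M.H - 1, by have := M.H_pos; omega⟩
  have hψm := hΦ 0 M.H_pos _ (R.ψhat_mem n hn hnN 0 M.H_pos ω)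
  set f := valueFrom (R.Phat n ω) (R.rhat n ω) π k 1 with hf
  let cm : Z × A → ℝ := fun c =>
    cellMean (R.ψhat n 0 ω) (collectAll R.X R.Y n 0 ω) (lam n) c f
  let b : Z × A → ℝ := fun c => min (alpha n *
    √((cellCount (R.ψhat n 0 ω) (collect R.X n 0 ω) c + lam n)⁻¹)) 2
  have e : ∀ s, valueFrom (R.Phat n ω) (R.rhat n ω) π M.H 0 s = ∑ a, π.prob 0 s a *
      (M.r 0 s a + (b (R.ψhat n 0 ω s, a) + cm (R.ψhat n 0 ω s, a))) := by
    intro s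
    rw [hk, valueFrom]
    refine Finset.sum_congr rfl fun a _ => ?_
    rw [R.rhat_eq hlam, R.Phat_eq hlam, add_assoc]
  have hm : Measurable (valueFrom (R.Phat n ω) (R.rhat n ω) π M.H 0) := by
    rw [funext e]
    exact Finset.measurable_fun_sum _ fun a _ => (π.meas 0 a).mul ((M.r_meas 0 a).add
      (measurable_comp_of_finite hψm fun z => b (z, a) + cm (z, a)))
  -- The 3 is one for the reward and two for the bonus.
  refine integrable_of_mem_Icc hm (R.valueFrom_nonneg hlam hα ω π M.H 0)
    (b := 3 + ∑ c, |cm c|) fun s => ?_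
  rw [e]
  calc _ ≤ ∑ a, π.prob 0 s a * (3 + ∑ c, |cm c|) := by
        refine Finset.sum_le_sum fun a _ => mul_le_mul_of_nonneg_left ?_ (π.nonneg 0 s a)
        have h1 := M.r_zero_le_one s a
        have h2 : b (R.ψhat n 0 ω s, a) ≤ 2 := min_le_right _ _
        have h3 : cm (R.ψhat n 0 ω s, a) ≤ ∑ c, |cm c| := (le_abs_self _).trans
          (Finset.single_le_sum (f := fun c => |cm c|) (fun _ _ => abs_nonneg _)
            (Finset.mem_univ _))
        linarith
    _ = _ := by rw [← Finset.sum_mul, π.sum_eq_one, one_mul]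

lemma Run.value_le_value_lsvi (R : Run M Φ N lam alpha μ)
    (hΦ : ∀ h < M.H, ∀ ψ ∈ Φ h, ∀ z, MeasurableSet (ψ ⁻¹' {z})) {n : ℕ} (hn : 1 ≤ n)
    (hnN : n ≤ N) (hlam : 0 < lam n) (hα : 0 ≤ alpha n) (ω : Ω) (π : Policy S A) :
    M.value (R.Phat n ω) (R.rhat n ω) π ≤ M.value (R.Phat n ω) (R.rhat n ω) (R.πhat n ω) := by
  refine integral_mono (R.integrable_valueFrom hΦ hn hnN hlam hα ω π)
    (R.integrable_valueFrom hΦ hn hnN hlam hα ω _) fun s => ?_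
  have h1 : valueFrom (R.Phat n ω) (R.rhat n ω) (R.πhat n ω) M.H 0 = _ :=
    lsviV_le_valueFrom_of_isLSVI _ _ _ (R.πhat_lsvi n hn hnN ω) M.H 0 (by omega)
  rw [h1]
  exact valueFrom_le_lsviV hlam _ _ _ π M.H 0 s

end Step

/-! ### The optimism recursion -/

section Optimism

variable {S A Z Ω : Type*} [MeasurableSpace S] [Fintype A] [Nonempty A] [MeasurableSpace A]
  [Fintype Z] [Nonempty Z] [MeasurableSpace Ω]
  {M : BlockMDP S A Z} {Φ : ℕ → Finset (S → Z)} {N : ℕ} {lam ζ : ℕ → ℝ} {c : ℝ} {μ : Measure Ω}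

/-- If the horizon exceeds the number of iterations, the bonuses alone exceed the largest possible
value. -/
lemma Run.one_le_valueFrom (R : Run M Φ N lam (bonusScale Z A c lam ζ) μ) (hc : 0 < c)
    (hc1 : c ≤ 1) {κ' : ℝ} (hκ : 0 < κ') (hcκ : c ≤ √(κ' / (1 + κ'))) {n : ℕ} (hn : 1 ≤ n)
    (hlam : κ' ≤ lam n) (hζ : 0 ≤ ζ n) (hH : n < M.H) (ω : Ω) (π : Policy S A) (s : S) :
    1 ≤ valueFrom (R.Phat n ω) (R.rhat n ω) π M.H 0 s := by
  have hlam0 : 0 < lam n := hκ.trans_le hlam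
  have hn' : (1 : ℝ) ≤ n := by exact_mod_cast hn
  -- The net gain per step. The bonus is at least `2 q / c` or equal to 2, with `q = √(λ/(count +
  -- λ))`. A part `q²` pays for the mass that regularization removes from the level `w ≤ 1`, and at
  -- least `β` is left because counts are at most `n`.
  set β := min 1 (√(lam n / (n + lam n)) / c) with hβ
  have hβ0 : 0 ≤ β := le_min zero_le_one (by positivity)
  have hHβ : 1 ≤ (M.H : ℝ) * β := by
    have hHn : (n : ℝ) + 1 ≤ M.H := by exact_mod_cast hH
    rcases le_total 1 (√(lam n / (n + lam n)) / c) with h1 | h1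
    · rw [hβ, min_eq_left h1]; linarith
    · rw [hβ, min_eq_right h1, ← mul_div_assoc, one_le_div hc]
      refine hcκ.trans ?_
      -- As `H > n ≥ √n`, the total gain times `c` is at least `√(n λ/(n+λ))`, which is smallest at
      -- `n = 1`, `λ = κ'`.
      have h2 : √(κ' / (1 + κ')) ≤ √(n * (lam n / (n + lam n))) := by
        apply Real.sqrt_le_sqrt
        rw [← mul_div_assoc, div_le_div_iff₀ (by positivity) (by positivity)]
        nlinarith [mul_nonneg hκ.le (sub_nonneg.2 hn'), mul_nonneg (sub_nonneg.2 hlam)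
          (by linarith : (0 : ℝ) ≤ n), mul_nonneg hlam0.le (mul_nonneg hκ.le (sub_nonneg.2 hn'))]
      refine h2.trans ?_
      rw [Real.sqrt_mul (by positivity)]
      gcongr
      calc √(n : ℝ) ≤ n := by
            rw [Real.sqrt_le_left (by positivity)]; nlinarith
        _ ≤ M.H := by linarith
  have hmain := min_le_valueFrom (P := R.Phat n ω) (r := R.rhat n ω) hβ0 ?_ π M.H 0 s
  · rwa [min_eq_left hHβ] at hmain
  · intro h s a f w hw0 hw1 hf
    rw [R.rhat_eq hlam0, R.Phat_eq hlam0]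
    set ψ := R.ψhat n h ω
    set C : ℝ := cellCount ψ (collect R.X n h ω) (ψ s, a) with hC
    set Cb : ℝ := cellCount ψ (collectAll R.X R.Y n h ω) (ψ s, a) with hCb
    have hC0 : 0 ≤ C := cellCount_nonneg _ _ _
    have hCCb : C ≤ Cb := cellCount_collect_le_collectAll _ _ _ _ _ _ _
    have hCn : C ≤ n := cellCount_collect_le _ _ _ _ _ _
    set q := √(lam n / (C + lam n)) with hq
    have hq0 : 0 ≤ q := Real.sqrt_nonneg _
    have hq2 : q ^ 2 = lam n / (C + lam n) := Real.sq_sqrt (by positivity)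
    have hq1 : q ≤ 1 := by
      rw [hq, Real.sqrt_le_left zero_le_one, one_pow, div_le_one (by positivity)]; linarith
    have hqβ : β ≤ q / c := (min_le_right _ _).trans (by
      gcongr
      apply Real.sqrt_le_sqrt
      gcongr)
    have hqc : q ≤ q / c := by rw [le_div_iff₀ hc]; nlinarith
    have hη := two_mul_sqrt_le_bonusScale (Z := Z) (A := A) (ζ := ζ) hc hC0 hlam0 hζ
    rw [← hq] at hη
    set η := bonusScale Z A c lam ζ n * √((C + lam n)⁻¹)
    have hη2 : 2 * (q / c) ≤ η := by
      rw [← mul_div_assoc, div_le_iff₀ hc]; linarith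
    have hmean : w - q ^ 2 ≤ cellMean ψ (collectAll R.X R.Y n h ω) (lam n) (ψ s, a) f := by
      refine le_trans ?_ (cellMean_mono hlam0 _ _ _ hf)
      rw [cellMean_const, ← hCb, hq2]
      have hCbp : 0 < Cb + lam n := by linarith
      have h1 : Cb / (Cb + lam n) = 1 - lam n / (Cb + lam n) := by field_simp; ring
      have h2 : lam n / (Cb + lam n) ≤ lam n / (C + lam n) := by gcongr
      have h3 : 0 ≤ lam n / (Cb + lam n) := by positivity
      rw [h1]
      nlinarith
    have hbon : β + q ^ 2 ≤ min η 2 := by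
      have hqq : q ^ 2 ≤ q := by nlinarith
      refine le_min (by linarith) ?_
      have : β ≤ 1 := min_le_left _ _
      linarith
    linarith [M.r_nonneg h s a]

/-- The bonus covers the difference between the predicted value and the value in the learned
model, if the latter satisfies the induction hypothesis at the next step. -/
lemma Run.predictedValue_le [MeasurableSingletonClass A]
    (R : Run M Φ N lam (bonusScale Z A c lam ζ) μ)
    (hΦ : ∀ h < M.H, ∀ ψ ∈ Φ h, ∀ z, MeasurableSet (ψ ⁻¹' {z})) (hψ : ∀ h < M.H, M.ψ h ∈ Φ h)
    (π : Policy S A) {n : ℕ} (hn : 1 ≤ n) (hnN : n ≤ N) {κ' K : ℝ} (hκ : 0 < κ')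
    (hlam : κ' ≤ lam n) {ω : Ω} (hζ : 0 ≤ ζ n) (hg : R.Guarantee (ζ n) n ω) (hK : 0 ≤ K)
    (hc : 0 < c) (hcK : c * (2 * (1 + K) + (1 + 1 / κ') + √(K + 5)) ≤ 1)
    (hconc : R.Concentrated K (M.testFunctions Φ π n) n ω) {h : ℕ} (hh : h + 1 < M.H)
    {V : S → ℝ} (hV0 : ∀ s, 0 ≤ V s)
    (hV : ∀ s, M.clippedValue π (M.H - (h + 1)) (h + 1) s - V s ≤ R.gap π n ω (h + 1) s)
    (x : Z × A) :
    R.predictedValue π n ω h x ≤ min (bonusScale Z A c lam ζ n *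
      √((cellCount (R.ψhat n h ω) (collect R.X n h ω) x + lam n)⁻¹)) 2 +
      cellMean (R.ψhat n h ω) (collectAll R.X R.Y n h ω) (lam n) x V := by
  classical
  have hlam0 : 0 < lam n := hκ.trans_le hlam
  have hgapm := R.cellMean_gap_le hΦ π hn hnN hlam0 hK hconc hh x
  have hsq := R.sq_cellMean_gap_le hΦ hψ π hn hnN hlam0 hζ hg hK hconc hh x
  set ψ := R.ψhat n h ω with hψdef
  set D := collectAll R.X R.Y n h ω with hD
  set C : ℝ := cellCount ψ (collect R.X n h ω) x with hC
  have hC0 : 0 ≤ C := cellCount_nonneg _ _ _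
  have hCn : C ≤ n := cellCount_collect_le _ _ _ _ _ _
  have hy := le_bonusScale_of_sq_le (Z := Z) (A := A) hc hC0 hlam0 hζ hK hsq
  have hη := two_mul_sqrt_le_bonusScale (Z := Z) (A := A) (ζ := ζ) hc hC0 hlam0 hζ
  have h2n := two_div_le_scale hκ hlam hn hC0 hCn
  set q := √(lam n / (C + lam n)) with hq
  set η := bonusScale Z A c lam ζ n * √((C + lam n)⁻¹) with hηdef
  have hη0 : 0 ≤ η := by
    have h1 : 0 ≤ c * η := le_trans (by positivity) hη
    exact nonneg_of_mul_nonneg_right h1 hc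
  set U := M.clippedValue π (M.H - (h + 1)) (h + 1) with hU
  -- Only upper deviations are controlled, so the lower bound on the average of `U` is obtained from
  -- `1 - U`.
  have hmem : (fun s => 1 - U s) ∈ M.testFunctions Φ π n h := by
    rw [BlockMDP.testFunctions, if_pos hh]
    exact Finset.mem_insert_self _ _
  have hUconc := R.cellMean_le_of_concentrated hK hlam0 hconc (by omega)
    (R.ψhat_mem n hn hnN h (by omega) ω) x hmem
  rw [← hψdef, ← hD, ← hC, ← hq] at hUconc
  have hEm : ∀ s, M.emissionMean (h + 1) (fun s => 1 - U s) s = 1 - M.meanValue π (h + 1) s := by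
    intro s
    rw [BlockMDP.emissionMean, integral_sub (integrable_const _) (M.integrable_clippedValue π _ _ _)]
    simp [BlockMDP.meanValue, BlockMDP.emissionMean]
  have e1 : cellMean ψ D (lam n) x (fun s => 1 - U s) =
      cellMean ψ D (lam n) x (fun _ => 1) - cellMean ψ D (lam n) x U := by
    have := cellMean_add (lam := lam n) ψ D x (fun s => 1 - U s) U
    simp only [sub_add_cancel] at this
    linarith
  have e2 : cellMean ψ D (lam n) x (M.emissionMean (h + 1) fun s => 1 - U s) =
      cellMean ψ D (lam n) x (fun _ => 1) - cellMean ψ D (lam n) x (M.meanValue π (h + 1)) := by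
    have := cellMean_add (lam := lam n) ψ D x
      (M.emissionMean (h + 1) fun s => 1 - U s) (M.meanValue π (h + 1))
    simp only [hEm, sub_add_cancel] at this
    linarith
  have e3 : cellMean ψ D (lam n) x U ≤ cellMean ψ D (lam n) x V +
      cellMean ψ D (lam n) x (R.gap π n ω (h + 1)) := by
    rw [← cellMean_add]
    exact cellMean_mono hlam0 _ _ _ fun s => by linarith [hV s]
  have hVm : 0 ≤ cellMean ψ D (lam n) x V := cellMean_nonneg hlam0 _ _ _ hV0
  have hpred : R.predictedValue π n ω h x = cellMean ψ D (lam n) x (M.meanValue π (h + 1)) := rfl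
  rw [← sub_le_iff_le_add]
  -- Against the cap 2 the claim is trivial, as predictions are at most one; the rest concerns the
  -- uncapped bonus.
  refine le_min ?_ ?_
  -- Concentration of `1 - U` and of the gap costs `2 (1 + K) q` each, and rounding costs `2 (1 +
  -- 1/κ') q`, where `2 q ≤ c η`. The transported gap costs `√(K + 5) c η`. By `hcK` the total is at
  -- most `η`.
  · have hcoef : (4 * (1 + K) + 2 * (1 + 1 / κ')) * q ≤
        (2 * (1 + K) + (1 + 1 / κ')) * (c * η) := by
      have h0 : 0 ≤ 2 * (1 + K) + (1 + 1 / κ') := by positivity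
      nlinarith [mul_le_mul_of_nonneg_left hη h0]
    have hfin : (2 * (1 + K) + (1 + 1 / κ')) * (c * η) + √(K + 5) * (c * η) ≤ η := by
      nlinarith [mul_le_mul_of_nonneg_right hcK hη0]
    rw [hpred]
    linarith
  · linarith [(R.predictedValue_mem π hlam0 ω h x).2]

/-- Backward induction starting at the last step, where the next values and the prediction vanish
and nonnegativity of the bonus is enough. Hence the form with `k + 1` steps to go. -/
lemma Run.clippedValue_sub_valueFrom_le [MeasurableSingletonClass A]
    (R : Run M Φ N lam (bonusScale Z A c lam ζ) μ)
    (hΦ : ∀ h < M.H, ∀ ψ ∈ Φ h, ∀ z, MeasurableSet (ψ ⁻¹' {z})) (hψ : ∀ h < M.H, M.ψ h ∈ Φ h)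
    (π : Policy S A) {n : ℕ} (hn : 1 ≤ n) (hnN : n ≤ N) {κ' K : ℝ} (hκ : 0 < κ')
    (hlam : κ' ≤ lam n) {ω : Ω} (hζ : 0 ≤ ζ n) (hg : R.Guarantee (ζ n) n ω) (hK : 0 ≤ K)
    (hc : 0 < c) (hcK : c * (2 * (1 + K) + (1 + 1 / κ') + √(K + 5)) ≤ 1)
    (hconc : R.Concentrated K (M.testFunctions Φ π n) n ω) (k : ℕ) {h : ℕ}
    (hk : h + (k + 1) = M.H) (s : S) :
    M.clippedValue π (k + 1) h s - valueFrom (R.Phat n ω) (R.rhat n ω) π (k + 1) h s ≤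
      R.gap π n ω h s := by
  have hlam0 : 0 < lam n := hκ.trans_le hlam
  have hα : 0 ≤ bonusScale Z A c lam ζ n := div_nonneg (Real.sqrt_nonneg _) hc.le
  induction k generalizing h s with
  | zero =>
    refine R.clippedValue_sub_le_gap hlam0 ω π hk s fun a => ?_
    have h0 : R.predictedValue π n ω h (R.ψhat n h ω s, a) = 0 := by
      rw [Run.predictedValue, show h + 1 = M.H by omega, M.meanValue_horizon, cellMean_const,
        mul_zero]
    rw [h0]
    exact add_nonneg (le_min (by positivity) zero_le_two)
      (cellMean_nonneg hlam0 _ _ _ (R.valueFrom_nonneg hlam0 hα ω π 0 (h + 1)))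
  | succ k ih =>
    refine R.clippedValue_sub_le_gap hlam0 ω π hk s fun a => ?_
    refine R.predictedValue_le hΦ hψ π hn hnN hκ hlam hζ hg hK hc hcK hconc (by omega)
      (R.valueFrom_nonneg hlam0 hα ω π (k + 1) (h + 1)) (fun s' => ?_) _
    rw [show M.H - (h + 1) = k + 1 by omega]
    exact ih (by omega) s'

/-- Almost optimism of any policy at an iteration whose data concentrate. -/
lemma Run.value_sub_le [MeasurableSingletonClass A]
    (R : Run M Φ N lam (bonusScale Z A c lam ζ) μ)
    (hΦ : ∀ h < M.H, ∀ ψ ∈ Φ h, ∀ z, MeasurableSet (ψ ⁻¹' {z})) (hψ : ∀ h < M.H, M.ψ h ∈ Φ h)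
    (π : Policy S A) {n : ℕ} (hn : 1 ≤ n) (hnN : n ≤ N) {κ' K : ℝ} (hκ : 0 < κ')
    (hlam : κ' ≤ lam n) {ω : Ω} (hζ : 0 ≤ ζ n) (hg : R.Guarantee (ζ n) n ω) (hK : 0 ≤ K)
    (hc : 0 < c) (hc1 : c ≤ 1) (hcκ : c ≤ √(κ' / (1 + κ')))
    (hcK : c * (2 * (1 + K) + (1 + 1 / κ') + √(K + 5)) ≤ 1)
    (hconc : M.H ≤ n → R.Concentrated K (M.testFunctions Φ π n) n ω) :
    M.value M.trueModel M.r π - √(Fintype.card A * ζ n) ≤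
      M.value (R.Phat n ω) (R.rhat n ω) π := by
  have hlam0 : 0 < lam n := hκ.trans_le hlam
  have hα : 0 ≤ bonusScale Z A c lam ζ n := div_nonneg (Real.sqrt_nonneg _) hc.le
  have hVi := R.integrable_valueFrom hΦ hn hnN hlam0 hα ω π
  have hUi := M.integrable_clippedValue π M.H 0 M.d₀
  rw [M.value_eq_clipped]
  by_cases hH : M.H ≤ n
  · obtain ⟨k, hk⟩ : ∃ k, M.H = k + 1 := ⟨M.H - 1, by have := M.H_pos; omega⟩
    have hgm := R.measurable_gap hΦ π hn hnN ω M.H_pos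
    have hg0 := R.gap_nonneg π n ω 0
    have hg1 := R.gap_le_one π hlam0 ω 0
    have hgi := integrable_of_mem_Icc (ν := M.d₀) hgm hg0 hg1
    have hpt : ∀ s, M.clippedValue π M.H 0 s ≤
        valueFrom (R.Phat n ω) (R.rhat n ω) π M.H 0 s + R.gap π n ω 0 s := by
      intro s
      have := R.clippedValue_sub_valueFrom_le hΦ hψ π hn hnN hκ hlam hζ hg hK hc hcK (hconc hH) k
        (h := 0) (by omega) s
      rw [hk]
      linarith
    have h1 := integral_mono hUi (hVi.add hgi) hpt
    simp only [Pi.add_apply] at h1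
    rw [integral_add hVi hgi] at h1
    -- At step 0 every policy has state law `d₀`, so the `n` summands in the `ρ`-guarantee coincide
    -- and the factor `n` cancels.
    have h2 : ∫ s, R.gap π n ω 0 s ∂M.d₀ ≤ √(Fintype.card A * ζ n) := by
      apply Real.le_sqrt_of_sq_le
      refine (sq_integral_le hgm hg0 hg1).trans ?_
      refine (integral_sq_maxGap_le (M.latentValue_mem π 0) (R.predictedValue_mem π hlam0 ω 0)
        (hΦ 0 M.H_pos _ (R.ψhat_mem n hn hnN 0 M.H_pos ω)) M.d₀).trans ?_
      gcongr
      have h3 := (R.sum_sq_error_le hΦ hψ π hn hnN hlam0 hζ hg M.H_pos).1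
      simp only [BlockMDP.stateDist, Finset.sum_const, Finset.card_range, nsmul_eq_mul] at h3
      exact le_of_mul_le_mul_left h3 (by exact_mod_cast hn)
    have h4 : M.value (R.Phat n ω) (R.rhat n ω) π =
      ∫ s, valueFrom (R.Phat n ω) (R.rhat n ω) π M.H 0 s ∂M.d₀ := rfl
    linarith
  · have h1 : ∫ s, M.clippedValue π M.H 0 s ∂M.d₀ ≤ M.value (R.Phat n ω) (R.rhat n ω) π :=
      integral_mono hUi hVi fun s => (M.clippedValue_le_one π _ _ s).trans
        (R.one_le_valueFrom hc hc1 hκ hcκ hn hlam hζ (not_le.1 hH) ω π s)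
    linarith [Real.sqrt_nonneg (Fintype.card A * ζ n)]

end Optimism

lemma sqrt_mul_le_rate {a d B x ζ : ℝ} (ha : 0 ≤ a) (hd : 0 ≤ d) (hB : 0 ≤ B) (hx : 0 ≤ x)
    (hζ : ζ ≤ B * d ^ 2 * √x) : √(a * ζ) ≤ √B * (√a * d * x ^ (1 / 4 : ℝ)) := by
  have h1 : x ^ (1 / 4 : ℝ) = √(√x) := by
    rw [Real.sqrt_eq_rpow, Real.sqrt_eq_rpow, ← Real.rpow_mul hx]
    norm_num
  calc √(a * ζ) ≤ √(a * (B * d ^ 2 * √x)) := by gcongr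
    _ = √B * (√a * d * x ^ (1 / 4 : ℝ)) := by
      rw [h1, Real.sqrt_mul ha, Real.sqrt_mul (by positivity), Real.sqrt_mul hB, Real.sqrt_sq hd]
      ring

end Briee

end

/-! ### Choice of constants and conclusion -/

theorem lemma4 :
    ∀ κ : ℝ, 0 < κ → ∃ c₀ : ℝ, 0 < c₀ ∧ ∀ c : ℝ, 0 < c → c ≤ c₀ →
    ∀ (S A Z Ω : Type*) [MeasurableSpace S]
      [Fintype A] [Nonempty A] [MeasurableSpace A] [MeasurableSingletonClass A]
      [Fintype Z] [Nonempty Z] [MeasurableSpace Ω]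
      (M : Briee.BlockMDP S A Z) (Φ : ℕ → Finset (S → Z)),
      (∀ h < M.H, ∀ ψ ∈ Φ h, ∀ z, MeasurableSet (ψ ⁻¹' {z})) →
      (∀ h < M.H, M.ψ h ∈ Φ h) →
    ∀ δ : ℝ, 0 < δ → δ < 1 → 2 * δ ≤ Briee.classSize M.H Φ →
    ∀ (N : ℕ) (lam ζ : ℕ → ℝ),
      (∀ n, 1 ≤ n → n ≤ N →
        κ * (Fintype.card Z * Fintype.card A) * Real.log (Briee.classSize M.H Φ * n / δ)
          ≤ lam n) →
      (∀ n, 0 ≤ ζ n) →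
    ∀ (μ : Measure Ω) [IsProbabilityMeasure μ]
      (R : Briee.Run M Φ N lam (Briee.bonusScale Z A c lam ζ) μ)
      (πstar : Briee.Policy S A), M.IsOptimal πstar →
    ∃ G : Set Ω, MeasurableSet G ∧ ENNReal.ofReal (1 - δ) ≤ μ G ∧
      ∀ ω ∈ G, ∀ n, 1 ≤ n → n ≤ N → R.Guarantee (ζ n) n ω →
        M.value M.trueModel M.r πstar - √(Fintype.card A * ζ n)
            ≤ M.value (R.Phat n ω) (R.rhat n ω) πstar ∧
        M.value M.trueModel M.r πstar - √(Fintype.card A * ζ n)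
            ≤ M.value (R.Phat n ω) (R.rhat n ω) (R.πhat n ω) ∧
        (∀ B : ℝ, 0 ≤ B →
          ζ n ≤ B * (Fintype.card Z * Fintype.card A : ℝ) ^ 2
              * √(Real.log (n * Briee.classSize M.H Φ / δ) / n) →
          M.value M.trueModel M.r πstar
              - √B * (√(Fintype.card A) * (Fintype.card Z * Fintype.card A)
                * (Real.log (n * Briee.classSize M.H Φ / δ) / n) ^ (1 / 4 : ℝ))
            ≤ M.value (R.Phat n ω) (R.rhat n ω) (R.πhat n ω)) := by
  intro κ hκ
  -- A lower bound for every `λ_n`: the argument of the logarithm is at least 2, by `2δ ≤ |Φ|`, and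
  -- `d ≥ 1`.
  set κ' : ℝ := κ * Real.log 2 with hκ'
  have hκ'0 : 0 < κ' := mul_pos hκ (Real.log_pos one_lt_two)
  set K : ℝ := 12 / κ with hK
  have hK0 : 0 ≤ K := by positivity
  set Q : ℝ := 2 * (1 + K) + (1 + 1 / κ') + √(K + 5) with hQ
  have hQ0 : 0 < Q := by positivity
  -- The first two bounds serve iterations with `n < H`, and `1 / Q` lets the bonus absorb all
  -- errors when `H ≤ n`. All three depend on `κ` only.
  refine ⟨min (min 1 √(κ' / (1 + κ'))) (1 / Q), by positivity, ?_⟩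
  intro c hc hc₀ S A Z Ω _ _ _ _ _ _ _ _ M Φ hΦ hψ δ hδ0 hδ1 hδΦ N lam ζ hlam hζ μ _ R πstar _
  have hc1 : c ≤ 1 := hc₀.trans ((min_le_left _ _).trans (min_le_left _ _))
  have hcκ : c ≤ √(κ' / (1 + κ')) := hc₀.trans ((min_le_left _ _).trans (min_le_right _ _))
  have hcQ : c * Q ≤ 1 := by
    have := hc₀.trans (min_le_right _ _)
    rwa [le_div_iff₀ hQ0] at this
  set C := Briee.classSize M.H Φ with hC
  have hcard : ∀ h < M.H, (Φ h).card ≤ C := fun h hh =>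
    Finset.le_sup (f := fun h => (Φ h).card) (Finset.mem_range.2 hh)
  have hx : ∀ n : ℕ, 1 ≤ n → 2 ≤ (C : ℝ) * n / δ := by
    intro n hn
    have hn' : (1 : ℝ) ≤ n := by exact_mod_cast hn
    rw [le_div_iff₀ hδ0]
    nlinarith
  have hlam' : ∀ n, 1 ≤ n → n ≤ N → κ' ≤ lam n := by
    intro n h1 h2
    refine le_trans ?_ (hlam n h1 h2)
    have hl : Real.log 2 ≤ Real.log (C * n / δ) := Real.log_le_log two_pos (hx n h1)
    have hl0 : 0 ≤ Real.log 2 := (Real.log_pos one_lt_two).le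
    have hd := Briee.one_le_card_mul_card (Z := Z) (A := A)
    calc κ' = κ * 1 * Real.log 2 := by rw [hκ', mul_one]
      _ ≤ _ := by gcongr
  -- The test functions are built from `πstar`, which is fixed before the data; one event serves all
  -- iterations.
  obtain ⟨G, hGm, hGμ, hG⟩ := R.exists_event hΦ hκ hδ0 hδ1 hcard hδΦ
    (fun n h1 h2 => hκ'0.trans_le (hlam' n h1 h2)) hlam
    (𝒢 := fun n => M.testFunctions Φ πstar n)
    (fun n h _ => Briee.BlockMDP.card_testFunctions_le πstar n hcard h)
    (fun n h _ G hG => Briee.BlockMDP.testFunctions_mem hΦ πstar n h hG)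
  refine ⟨G, hGm, hGμ, fun ω hω n h1 h2 hg => ?_⟩
  have hstar := R.value_sub_le hΦ hψ πstar h1 h2 hκ'0 (hlam' n h1 h2) (hζ n) hg hK0 hc hc1 hcκ
    hcQ (hG ω hω n h1 h2)
  have hhat := hstar.trans (R.value_le_value_lsvi hΦ h1 h2 (hκ'0.trans_le (hlam' n h1 h2))
    (div_nonneg (Real.sqrt_nonneg _) hc.le) ω πstar)
  refine ⟨hstar, hhat, fun B hB hζB => le_trans (sub_le_sub_left ?_ _) hhat⟩
  refine Briee.sqrt_mul_le_rate (Nat.cast_nonneg _) (by positivity) hB ?_ hζB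
  refine div_nonneg (Real.log_nonneg ?_) (Nat.cast_nonneg n)
  rw [mul_comm (n : ℝ)]
  linarith [hx n h1]
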